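/- Let $p$ be a prime, let $E/\mathbb Q_p$ be a quadratic extension with ring of integers $\mathcal O_E$, maximal ideal $\mathfrak p$ and ramification index $e\in\{1,2\}$, and let $\delta$ be the $p$-adic valuation of the discriminant of $E/\mathbb Q_p$. Let $\epsilon_E:\mathbb Q_p^\times\to\{\pm1\}$ be the quadratic character attached to $E/\mathbb Q_p$ by local class field theory, i.e. the character with kernel $\mathrm N_{E/\mathbb Q_p}(E^\times)$. A character $\theta:E^\times\to\mathbb C^\times$ (a continuous homomorphism) has conductor $n$ (it is primitive of conductor $n$) if $n\ge 0$ is the least integer such that $\theta$ is trivial on $U^n$, where $U^0=\mathcal O_E^\times$ and $U^n=1+\mathfrak p^n$ for $n\ge1$. The inertial type of $\theta$ is its restriction to $\mathcal O_E^\times$, and two inertial types are in the same Galois orbit if they are conjugate under some $\sigma\in\mathrm{Aut}_{\mathbb Q}(\mathbb C)$. Let $c_n$ be the number of Galois orbits of inertial types of characters $\theta$ of $E^\times$ of conductor $n$ with $\theta|_{\mathbb Q_p^\times}=\epsilon_E$, and let $\sigma_0(a)$ be the number of positive divisors of $a$. Then: 1. If $e=1$ and $p\ne2$, then $c_n=\sigma_0(p+1)$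 for all $n\ge2$; moreover $c_0=1$ and $c_1=\sigma_0(p+1)-1$ (so that there are $\sigma_0(p+1)$ orbits of conductor at most $1$). 2. If $e=1$ and $p=2$, then $c_n=4$ for all $n\ge3$. 3. If $e=2$ and $p\ne2$, then $c_1=1$. 4. If $e=2$, $p\ne2$ and $E\ne\mathbb Q_3(\sqrt{-3})$, then for $n\ge2$, $c_n=0$ if $n$ is odd and $c_n=1$ if $n$ is even. 5. If $e=2$, $p=2$ and $\delta=3$, then $c_5=3$, and for $n\ge6$, $c_n=0$ if $n$ is odd and $c_n=1$ if $n$ is even. 6. If $E=\mathbb Q_3(\sqrt{-3})$, then $c_2=1$, and for $n\ge3$, $c_n=0$ if $n$ is odd and $c_n=3$ if $n$ is even. 7. If $e=2$, $p=2$ and $\delta=2$, then $c_3=c_4=1$, and for $n\ge6$, $c_n=0$ if $n$ is odd and $c_n=2$ if $n$ is even. -/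

import Mathlib

open IsLocalRing

noncomputable section

namespace LocalChar

variable (p : ℕ) [Fact p.Prime] (E : Type*) [Field E] [Algebra ℚ_[p] E] [Algebra ℤ_[p] E]
  [IsScalarTower ℤ_[p] ℚ_[p] E]

/-- The ring of integers of an extension `E` of `ℚ_p`: the integral closure of `ℤ_p` in `E`. -/
abbrev RingOfInt : Subalgebra ℤ_[p] E := integralClosure ℤ_[p] E

/-- An element of a finite extension of `ℚ_p` is integral iff its (spectral) norm is at most `1`. -/
theorem isIntegral_iff_spectralNorm_le_one [FiniteDimensional ℚ_[p] E] (x : E) :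
    IsIntegral ℤ_[p] x ↔ spectralNorm ℚ_[p] E x ≤ 1 := by
  have hx : IsIntegral ℚ_[p] x := Algebra.IsIntegral.isIntegral x
  rw [spectralNorm, spectralValue_le_one_iff (minpoly.monic hx)]
  constructor
  · intro h n
    rw [minpoly.isIntegrallyClosed_eq_field_fractions' ℚ_[p] h, Polynomial.coeff_map]
    exact PadicInt.norm_le_one _
  · intro h
    have hl : minpoly ℚ_[p] x ∈ Polynomial.lifts (algebraMap ℤ_[p] ℚ_[p]) := by
      rw [Polynomial.lifts_iff_coeff_lifts]
      intro n
      exact ⟨⟨_, h n⟩, rfl⟩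
    obtain ⟨q, hq, -, hqm⟩ := Polynomial.lifts_and_natDegree_eq_and_monic hl (minpoly.monic hx)
    refine ⟨q, hqm, ?_⟩
    have := minpoly.aeval ℚ_[p] x
    rw [← hq, Polynomial.aeval_map_algebraMap] at this
    exact this

/-- The ring of integers of a finite extension of `ℚ_p` is a local ring. -/
instance isLocalRing_ringOfInt [FiniteDimensional ℚ_[p] E] : IsLocalRing (RingOfInt p E) := by
  have hone : ∀ x : E, spectralNorm ℚ_[p] E x = 1 → IsIntegral ℤ_[p] x⁻¹ := by
    intro x hx
    let : NormedField E := spectralNorm.normedField ℚ_[p] E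
    rw [isIntegral_iff_spectralNorm_le_one]
    have h1 : ‖x‖ = 1 := hx
    have h2 : ‖x⁻¹‖ = 1 := by rw [norm_inv, h1, inv_one]
    exact le_of_eq h2
  have hunit : ∀ x : RingOfInt p E, spectralNorm ℚ_[p] E (x : E) = 1 → IsUnit x := by
    intro x hx
    refine IsUnit.of_mul_eq_one ⟨(x : E)⁻¹, hone x hx⟩ (Subtype.ext ?_)
    have hx0 : (x : E) ≠ 0 := by
      intro h0
      rw [h0, spectralNorm_zero] at hx
      exact zero_ne_one hx
    exact mul_inv_cancel₀ hx0
  refine IsLocalRing.of_isUnit_or_isUnit_one_sub_self fun x => ?_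
  rcases ((isIntegral_iff_spectralNorm_le_one p E (x : E)).1 x.2).eq_or_lt with h | h
  · exact Or.inl (hunit x h)
  · right
    have h1 : spectralNorm ℚ_[p] E ((1 - x : RingOfInt p E) : E) ≤ 1 :=
      (isIntegral_iff_spectralNorm_le_one p E _).1 (1 - x).2
    refine hunit _ (h1.antisymm ?_)
    have h2 := isNonarchimedean_spectralNorm (K := ℚ_[p]) (L := E)
      ((1 - x : RingOfInt p E) : E) (x : E)
    have h3 : ((1 - x : RingOfInt p E) : E) + (x : E) = 1 := by simp
    rw [h3, spectralNorm_one] at h2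
    rcases le_max_iff.1 h2 with h4 | h4
    · exact h4
    · exact absurd h4 (not_le.2 h)

/-- `E/ℚ_p` has discriminant of valuation `δ`: for a basis of the ring of integers over `ℤ_p`, the
discriminant of that basis has `p`-adic valuation `δ`. Any two integral bases have discriminants that
differ by the square of a unit, so `δ` does not depend on the basis. -/
def HasDiscrValuation (δ : ℕ) : Prop :=
  ∃ b : Module.Basis (Fin (Module.finrank ℚ_[p] E)) ℤ_[p] (RingOfInt p E),
    (Algebra.discr ℤ_[p] b).valuation = δ

/-- The inclusion of the unit group of the ring of integers into `E^×`. -/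
def unitsIncl : (RingOfInt p E)ˣ →* Eˣ :=
  Units.map (algebraMap (RingOfInt p E) E : RingOfInt p E →* E)

/-- The inclusion `ℚ_p^× → E^×`. -/
def baseIncl : ℚ_[p]ˣ →* Eˣ := Units.map (algebraMap ℚ_[p] E : ℚ_[p] →* E)

open Classical in
/-- The quadratic character `ε_E` of `ℚ_p^×` attached to a quadratic extension `E/ℚ_p` by local
class field theory: it is `1` on the norms from `E^×`, and `-1` on the other elements. -/
def quadChar (a : ℚ_[p]ˣ) : ℂˣ :=
  if ∃ y : E, Algebra.norm ℚ_[p] y = (a : ℚ_[p]) then 1 else -1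

variable [FiniteDimensional ℚ_[p] E]

/-- The ramification index of `E/ℚ_p`. -/
def ramIndex : ℕ := (maximalIdeal (RingOfInt p E)).ramificationIdx ℤ_[p]

/-- The unit filtration: `U^m` is the group of the units of the ring of integers that are
congruent to `1` modulo the `m`-th power of the maximal ideal; `U^0` is the whole unit group. -/
def unitFiltration (m : ℕ) : Subgroup (RingOfInt p E)ˣ :=
  (Units.map (Ideal.Quotient.mk (maximalIdeal (RingOfInt p E) ^ m) :
    RingOfInt p E →* RingOfInt p E ⧸ maximalIdeal (RingOfInt p E) ^ m)).ker

/-- The homomorphism `θ : E^× → ℂ^×` has conductor (exponent) `n`, that is, `n` is the least `m`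
such that `θ` is trivial on `U^m`. A homomorphism is continuous iff it is trivial on some `U^m`, so
one that has a conductor is automatically continuous. -/
def HasConductor (θ : Eˣ →* ℂˣ) (n : ℕ) : Prop :=
  IsLeast {m : ℕ | ∀ u ∈ unitFiltration p E m, θ (unitsIncl p E u) = 1} n

/-- The (continuous) characters `θ` of `E^×` of conductor `n` whose restriction to `ℚ_p^×` is the
quadratic character `ε_E`. -/
def PrimChar (n : ℕ) : Type _ :=
  {θ : Eˣ →* ℂˣ //
    (∀ a : ℚ_[p]ˣ, θ (baseIncl p E a) = quadChar p E a) ∧ HasConductor p E θ n}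

/-- Two characters of `E^×` have Galois conjugate inertial types: their restrictions to the unit
group of the ring of integers (the inertia subgroup, by class field theory) are conjugate under an
automorphism of `ℂ` over `ℚ`. -/
def GaloisConjType (θ₁ θ₂ : Eˣ →* ℂˣ) : Prop :=
  ∃ σ : ℂ ≃ₐ[ℚ] ℂ, ∀ u : (RingOfInt p E)ˣ,
    σ (θ₁ (unitsIncl p E u) : ℂ) = (θ₂ (unitsIncl p E u) : ℂ)

/-- Having Galois conjugate inertial types, as an equivalence relation. -/
def orbitSetoid (n : ℕ) : Setoid (PrimChar p E n) where
  r θ₁ θ₂ := GaloisConjType p E θ₁.1 θ₂.1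
  iseqv :=
    { refl := fun _ => ⟨AlgEquiv.refl, fun _ => rfl⟩
      symm := by
        rintro _ _ ⟨σ, h⟩
        exact ⟨σ.symm, fun u => by rw [← h u, AlgEquiv.symm_apply_apply]⟩
      trans := by
        rintro _ _ _ ⟨σ, h⟩ ⟨τ, h'⟩
        exact ⟨σ.trans τ, fun u => by rw [AlgEquiv.trans_apply, h u, h' u]⟩ }

/-- The number (possibly `⊤`) of inertial type Galois orbits of characters of `E^×` of conductor `n`
whose restriction to `ℚ_p^×` is `ε_E`. -/
def orbitCount (n : ℕ) : ℕ∞ := ENat.card (Quotient (orbitSetoid p E n))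

end LocalChar

end

open IsLocalRing

noncomputable section

namespace LocalChar

/-! ### Galois conjugate roots of unity -/

/-! Write the ring of integers `O` as `ℤ_p[w]` with `w² = a + b w`; five normal forms of `(a, b)`
suffice (`exists_isIntegralGenerator`). Restriction to `O^×` loses nothing: a character `ψ` of `O^×`
that agrees with `ε_E` on `ℤ_p^×` extends to `E^×`, since its value at a uniformizer only has to be
a suitable root of a given number. So the task is to count Galois orbits of such `ψ`
(`orbitCount_eq_of_hasOrbitCount`).

As `ψ` is prescribed on `ℤ_p^×`, the groups `U^n` can be replaced by the unit groups `R k` of the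
orders `ℤ_p + p^k O` (`orderUnits`). If `E` is unramified, `ψ` is trivial on `U^n` iff it is trivial
on `R n`. If `E` is ramified and `ε_E` has conductor `c + 1` on `ℤ_p^×`, then `ψ` is trivial on
`U^n` iff `n ≥ 2c + 1` and `ψ x = ε_E (re x)` on `R ⌊n/2⌋` (`trivial_iff_mem_agreeing_of_ramified`).
Hence the least conductor is `2c + 1`, larger odd conductors do not occur, and conductor `2k` means
agreement at level `k` but not at level `k - 1`. The norm forms modulo `p`, `4` or `8` determine
`ε_E` on units, in particular `c`.

From some level `j` on, the quotients `R k / R (k+1)` have order `p` and the `p`-th power map passes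
from each one to the next (`PowFiltration`), so `R j / R k` is cyclic. Therefore `O^× / R k` is
generated by one element `g`, or by `g` and one further element `s`. If `g` suffices, orbits
correspond to the possible orders of `ψ g`, because roots of unity of the same order are conjugate;
for order `m p^k` with `m` prime to `p`, each new level contributes as many orbits as `m` has
divisors (`card_divisors_sdiff`). This covers unramified `E` for odd `p` (`m = p + 1`) and most
ramified `E` (`m = 1`).

A second generator is needed in three cases. For unramified `E/ℚ_2`, `s = √-3` and `ψ s = ±1`
doubles the two orders coming from `m = 3`. For `ℚ_3(√-3)`, `s` is a cube root of unity; once `ψ g`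
is a primitive `3^k`-th root of unity, `k ≥ 1`, the exponent of `ψ s` relative to it is an invariant
with three values. For ramified `E/ℚ_2` with `δ = 2`, `s²` is a unit of `ℤ_2` that is not a norm, so
`ψ s = ±i`; the sign becomes an invariant once the powers of `ψ g` contain `i`. -/

/-- An automorphism of the field of algebraic numbers extends to `ℂ`. -/
theorem exists_ringEquiv_complex_extending
    (τ : algebraicClosure ℚ ℂ ≃+* algebraicClosure ℚ ℂ) :
    ∃ σ : ℂ ≃+* ℂ, ∀ x : algebraicClosure ℚ ℂ, σ (x : ℂ) = (τ x : ℂ) := by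
  obtain ⟨s, hs⟩ := exists_isTranscendenceBasis (algebraicClosure ℚ ℂ) ℂ
  let v : s → ℂ := Subtype.val
  have hv : IsTranscendenceBasis (algebraicClosure ℚ ℂ) v := hs
  have := IsAlgClosed.isAlgClosure_of_transcendence_basis v hv
  -- `τ` acts on the coefficients of polynomials in a transcendence basis. As `ℂ` is an algebraic
  -- closure of this polynomial ring, uniqueness of algebraic closures extends the action to `ℂ`.
  let f : Algebra.adjoin (algebraicClosure ℚ ℂ) (Set.range v) ≃+*
      Algebra.adjoin (algebraicClosure ℚ ℂ) (Set.range v) :=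
    (hv.1.aevalEquiv.symm.toRingEquiv.trans (MvPolynomial.mapEquiv s τ)).trans
      hv.1.aevalEquiv.toRingEquiv
  have hf : ∀ x, f (algebraMap _ _ x) = algebraMap _ _ (τ x) := by
    intro x
    have h1 : hv.1.aevalEquiv.symm (algebraMap _ _ x) = MvPolynomial.C x := by
      rw [AlgEquiv.commutes]; rfl
    have h2 : MvPolynomial.mapEquiv s τ (MvPolynomial.C x) = MvPolynomial.C (τ x) := by
      exact MvPolynomial.map_C τ.toRingHom x
    change hv.1.aevalEquiv (MvPolynomial.mapEquiv s τ (hv.1.aevalEquiv.symm (algebraMap _ _ x))) = _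
    rw [h1, h2]
    exact hv.1.aevalEquiv.commutes (τ x)
  refine ⟨IsAlgClosure.equivOfEquiv ℂ ℂ f, fun x => ?_⟩
  have h := IsAlgClosure.equivOfEquiv_algebraMap ℂ ℂ f (algebraMap _ _ x)
  rw [hf] at h
  exact h

/-- Two roots of unity of the same order are conjugate under an automorphism of `ℂ`. -/
theorem exists_algEquiv_of_orderOf_eq {x y : ℂˣ} (hx : 0 < orderOf x)
    (h : orderOf x = orderOf y) : ∃ σ : ℂ ≃ₐ[ℚ] ℂ, σ (x : ℂ) = y := by
  have hpx : IsPrimitiveRoot (x : ℂ) (orderOf x) :=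
    IsPrimitiveRoot.coe_units_iff.2 (IsPrimitiveRoot.orderOf x)
  have hpy : IsPrimitiveRoot (y : ℂ) (orderOf x) := by
    rw [h]; exact IsPrimitiveRoot.coe_units_iff.2 (IsPrimitiveRoot.orderOf y)
  have hix : IsIntegral ℚ (x : ℂ) := (hpx.isIntegral hx).tower_top
  have hiy : IsIntegral ℚ (y : ℂ) := (hpy.isIntegral hx).tower_top
  let x' : algebraicClosure ℚ ℂ := ⟨x, hix⟩
  let y' : algebraicClosure ℚ ℂ := ⟨y, hiy⟩
  -- Both roots of unity have the same cyclotomic polynomial as minimal polynomial over `ℚ`.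
  have hc : IsConjRoot ℚ y' x' := by
    rw [isConjRoot_def]
    have e1 : minpoly ℚ y' = minpoly ℚ (y : ℂ) :=
      (minpoly.algebraMap_eq (B' := ℂ) Subtype.val_injective y').symm
    have e2 : minpoly ℚ x' = minpoly ℚ (x : ℂ) :=
      (minpoly.algebraMap_eq (B' := ℂ) Subtype.val_injective x').symm
    rw [e1, e2, ← Polynomial.cyclotomic_eq_minpoly_rat hpx hx,
      ← Polynomial.cyclotomic_eq_minpoly_rat hpy hx]
  have : IsAlgClosure ℚ (algebraicClosure ℚ ℂ) := algebraicClosure.isAlgClosure ℚ ℂ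
  obtain ⟨τ, hτ⟩ := isConjRoot_iff_exists_algEquiv.1 hc
  obtain ⟨σ, hσ⟩ := exists_ringEquiv_complex_extending τ.toRingEquiv
  refine ⟨AlgEquiv.ofRingEquiv (f := σ) fun r => by simp, ?_⟩
  have := hσ x'
  change σ (x : ℂ) = _
  rw [show (x : ℂ) = (x' : ℂ) from rfl, this]
  exact congrArg Subtype.val hτ

theorem algEquiv_coe_units_eq_iff (σ : ℂ ≃ₐ[ℚ] ℂ) (x y : ℂˣ) :
    σ (x : ℂ) = y ↔ Units.map (σ : ℂ →* ℂ) x = y := by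
  rw [Units.ext_iff]; rfl

/-! ### Extending characters -/

section Group

variable {G A : Type*} [CommGroup G] [CommGroup A]

/-- A character of `H` extends to the group generated by `H`, `g` and `s`, with prescribed values
at `g` and `s`. -/
theorem exists_extension_two (H : Subgroup G) (φ : H →* A) (g s : G) (N M : ℕ)
    (hmem : ∀ k l : ℤ, g ^ k * s ^ l ∈ H ↔ (N : ℤ) ∣ k ∧ (M : ℤ) ∣ l)
    (hgen : ∀ x : G, ∃ k l : ℤ, ∃ h ∈ H, x = h * (g ^ k * s ^ l)) (x y : A)
    (hx : ∀ h : H, (h : G) = g ^ N → φ h = x ^ N) (hy : ∀ h : H, (h : G) = s ^ M → φ h = y ^ M) :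
    ∃ ψ : G →* A, (∀ h : H, ψ h = φ h) ∧ ψ g = x ∧ ψ s = y := by
  -- `G` is the image of `H × ℤ × ℤ`. The evident character of this product descends to `G` because,
  -- by `hmem`, the kernel only involves exponents divisible by `N` and `M`, where `hx` and `hy`
  -- apply.
  let f : H × Multiplicative ℤ × Multiplicative ℤ →* G :=
    MonoidHom.coprod H.subtype (MonoidHom.coprod (zpowersHom G g) (zpowersHom G s))
  let χ : H × Multiplicative ℤ × Multiplicative ℤ →* A :=
    MonoidHom.coprod φ (MonoidHom.coprod (zpowersHom A x) (zpowersHom A y))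
  have hf : Function.Surjective f := by
    intro z
    obtain ⟨k, l, h, hh, rfl⟩ := hgen z
    exact ⟨(⟨h, hh⟩, Multiplicative.ofAdd k, Multiplicative.ofAdd l), by simp [f]⟩
  have hker : f.ker ≤ χ.ker := by
    rintro ⟨h, k, l⟩ hk
    induction k using Multiplicative.rec with | ofAdd k => ?_
    induction l using Multiplicative.rec with | ofAdd l => ?_
    simp only [MonoidHom.mem_ker, f, χ, MonoidHom.coprod_apply, zpowersHom_apply,
      Subgroup.coe_subtype, toAdd_ofAdd] at hk ⊢
    have h1 : g ^ k * s ^ l = ((h⁻¹ : H) : G) := by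
      rw [Subgroup.coe_inv]; exact eq_inv_of_mul_eq_one_right hk
    obtain ⟨⟨k', rfl⟩, ⟨l', rfl⟩⟩ := (hmem k l).1 (h1 ▸ (h⁻¹).2)
    have hg : g ^ N ∈ H := by
      have := (hmem N 0).2 ⟨dvd_rfl, dvd_zero _⟩
      simpa using this
    have hs : s ^ M ∈ H := by
      have := (hmem 0 M).2 ⟨dvd_zero _, dvd_rfl⟩
      simpa using this
    have h2 : (⟨_, hg⟩ : H) ^ k' * (⟨_, hs⟩ : H) ^ l' = h⁻¹ := by
      apply Subtype.ext
      rw [← h1]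
      simp [zpow_mul]
    have h3 : φ h = (φ (⟨_, hg⟩ : H) ^ k' * φ (⟨_, hs⟩ : H) ^ l')⁻¹ := by
      rw [← map_zpow, ← map_zpow, ← map_mul, h2, map_inv, inv_inv]
    rw [h3, hx ⟨_, hg⟩ rfl, hy ⟨_, hs⟩ rfl]
    simp [zpow_mul]
  refine ⟨MonoidHom.liftOfRightInverse f _ (Function.rightInverse_surjInv hf) ⟨χ, hker⟩, ?_, ?_, ?_⟩
  · intro h
    have := MonoidHom.liftOfRightInverse_comp_apply f _ (Function.rightInverse_surjInv hf)
      ⟨χ, hker⟩ (h, 1, 1)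
    simpa [f, χ] using this
  · have := MonoidHom.liftOfRightInverse_comp_apply f _ (Function.rightInverse_surjInv hf)
      ⟨χ, hker⟩ (1, Multiplicative.ofAdd 1, 1)
    simpa [f, χ] using this
  · have := MonoidHom.liftOfRightInverse_comp_apply f _ (Function.rightInverse_surjInv hf)
      ⟨χ, hker⟩ (1, 1, Multiplicative.ofAdd 1)
    simpa [f, χ] using this

/-- The two-generator statement with second generator `1`. The value `N = 0` is allowed and covers a
generator of infinite order modulo `H`. -/
theorem exists_extension_one (H : Subgroup G) (φ : H →* A) (g : G) (N : ℕ)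
    (hmem : ∀ k : ℤ, g ^ k ∈ H ↔ (N : ℤ) ∣ k)
    (hgen : ∀ x : G, ∃ k : ℤ, ∃ h ∈ H, x = h * g ^ k) (x : A)
    (hx : ∀ h : H, (h : G) = g ^ N → φ h = x ^ N) :
    ∃ ψ : G →* A, (∀ h : H, ψ h = φ h) ∧ ψ g = x := by
  obtain ⟨ψ, h1, h2, -⟩ := exists_extension_two H φ g 1 N 1 (by simpa using hmem)
    (fun z => by obtain ⟨k, h, hh, rfl⟩ := hgen z; exact ⟨k, 0, h, hh, by simp⟩) x 1 hx
    (fun h hh => by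
      have : h = 1 := Subtype.ext (by simpa using hh)
      simp [this])
  exact ⟨ψ, h1, h2⟩

end Group

/-! ### Filtrations with successive quotients of order `p` -/

/-- A decreasing filtration of an abelian group whose successive quotients from level `j` on have
order `p` and are linked by the `p`-th power map. -/
structure PowFiltration {G : Type*} [CommGroup G] (R : ℕ → Subgroup G) (p j : ℕ) : Prop where
  anti : Antitone R
  gen : ∀ i, j ≤ i → ∀ x ∈ R i, ∀ g ∈ R i, g ∉ R (i + 1) → ∃ k : ℕ, x * g ^ k ∈ R (i + 1)
  pow : ∀ i, j ≤ i → ∀ x ∈ R i, x ∉ R (i + 1) → x ^ p ∈ R (i + 1) ∧ x ^ p ∉ R (i + 2)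

namespace PowFiltration

variable {G : Type*} [CommGroup G] {R : ℕ → Subgroup G} {p j : ℕ}

/-- Repeated `p`-th powers of `g` supply an element of exact level `j + i` for every `i`. -/
theorem pow_pow_mem (h : PowFiltration R p j) {g : G} (hg : g ∈ R j) (hg' : g ∉ R (j + 1)) (i : ℕ) :
    g ^ p ^ i ∈ R (j + i) ∧ g ^ p ^ i ∉ R (j + i + 1) := by
  induction i with
  | zero => simpa using ⟨hg, hg'⟩
  | succ i ih =>
    rw [pow_succ, pow_mul]
    exact h.pow (j + i) (by omega) _ ih.1 ih.2

/-- `x` is corrected one level at a time by powers of `g ^ p ^ i`. Thus `R j / R (j + i)` is cyclic,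
generated by `g`. -/
theorem exists_mul_pow_mem (h : PowFiltration R p j) {g : G} (hg : g ∈ R j) (hg' : g ∉ R (j + 1))
    (i : ℕ) {x : G} (hx : x ∈ R j) : ∃ k : ℕ, x * g ^ k ∈ R (j + i) := by
  induction i with
  | zero => exact ⟨0, by simpa using hx⟩
  | succ i ih =>
    obtain ⟨k, hk⟩ := ih
    obtain ⟨h1, h2⟩ := h.pow_pow_mem hg hg' i
    obtain ⟨l, hl⟩ := h.gen (j + i) (by omega) _ hk _ h1 h2
    refine ⟨k + p ^ i * l, ?_⟩
    rwa [pow_add, pow_mul, ← mul_assoc]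

theorem exists_eq_mul_zpow (h : PowFiltration R p j) {g : G} (hg : g ∈ R j) (hg' : g ∉ R (j + 1))
    (i : ℕ) {x : G} (hx : x ∈ R j) : ∃ k : ℤ, ∃ y ∈ R (j + i), x = y * g ^ k := by
  obtain ⟨k, hk⟩ := h.exists_mul_pow_mem hg hg' i hx
  exact ⟨-k, _, hk, by simp⟩

theorem zpow_mem_iff (h : PowFiltration R p j) (hp : p.Prime) {g : G} (hg : g ∈ R j)
    (hg' : g ∉ R (j + 1)) (i : ℕ) (k : ℤ) : g ^ k ∈ R (j + i) ↔ ((p ^ i : ℕ) : ℤ) ∣ k := by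
  have key : orderOf (g : G ⧸ R (j + i)) = p ^ i := by
    rcases i with _ | i
    · simpa [QuotientGroup.eq_one_iff] using hg
    · have := Fact.mk hp
      refine orderOf_eq_prime_pow ?_ ?_
      · rw [← QuotientGroup.mk_pow, QuotientGroup.eq_one_iff]
        exact (h.pow_pow_mem hg hg' i).2
      · rw [← QuotientGroup.mk_pow, QuotientGroup.eq_one_iff]
        exact (h.pow_pow_mem hg hg' (i + 1)).1
  rw [← key, orderOf_dvd_iff_zpow_eq_one, ← QuotientGroup.mk_zpow, QuotientGroup.eq_one_iff]

end PowFiltration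

/-! ### Counting Galois orbits of characters -/

section Count

variable {G : Type*} [CommGroup G]

/-- The set `Y` of characters consists of characters in exactly `N` Galois orbits, distinguished by
a complete invariant. -/
def HasOrbitCount (Y : Set (G →* ℂˣ)) (N : ℕ∞) : Prop :=
  ∃ f : (G →* ℂˣ) → ℕ × ℕ, (∀ ψ₁ ∈ Y, ∀ ψ₂ ∈ Y,
    (f ψ₁ = f ψ₂ ↔ ∃ σ : ℂ ≃ₐ[ℚ] ℂ, ∀ u, σ (ψ₁ u : ℂ) = ψ₂ u)) ∧ (f '' Y).encard = N

theorem hasOrbitCount_empty : HasOrbitCount (∅ : Set (G →* ℂˣ)) 0 :=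
  ⟨fun _ => 0, by simp, by simp⟩

theorem exists_orderOf_eq {d : ℕ} (hd : d ≠ 0) : ∃ x : ℂˣ, orderOf x = d := by
  have h := Complex.isPrimitiveRoot_exp d hd
  refine ⟨(h.isUnit hd).unit, ?_⟩
  have h2 : IsPrimitiveRoot (h.isUnit hd).unit d := IsPrimitiveRoot.coe_units_iff.1 h
  exact h2.eq_orderOf.symm

theorem orderOf_eq_of_algEquiv {σ : ℂ ≃ₐ[ℚ] ℂ} {x y : ℂˣ} (h : σ (x : ℂ) = y) :
    orderOf x = orderOf y := by
  rw [← orderOf_units, ← orderOf_units, ← h]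
  exact (orderOf_injective (σ : ℂ →* ℂ) σ.injective (x : ℂ)).symm

theorem eq_one_or_eq_neg_one_of_sq {y : ℂˣ} (hy : y ^ 2 = 1) : y = 1 ∨ y = -1 := by
  have h := congrArg Units.val hy
  rw [Units.val_pow_eq_pow_val, Units.val_one, sq, mul_self_eq_one_iff] at h
  exact h.imp (fun h => Units.ext h) fun h => Units.ext h

theorem neg_one_ne_one_units : (-1 : ℂˣ) ≠ 1 := fun h => by
  have := congrArg Units.val h
  norm_num at this

theorem sq_eq_neg_one_iff {y : ℂˣ} : y ^ 2 = -1 ↔ orderOf y = 4 := by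
  constructor
  · intro hy
    refine orderOf_eq_prime_pow (p := 2) (n := 1) (by simp [hy]) ?_
    rw [show 2 ^ (1 + 1) = 2 * 2 from rfl, pow_mul, hy]
    simp
  · intro hy
    refine (eq_one_or_eq_neg_one_of_sq ?_).resolve_left fun h1 => ?_
    · rw [← pow_mul, show 2 * 2 = orderOf y from hy.symm, pow_orderOf_eq_one]
    · have := orderOf_dvd_of_pow_eq_one h1
      rw [hy] at this
      norm_num at this

/-- The discrete logarithm of `x` to the base `w`. -/
def dlog (w x : ℂˣ) : ℕ := sInf {i | w ^ i = x}

theorem dlog_pow {w : ℂˣ} {L i : ℕ} (hw : orderOf w = L) (hi : i < L) : dlog w (w ^ i) = i := by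
  refine IsLeast.csInf_eq ⟨rfl, fun j hj => ?_⟩
  by_contra hji
  have : j = i := pow_injOn_Iio_orderOf (by simp; omega) (by simp; omega) hj
  omega

theorem pow_dlog {w x : ℂˣ} {L : ℕ} (hL : L ≠ 0) (hw : orderOf w = L) (hx : x ^ L = 1) :
    w ^ dlog w x = x ∧ dlog w x < L := by
  have : NeZero L := ⟨hL⟩
  have hp : IsPrimitiveRoot w L := hw ▸ IsPrimitiveRoot.orderOf w
  obtain ⟨i, hi, rfl⟩ := hp.eq_pow_of_mem_rootsOfUnity (ξ := x) ((mem_rootsOfUnity _ _).2 hx)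
  rw [dlog_pow hw hi]
  exact ⟨rfl, hi⟩

/-- An automorphism transports the equation `w ^ i = x`, so the exponent of one value relative to
another is a Galois invariant. It separates orbits when two generators are needed. -/
theorem dlog_eq_of_algEquiv {σ : ℂ ≃ₐ[ℚ] ℂ} {w w' x x' : ℂˣ} (hw : σ (w : ℂ) = w')
    (hx : σ (x : ℂ) = x') : dlog w x = dlog w' x' := by
  rw [algEquiv_coe_units_eq_iff] at hw hx
  have hinj : Function.Injective (Units.map (σ : ℂ →* ℂ)) := Units.map_injective σ.injective
  unfold dlog
  congr 1
  ext i
  rw [← hw, ← hx]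
  exact ⟨fun h => by rw [Set.mem_ofPred_eq] at *; rw [← map_pow, h],
    fun h => hinj (by rw [Set.mem_ofPred_eq] at *; rw [map_pow, h])⟩

/-- A decreasing filtration together with a sign function that is multiplicative from level `c`
on. -/
structure SignFiltration (R : ℕ → Subgroup G) (ρ : G → ℂˣ) (c : ℕ) : Prop where
  anti : Antitone R
  mul : ∀ x ∈ R c, ∀ y ∈ R c, ρ (x * y) = ρ x * ρ y
  sign : ∀ x, ρ x = 1 ∨ ρ x = -1

/-- The characters that agree with `ρ` at level `k`. -/
def agreeing (R : ℕ → Subgroup G) (ρ : G → ℂˣ) (k : ℕ) : Set (G →* ℂˣ) :=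
  {ψ | ∀ x ∈ R k, ψ x = ρ x}

variable {R : ℕ → Subgroup G} {ρ : G → ℂˣ} {c k k' : ℕ} {g s : G} {N M N' : ℕ}

namespace SignFiltration

variable (h : SignFiltration R ρ c)
include h

/-- The restriction of the sign function to a level, as a homomorphism. -/
def hom (hk : c ≤ k) : R k →* ℂˣ :=
  MonoidHom.mk' (fun x => ρ x) fun x y => h.mul _ (h.anti hk x.2) _ (h.anti hk y.2)

theorem map_pow_of_mem (hg : g ∈ R c) (n : ℕ) : ρ (g ^ n) = ρ g ^ n :=
  map_pow (h.hom le_rfl) ⟨g, hg⟩ n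

theorem exists_mem_agreeing_two (hk : c ≤ k)
    (hmem : ∀ i j : ℤ, g ^ i * s ^ j ∈ R k ↔ (N : ℤ) ∣ i ∧ (M : ℤ) ∣ j)
    (hgen : ∀ x : G, ∃ i j : ℤ, ∃ y ∈ R k, x = y * (g ^ i * s ^ j)) {x y : ℂˣ}
    (hx : x ^ N = ρ (g ^ N)) (hy : y ^ M = ρ (s ^ M)) :
    ∃ ψ ∈ agreeing R ρ k, ψ g = x ∧ ψ s = y := by
  obtain ⟨ψ, h1, h2, h3⟩ := exists_extension_two (R k) (h.hom hk) g s N M hmem hgen x y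
    (fun z hz => by rw [hx, ← hz]; rfl) (fun z hz => by rw [hy, ← hz]; rfl)
  exact ⟨ψ, fun z hz => h1 ⟨z, hz⟩, h2, h3⟩

/-- The values of `ρ` are `±1`, hence fixed by `σ`, so conjugacy need only be tested at the two
generators. -/
theorem conj_of_two {ψ₁ ψ₂ : G →* ℂˣ} (h₁ : ψ₁ ∈ agreeing R ρ k) (h₂ : ψ₂ ∈ agreeing R ρ k)
    (hgen : ∀ x : G, ∃ i j : ℤ, ∃ y ∈ R k, x = y * (g ^ i * s ^ j)) {σ : ℂ ≃ₐ[ℚ] ℂ}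
    (hg : σ (ψ₁ g : ℂ) = ψ₂ g) (hs : σ (ψ₁ s : ℂ) = ψ₂ s) (u : G) : σ (ψ₁ u : ℂ) = ψ₂ u := by
  rw [algEquiv_coe_units_eq_iff] at *
  obtain ⟨i, j, y, hy, rfl⟩ := hgen u
  have hρ : Units.map (σ : ℂ →* ℂ) (ρ y) = ρ y := by
    rcases h.sign y with h | h <;> rw [h]
    · rw [map_one]
    · apply Units.ext; simp
  simp only [map_mul, map_zpow, hg, hs, h₁ y hy, h₂ y hy, hρ]

theorem agreeing_anti (hk : k' ≤ k) : agreeing R ρ k' ⊆ agreeing R ρ k :=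
  fun _ hψ x hx => hψ x (h.anti hk hx)

/-- Since `s ^ M` already lies in the deeper group `R k`, the group `R k'` is generated by `R k` and
`g ^ N'` alone. The only new condition is the one at `g ^ N'`. -/
theorem mem_agreeing_iff_two (hk' : c ≤ k') (hk : k' ≤ k)
    (hgen : ∀ x : G, ∃ i j : ℤ, ∃ y ∈ R k, x = y * (g ^ i * s ^ j))
    (hmem' : ∀ i j : ℤ, g ^ i * s ^ j ∈ R k' ↔ (N' : ℤ) ∣ i ∧ (M : ℤ) ∣ j)
    (hs : s ^ M ∈ R k) (hρ : ρ (g ^ N') = 1) {ψ : G →* ℂˣ} (hψ : ψ ∈ agreeing R ρ k) :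
    ψ ∈ agreeing R ρ k' ↔ ψ g ^ N' = 1 := by
  have hgk : g ^ N' ∈ R k' := by
    have := (hmem' N' 0).2 ⟨dvd_rfl, dvd_zero _⟩
    simpa using this
  constructor
  · intro h1
    rw [← map_pow, h1 _ hgk, hρ]
  · intro h1 x hx
    obtain ⟨i, j, y, hy, rfl⟩ := hgen x
    have hm : g ^ i * s ^ j ∈ R k' := ((R k').mul_mem_cancel_left (h.anti hk hy)).1 hx
    obtain ⟨⟨i', rfl⟩, ⟨j', rfl⟩⟩ := (hmem' i j).1 hm
    let g' : R k' := ⟨_, hgk⟩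
    let s' : R k' := ⟨_, h.anti hk hs⟩
    let y' : R k' := ⟨y, h.anti hk hy⟩
    have e1 : ρ (y * (g ^ ((N' : ℤ) * i') * s ^ ((M : ℤ) * j'))) =
        h.hom hk' (y' * (g' ^ i' * s' ^ j')) := by
      change _ = ρ _
      simp [g', s', y', zpow_mul]
    have e2 : h.hom hk' g' = 1 := hρ
    have e3 : h.hom hk' s' = ψ s ^ M := by rw [← map_pow, hψ _ hs]; rfl
    have e4 : h.hom hk' y' = ψ y := (hψ y hy).symm
    rw [e1, map_mul (h.hom hk'), map_mul (h.hom hk'), map_zpow (h.hom hk'),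
      map_zpow (h.hom hk'), e2, e3, e4]
    simp [zpow_mul, h1]

/-- When `G / R k` is cyclic, `ψ` is determined by the root of unity `ψ g`, and roots of unity are
conjugate iff their orders agree. The orbits therefore correspond to the admissible orders `D`. -/
theorem hasOrbitCount_of_orderOf (hk : c ≤ k) (hmem : ∀ i : ℤ, g ^ i ∈ R k ↔ (N : ℤ) ∣ i)
    (hgen : ∀ x : G, ∃ i : ℤ, ∃ y ∈ R k, x = y * g ^ i) {Y : Set (G →* ℂˣ)} (D : Finset ℕ)
    (hD0 : 0 ∉ D) (hY : ∀ ψ, ψ ∈ Y ↔ ψ ∈ agreeing R ρ k ∧ orderOf (ψ g) ∈ D)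
    (hD : ∀ x : ℂˣ, orderOf x ∈ D → x ^ N = ρ (g ^ N)) : HasOrbitCount Y D.card := by
  have hgen' : ∀ x : G, ∃ i j : ℤ, ∃ y ∈ R k, x = y * (g ^ i * 1 ^ j) := fun x => by
    obtain ⟨i, y, hy, rfl⟩ := hgen x
    exact ⟨i, 0, y, hy, by simp⟩
  refine ⟨fun ψ => (orderOf (ψ g), 0), fun ψ₁ h₁ ψ₂ h₂ => ⟨fun he => ?_, ?_⟩, ?_⟩
  · have he : orderOf (ψ₁ g) = orderOf (ψ₂ g) := congrArg Prod.fst he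
    have hpos : 0 < orderOf (ψ₁ g) := Nat.pos_of_ne_zero fun h0 => hD0 (h0 ▸ ((hY _).1 h₁).2)
    obtain ⟨σ, hσ⟩ := exists_algEquiv_of_orderOf_eq hpos he
    exact ⟨σ, h.conj_of_two ((hY _).1 h₁).1 ((hY _).1 h₂).1 hgen' hσ (by simp)⟩
  · rintro ⟨σ, hσ⟩
    exact Prod.ext (orderOf_eq_of_algEquiv (hσ g)) rfl
  · have : (fun ψ : G →* ℂˣ => (orderOf (ψ g), 0)) '' Y = (fun d => (d, 0)) '' (D : Set ℕ) := by
      ext z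
      constructor
      · rintro ⟨ψ, hψ, rfl⟩
        exact ⟨_, ((hY _).1 hψ).2, rfl⟩
      · rintro ⟨d, hd, rfl⟩
        obtain ⟨x, rfl⟩ := exists_orderOf_eq (fun h0 : d = 0 => hD0 (h0 ▸ hd))
        obtain ⟨ψ, hψ, hg, -⟩ := h.exists_mem_agreeing_two (s := 1) (M := 1) (y := 1) hk
          (by simpa using hmem) hgen' (hD x hd) (by
            have := h.map_pow_of_mem (one_mem (R c)) 0
            simpa using this.symm)
        exact ⟨ψ, (hY _).2 ⟨hψ, hg ▸ hd⟩, by simp [hg]⟩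
    rw [this, Function.Injective.encard_image (fun _ _ h => congrArg Prod.fst h),
      Set.encard_coe_eq_coe_finsetCard]

theorem hasOrbitCount_agreeing (hk : c ≤ k) (hN : N ≠ 0)
    (hmem : ∀ i : ℤ, g ^ i ∈ R k ↔ (N : ℤ) ∣ i)
    (hgen : ∀ x : G, ∃ i : ℤ, ∃ y ∈ R k, x = y * g ^ i) (hρ : ρ (g ^ N) = 1) :
    HasOrbitCount (agreeing R ρ k) N.divisors.card := by
  have hgN : g ^ N ∈ R k := by simpa using (hmem N).2 dvd_rfl
  refine h.hasOrbitCount_of_orderOf hk hmem hgen _ (by simp) (fun ψ => ?_) (fun x hx => ?_)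
  · rw [Nat.mem_divisors, orderOf_dvd_iff_pow_eq_one]
    refine ⟨fun hψ => ⟨hψ, ?_, hN⟩, fun h => h.1⟩
    rw [← map_pow, hψ _ hgN, hρ]
  · rw [hρ, ← orderOf_dvd_iff_pow_eq_one]
    exact Nat.dvd_of_mem_divisors hx

/-- Agreement at level `k` but not at `k'` says that the order of `ψ g` divides `N` but not `N'`. -/
theorem hasOrbitCount_agreeing_diff (hk' : c ≤ k') (hk : k' ≤ k) (hN : N ≠ 0)
    (hmem : ∀ i : ℤ, g ^ i ∈ R k ↔ (N : ℤ) ∣ i) (hmem' : ∀ i : ℤ, g ^ i ∈ R k' ↔ (N' : ℤ) ∣ i)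
    (hgen : ∀ x : G, ∃ i : ℤ, ∃ y ∈ R k, x = y * g ^ i) (hρ : ρ (g ^ N') = 1) :
    HasOrbitCount (agreeing R ρ k \ agreeing R ρ k') (N.divisors \ N'.divisors).card := by
  have hNN : N' ∣ N := by
    have := (hmem' N).1 (h.anti hk ((hmem N).2 dvd_rfl))
    exact_mod_cast this
  have hN' : N' ≠ 0 := ne_zero_of_dvd_ne_zero hN hNN
  have hgN : g ^ N ∈ R k := by simpa using (hmem N).2 dvd_rfl
  have hgN' : g ^ N' ∈ R k' := by simpa using (hmem' N').2 dvd_rfl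
  have hρN : ρ (g ^ N) = 1 := by
    obtain ⟨d, rfl⟩ := hNN
    rw [pow_mul, h.map_pow_of_mem (h.anti hk' hgN'), hρ, one_pow]
  have hgen' : ∀ x : G, ∃ i j : ℤ, ∃ y ∈ R k, x = y * (g ^ i * 1 ^ j) := fun x => by
    obtain ⟨i, y, hy, rfl⟩ := hgen x
    exact ⟨i, 0, y, hy, by simp⟩
  refine h.hasOrbitCount_of_orderOf (hk'.trans hk) hmem hgen _ (by simp [hN]) (fun ψ => ?_)
    (fun x hx => ?_)
  · rw [Finset.mem_sdiff, Nat.mem_divisors, Nat.mem_divisors, orderOf_dvd_iff_pow_eq_one,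
      orderOf_dvd_iff_pow_eq_one, Set.mem_sdiff]
    refine and_congr_right fun hψ => ?_
    rw [h.mem_agreeing_iff_two (s := 1) (M := 1) hk' hk hgen' (by simpa using hmem') (by simp) hρ hψ]
    have : ψ g ^ N = 1 := by rw [← map_pow, hψ _ hgN, hρN]
    simp [this, hN, hN']
  · rw [hρN, ← orderOf_dvd_iff_pow_eq_one]
    exact Nat.dvd_of_mem_divisors (Finset.mem_sdiff.1 hx).1

/-- Reduces the count to pairs of complex numbers: `P` singles out the admissible pairs `(ψ g, ψ
s)`, `φ` is a complete invariant for simultaneous conjugation, and `S` is its set of values. -/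
theorem hasOrbitCount_of_two (hk : c ≤ k)
    (hmem : ∀ i j : ℤ, g ^ i * s ^ j ∈ R k ↔ (N : ℤ) ∣ i ∧ (M : ℤ) ∣ j)
    (hgen : ∀ x : G, ∃ i j : ℤ, ∃ y ∈ R k, x = y * (g ^ i * s ^ j)) {Y : Set (G →* ℂˣ)}
    (P : ℂˣ → ℂˣ → Prop) (φ : ℂˣ → ℂˣ → ℕ × ℕ) (S : Finset (ℕ × ℕ))
    (hY : ∀ ψ, ψ ∈ Y ↔ ψ ∈ agreeing R ρ k ∧ P (ψ g) (ψ s))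
    (hP : ∀ x y, P x y → x ^ N = ρ (g ^ N) ∧ y ^ M = ρ (s ^ M))
    (hφ : ∀ x y, P x y → ∀ x' y', P x' y' → φ x y = φ x' y' →
      ∃ σ : ℂ ≃ₐ[ℚ] ℂ, σ (x : ℂ) = x' ∧ σ (y : ℂ) = y')
    (hφ' : ∀ (σ : ℂ ≃ₐ[ℚ] ℂ) (x y x' y' : ℂˣ), σ (x : ℂ) = x' → σ (y : ℂ) = y' →
      φ x y = φ x' y')
    (hS : ∀ z, z ∈ S ↔ ∃ x y, P x y ∧ φ x y = z) : HasOrbitCount Y S.card := by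
  refine ⟨fun ψ => φ (ψ g) (ψ s), fun ψ₁ h₁ ψ₂ h₂ => ⟨fun he => ?_, ?_⟩, ?_⟩
  · obtain ⟨σ, hσ, hσ'⟩ := hφ _ _ ((hY _).1 h₁).2 _ _ ((hY _).1 h₂).2 he
    exact ⟨σ, h.conj_of_two ((hY _).1 h₁).1 ((hY _).1 h₂).1 hgen hσ hσ'⟩
  · rintro ⟨σ, hσ⟩
    exact hφ' σ _ _ _ _ (hσ g) (hσ s)
  · have : (fun ψ : G →* ℂˣ => φ (ψ g) (ψ s)) '' Y = S := by
      ext z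
      rw [Finset.mem_coe, hS]
      constructor
      · rintro ⟨ψ, hψ, rfl⟩
        exact ⟨_, _, ((hY _).1 hψ).2, rfl⟩
      · rintro ⟨x, y, hxy, rfl⟩
        obtain ⟨ψ, hψ, rfl, rfl⟩ := h.exists_mem_agreeing_two hk hmem hgen (hP x y hxy).1
          (hP x y hxy).2
        exact ⟨ψ, (hY _).2 ⟨hψ, hxy⟩, rfl⟩
    rw [this, Set.encard_coe_eq_coe_finsetCard]

theorem mem_agreeing_diff_iff_two (hk' : c ≤ k') (hk : k' ≤ k)
    (hmem : ∀ i j : ℤ, g ^ i * s ^ j ∈ R k ↔ (N : ℤ) ∣ i ∧ (M : ℤ) ∣ j)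
    (hmem' : ∀ i j : ℤ, g ^ i * s ^ j ∈ R k' ↔ (N' : ℤ) ∣ i ∧ (M : ℤ) ∣ j)
    (hgen : ∀ x : G, ∃ i j : ℤ, ∃ y ∈ R k, x = y * (g ^ i * s ^ j))
    (hρ : ρ (g ^ N') = 1) (ψ : G →* ℂˣ) :
    ψ ∈ agreeing R ρ k \ agreeing R ρ k' ↔ ψ ∈ agreeing R ρ k ∧
      (ψ g ^ N = 1 ∧ ψ g ^ N' ≠ 1 ∧ ψ s ^ M = ρ (s ^ M)) := by
  have hgN : g ^ N ∈ R k := by simpa using (hmem N 0).2 ⟨dvd_rfl, dvd_zero _⟩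
  have hgN' : g ^ N' ∈ R k' := by simpa using (hmem' N' 0).2 ⟨dvd_rfl, dvd_zero _⟩
  have hsM : s ^ M ∈ R k := by simpa using (hmem 0 M).2 ⟨dvd_zero _, dvd_rfl⟩
  have hρN : ρ (g ^ N) = 1 := by
    obtain ⟨d, rfl⟩ : N' ∣ N := by
      have := ((hmem' N 0).1 (h.anti hk ((hmem N 0).2 ⟨dvd_rfl, dvd_zero _⟩))).1
      exact_mod_cast this
    rw [pow_mul, h.map_pow_of_mem (h.anti hk' hgN'), hρ, one_pow]
  rw [Set.mem_sdiff]
  refine and_congr_right fun hψ => ?_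
  rw [h.mem_agreeing_iff_two hk' hk hgen hmem' hsM hρ hψ, ← map_pow ψ g N, ← map_pow ψ s M,
    hψ _ hgN, hψ _ hsM]
  simp [hρN]

/-- Here `ψ s = ±1` is rational, so it is an invariant independent of the order of `ψ g`, and every
order occurs with both signs. -/
theorem hasOrbitCount_agreeing_diff_two_mul (hk' : c ≤ k') (hk : k' ≤ k) (hN : N ≠ 0)
    (hmem : ∀ i j : ℤ, g ^ i * s ^ j ∈ R k ↔ (N : ℤ) ∣ i ∧ ((2 : ℕ) : ℤ) ∣ j)
    (hmem' : ∀ i j : ℤ, g ^ i * s ^ j ∈ R k' ↔ (N' : ℤ) ∣ i ∧ ((2 : ℕ) : ℤ) ∣ j)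
    (hgen : ∀ x : G, ∃ i j : ℤ, ∃ y ∈ R k, x = y * (g ^ i * s ^ j))
    (hρ : ρ (g ^ N') = 1) (hρN : ρ (g ^ N) = 1) (hρs : ρ (s ^ 2) = 1) :
    HasOrbitCount (agreeing R ρ k \ agreeing R ρ k')
      ((N.divisors \ N'.divisors).card * 2 : ℕ) := by
  classical
  have hNN : N' ∣ N := by
    have := ((hmem' N 0).1 (h.anti hk ((hmem N 0).2 ⟨dvd_rfl, dvd_zero _⟩))).1
    exact_mod_cast this
  have hN' : N' ≠ 0 := ne_zero_of_dvd_ne_zero hN hNN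
  have key := h.hasOrbitCount_of_two (hk'.trans hk) hmem hgen
    (Y := agreeing R ρ k \ agreeing R ρ k')
    (fun x y => x ^ N = 1 ∧ x ^ N' ≠ 1 ∧ y ^ 2 = ρ (s ^ 2))
    (fun x y => (orderOf x, orderOf y)) ((N.divisors \ N'.divisors) ×ˢ {1, 2})
    (h.mem_agreeing_diff_iff_two hk' hk hmem hmem' hgen hρ)
    (fun x y h => ⟨h.1.trans hρN.symm, h.2.2⟩) ?_
    (fun σ x y x' y' hx hy => Prod.ext (orderOf_eq_of_algEquiv hx) (orderOf_eq_of_algEquiv hy)) ?_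
  · rwa [Finset.card_product, Finset.card_pair (by norm_num)] at key
  · rintro x y ⟨hx, -, hy⟩ x' y' ⟨-, -, hy'⟩ he
    obtain ⟨he1, he2⟩ := Prod.ext_iff.1 he
    have hsgn : ∀ y : ℂˣ, y ^ 2 = ρ (s ^ 2) → y = 1 ∨ y = -1 := fun y hy => by
      rw [hρs] at hy
      exact eq_one_or_eq_neg_one_of_sq hy
    obtain ⟨σ, hσ⟩ := exists_algEquiv_of_orderOf_eq
      (orderOf_pos_iff.2 (isOfFinOrder_iff_pow_eq_one.2 ⟨N, Nat.pos_of_ne_zero hN, hx⟩)) he1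
    refine ⟨σ, hσ, ?_⟩
    rcases hsgn y hy with rfl | rfl
    · have : y' = 1 := by simpa using he2.symm
      simp [this]
    · rcases hsgn y' hy' with rfl | rfl
      · simp at he2
      · simp
  · rintro ⟨d, e⟩
    simp only [Finset.mem_product, Finset.mem_sdiff, Nat.mem_divisors, Finset.mem_insert,
      Finset.mem_singleton, Prod.mk.injEq]
    constructor
    · rintro ⟨⟨⟨h1, h2⟩, h3⟩, he⟩
      obtain ⟨x, rfl⟩ := exists_orderOf_eq (ne_zero_of_dvd_ne_zero hN h1)
      obtain ⟨y, rfl⟩ := exists_orderOf_eq (show e ≠ 0 by omega)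
      refine ⟨x, y, ⟨orderOf_dvd_iff_pow_eq_one.1 h1,
        fun h => h3 ⟨orderOf_dvd_iff_pow_eq_one.2 h, hN'⟩, ?_⟩, rfl, rfl⟩
      rw [hρs, ← orderOf_dvd_iff_pow_eq_one]
      rcases he with he | he <;> norm_num [he]
    · rintro ⟨x, y, ⟨h1, h2, h3⟩, rfl, rfl⟩
      rw [hρs, ← orderOf_dvd_iff_pow_eq_one, Nat.dvd_prime Nat.prime_two] at h3
      exact ⟨⟨⟨orderOf_dvd_iff_pow_eq_one.2 h1, hN⟩,
        fun h => h2 (orderOf_dvd_iff_pow_eq_one.1 h.1)⟩, h3⟩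

/-- `ψ g` is a primitive `p ^ (i + 1)`-th root of unity, and all of these are conjugate. An
automorphism fixing `ψ g` also fixes `ψ s`, an `L`-th root of unity with `L ∣ p ^ (i + 1)`. What
remains is the exponent of `ψ s` relative to the power of `ψ g` of order `L`, and `J` lists the
exponents that occur. -/
theorem hasOrbitCount_agreeing_diff_of_prime_pow {p i L : ℕ} (hp : p.Prime) (hk' : c ≤ k')
    (hk : k' ≤ k)
    (hmem : ∀ i' j : ℤ, g ^ i' * s ^ j ∈ R k ↔ ((p ^ (i + 1) : ℕ) : ℤ) ∣ i' ∧ (M : ℤ) ∣ j)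
    (hmem' : ∀ i' j : ℤ, g ^ i' * s ^ j ∈ R k' ↔ ((p ^ i : ℕ) : ℤ) ∣ i' ∧ (M : ℤ) ∣ j)
    (hgen : ∀ x : G, ∃ i j : ℤ, ∃ y ∈ R k, x = y * (g ^ i * s ^ j))
    (hρ : ρ (g ^ p ^ i) = 1) (hL : L ∣ p ^ (i + 1)) (hM : ∀ y : ℂˣ, y ^ M = ρ (s ^ M) → y ^ L = 1)
    (J : Finset ℕ) (hJ : ∀ j ∈ J, j < L)
    (hJ' : ∀ w : ℂˣ, orderOf w = L → ∀ j < L, (w ^ j) ^ M = ρ (s ^ M) ↔ j ∈ J) :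
    HasOrbitCount (agreeing R ρ k \ agreeing R ρ k') J.card := by
  classical
  have hN : p ^ (i + 1) ≠ 0 := pow_ne_zero _ hp.ne_zero
  have hL0 : L ≠ 0 := ne_zero_of_dvd_ne_zero hN hL
  have hgN' : g ^ p ^ i ∈ R k' := by
    have := (hmem' (p ^ i : ℕ) 0).2 ⟨dvd_rfl, dvd_zero _⟩
    rwa [zpow_natCast, zpow_zero, mul_one] at this
  have hρN : ρ (g ^ p ^ (i + 1)) = 1 := by
    rw [pow_succ, pow_mul, h.map_pow_of_mem (h.anti hk' hgN'), hρ, one_pow]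
  have hord : ∀ x : ℂˣ, x ^ p ^ (i + 1) = 1 → x ^ p ^ i ≠ 1 → orderOf x = p ^ (i + 1) := by
    intro x h1 h2
    have := Fact.mk hp
    exact orderOf_eq_prime_pow h2 h1
  have hord' : ∀ x : ℂˣ, orderOf x = p ^ (i + 1) → orderOf (x ^ (p ^ (i + 1) / L)) = L := by
    intro x hx
    rw [orderOf_pow_of_dvd (Nat.div_pos (Nat.le_of_dvd (Nat.pos_of_ne_zero hN) hL)
      (Nat.pos_of_ne_zero hL0)).ne' (by rw [hx]; exact Nat.div_dvd_of_dvd hL), hx, Nat.div_div_self hL hN]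
  have key := h.hasOrbitCount_of_two (hk'.trans hk) hmem hgen
    (Y := agreeing R ρ k \ agreeing R ρ k')
    (fun x y => x ^ p ^ (i + 1) = 1 ∧ x ^ p ^ i ≠ 1 ∧ y ^ M = ρ (s ^ M))
    (fun x y => (0, dlog (x ^ (p ^ (i + 1) / L)) y)) ({0} ×ˢ J)
    (h.mem_agreeing_diff_iff_two hk' hk hmem hmem' hgen hρ)
    (fun x y h => ⟨h.1.trans hρN.symm, h.2.2⟩) ?_
    (fun σ x y x' y' hx hy => Prod.ext rfl (dlog_eq_of_algEquiv (σ := σ) (by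
      rw [Units.val_pow_eq_pow_val, map_pow, hx, Units.val_pow_eq_pow_val]) hy)) ?_
  · rwa [Finset.card_product, Finset.card_singleton, one_mul] at key
  · rintro x y ⟨hx, hx', hy⟩ x' y' ⟨hx1, hx1', hy1⟩ he
    have he : dlog _ y = dlog _ y' := congrArg Prod.snd he
    have o1 := hord x hx hx'
    have o2 := hord x' hx1 hx1'
    obtain ⟨σ, hσ⟩ := exists_algEquiv_of_orderOf_eq (o1 ▸ Nat.pos_of_ne_zero hN) (o1.trans o2.symm)
    refine ⟨σ, hσ, ?_⟩
    rw [← (pow_dlog hL0 (hord' x o1) (hM y hy)).1, ← (pow_dlog hL0 (hord' x' o2) (hM y' hy1)).1, he]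
    simp only [Units.val_pow_eq_pow_val, map_pow, hσ]
  · rintro ⟨d, j⟩
    simp only [Finset.mem_product, Finset.mem_singleton, Prod.mk.injEq]
    constructor
    · rintro ⟨rfl, hj⟩
      obtain ⟨x, hx⟩ := exists_orderOf_eq hN
      have hjL := hJ j hj
      refine ⟨x, (x ^ (p ^ (i + 1) / L)) ^ j, ⟨hx ▸ pow_orderOf_eq_one x, fun h1 => ?_,
        (hJ' _ (hord' x hx) j hjL).2 hj⟩, rfl, dlog_pow (hord' x hx) hjL⟩
      have := (Nat.pow_dvd_pow_iff_le_right hp.one_lt).1 (hx ▸ orderOf_dvd_of_pow_eq_one h1)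
      omega
    · rintro ⟨x, y, ⟨h1, h2, h3⟩, rfl, rfl⟩
      have o1 := hord' x (hord x h1 h2)
      obtain ⟨e1, e2⟩ := pow_dlog hL0 o1 (hM y h3)
      refine ⟨rfl, (hJ' _ o1 _ e2).1 ?_⟩
      rw [e1, h3]

/-- `ψ g = -1` is forced and `ψ s = ±i`, two conjugate values. The prime power count does not apply
with `L = 4`, since `i` is not a power of `ψ g`. -/
theorem hasOrbitCount_agreeing_diff_two_two (hk' : c ≤ k') (hk : k' ≤ k)
    (hmem : ∀ i j : ℤ, g ^ i * s ^ j ∈ R k ↔ ((2 : ℕ) : ℤ) ∣ i ∧ ((2 : ℕ) : ℤ) ∣ j)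
    (hmem' : ∀ i j : ℤ, g ^ i * s ^ j ∈ R k' ↔ ((1 : ℕ) : ℤ) ∣ i ∧ ((2 : ℕ) : ℤ) ∣ j)
    (hgen : ∀ x : G, ∃ i j : ℤ, ∃ y ∈ R k, x = y * (g ^ i * s ^ j))
    (hρ : ρ g = 1) (hρs : ρ (s ^ 2) = -1) :
    HasOrbitCount (agreeing R ρ k \ agreeing R ρ k') 1 := by
  classical
  have hgN' : g ∈ R k' := by simpa using (hmem' 1 0).2 ⟨by norm_num, dvd_zero _⟩
  have hsq : ∀ y : ℂˣ, y ^ 2 = 1 → y ≠ 1 → y = -1 := fun y hy hy1 =>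
    (eq_one_or_eq_neg_one_of_sq hy).resolve_left hy1
  have key := h.hasOrbitCount_of_two (hk'.trans hk) hmem hgen
    (Y := agreeing R ρ k \ agreeing R ρ k')
    (fun x y => x ^ 2 = 1 ∧ x ^ 1 ≠ 1 ∧ y ^ 2 = ρ (s ^ 2))
    (fun x y => (0, orderOf y)) {(0, 4)}
    (h.mem_agreeing_diff_iff_two hk' hk hmem hmem' hgen (by simpa using hρ))
    (fun x y h' => ⟨h'.1.trans (by rw [h.map_pow_of_mem (h.anti hk' hgN'), hρ, one_pow]), h'.2.2⟩) ?_
    (fun σ x y x' y' hx hy => Prod.ext rfl (orderOf_eq_of_algEquiv hy)) ?_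
  · simpa using key
  · rintro x y ⟨hx, hx', hy⟩ x' y' ⟨hx1, hx1', hy1⟩ -
    rw [hρs, sq_eq_neg_one_iff] at hy hy1
    obtain ⟨σ, hσ⟩ := exists_algEquiv_of_orderOf_eq (by omega) (hy.trans hy1.symm)
    rw [hsq x hx (by simpa using hx'), hsq x' hx1 (by simpa using hx1')]
    exact ⟨σ, by simp, hσ⟩
  · rintro z
    rw [Finset.mem_singleton]
    constructor
    · rintro rfl
      obtain ⟨y, hy⟩ := exists_orderOf_eq (show 4 ≠ 0 by norm_num)
      refine ⟨-1, y, ⟨by simp, ?_, ?_⟩, by rw [hy]⟩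
      · intro h1
        have := congrArg Units.val h1
        norm_num at this
      · rw [hρs, sq_eq_neg_one_iff, hy]
    · rintro ⟨x, y, ⟨-, -, hy⟩, rfl⟩
      rw [hρs, sq_eq_neg_one_iff] at hy
      rw [hy]

end SignFiltration

end Count

/-! ### Unit groups of orders in quadratic algebras over `ℤ_p` -/

section Quadratic

variable {p : ℕ} [Fact p.Prime]

theorem toZMod_eq_zero_iff_dvd (x : ℤ_[p]) : PadicInt.toZMod x = 0 ↔ (p : ℤ_[p]) ∣ x := by
  rw [← RingHom.mem_ker, PadicInt.ker_toZMod, PadicInt.maximalIdeal_eq_span_p,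
    Ideal.mem_span_singleton]

theorem not_dvd_iff_isUnit (x : ℤ_[p]) : ¬ (p : ℤ_[p]) ∣ x ↔ IsUnit x := by
  rw [← PadicInt.norm_lt_one_iff_dvd, ← PadicInt.not_isUnit_iff, not_not]

theorem not_dvd_units (u : ℤ_[p]ˣ) : ¬ (p : ℤ_[p]) ∣ (u : ℤ_[p]) :=
  (not_dvd_iff_isUnit _).2 u.isUnit

variable {a b : ℤ_[p]}

theorem isUnit_quadratic_iff (x : QuadraticAlgebra ℤ_[p] a b) :
    IsUnit x ↔ ¬ (p : ℤ_[p]) ∣ x.re * x.re + b * x.re * x.im - a * x.im * x.im := by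
  rw [not_dvd_iff_isUnit, QuadraticAlgebra.isUnit_iff_norm_isUnit, QuadraticAlgebra.norm_def]

theorem not_dvd_norm_units (u : (QuadraticAlgebra ℤ_[p] a b)ˣ) :
    ¬ (p : ℤ_[p]) ∣ u.1.re * u.1.re + b * u.1.re * u.1.im - a * u.1.im * u.1.im :=
  (isUnit_quadratic_iff _).1 u.isUnit

variable (a b) in
/-- The unit group of the order `ℤ_p + p^k O` of the quadratic algebra `O = ℤ_p ⊕ ℤ_p ω`. -/
def orderUnits (k : ℕ) : Subgroup (QuadraticAlgebra ℤ_[p] a b)ˣ where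
  carrier := {u | (p : ℤ_[p]) ^ k ∣ u.1.im}
  one_mem' := by
    simp only [Set.mem_ofPred_eq, Units.val_one, QuadraticAlgebra.im_one]
    exact dvd_zero _
  mul_mem' := by
    intro u v hu hv
    simp only [Set.mem_ofPred_eq, Units.val_mul, QuadraticAlgebra.im_mul] at *
    exact dvd_add (dvd_add (dvd_mul_of_dvd_right hv _) (dvd_mul_of_dvd_left hu _))
      (dvd_mul_of_dvd_right hv _)
  inv_mem' := by
    intro u hu
    simp only [Set.mem_ofPred_eq] at *
    -- The inverse is the conjugate times a scalar, and conjugation only changes the sign of the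
    -- imaginary part.
    have h : (u⁻¹).1 = star u.1 * QuadraticAlgebra.C ((u⁻¹).1.norm) := by
      have h1 : QuadraticAlgebra.C ((u⁻¹).1.norm) = (u⁻¹).1 * star (u⁻¹).1 :=
        QuadraticAlgebra.algebraMap_norm_eq_mul_star _
      have h2 : star u.1 * star (u⁻¹).1 = 1 := by
        rw [mul_comm, ← star_mul, Units.mul_inv, star_one]
      rw [h1, mul_left_comm, h2, mul_one]
    rw [h]
    simpa using dvd_mul_of_dvd_left hu _

theorem mem_orderUnits {k : ℕ} {u : (QuadraticAlgebra ℤ_[p] a b)ˣ} :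
    u ∈ orderUnits a b k ↔ (p : ℤ_[p]) ^ k ∣ u.1.im := Iff.rfl

theorem orderUnits_antitone : Antitone (orderUnits a b) := fun _ _ h _ hu =>
  (pow_dvd_pow _ h).trans hu

theorem mem_orderUnits_zero (u : (QuadraticAlgebra ℤ_[p] a b)ˣ) : u ∈ orderUnits a b 0 := by
  simp [mem_orderUnits]

/-- Either the level is positive, or the algebra is ramified. -/
def Tame (a b : ℤ_[p]) (j : ℕ) : Prop := 1 ≤ j ∨ ((p : ℤ_[p]) ∣ a ∧ (p : ℤ_[p]) ∣ b)

theorem Tame.mono {j i : ℕ} (h : Tame a b j) (hi : j ≤ i) : Tame a b i :=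
  h.imp (fun h => h.trans hi) id

theorem Tame.dvd {j : ℕ} (h : Tame a b j) {x : ℤ_[p]} (hx : (p : ℤ_[p]) ^ j ∣ x) :
    (p : ℤ_[p]) ∣ a * x ∧ (p : ℤ_[p]) ∣ b * x := by
  rcases h with h | h
  · have : (p : ℤ_[p]) ∣ x := (dvd_pow_self _ (by omega)).trans hx
    exact ⟨dvd_mul_of_dvd_right this _, dvd_mul_of_dvd_right this _⟩
  · exact ⟨dvd_mul_of_dvd_left h.1 _, dvd_mul_of_dvd_left h.2 _⟩

/-- At a tame level the terms of the norm that involve the imaginary part are divisible by `p`, so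
the norm is the square of the real part modulo `p`. -/
theorem Tame.not_dvd_re {j : ℕ} (h : Tame a b j) {u : (QuadraticAlgebra ℤ_[p] a b)ˣ}
    (hu : u ∈ orderUnits a b j) : ¬ (p : ℤ_[p]) ∣ u.1.re := by
  intro hr
  refine not_dvd_norm_units u (dvd_sub (dvd_add (dvd_mul_of_dvd_left hr _) ?_) ?_)
  · rw [mul_right_comm]; exact dvd_mul_of_dvd_left (h.dvd hu).2 _
  · exact dvd_mul_of_dvd_left (h.dvd hu).1 _

theorem not_mem_orderUnits_succ {j : ℕ} {u : (QuadraticAlgebra ℤ_[p] a b)ˣ} {c : ℤ_[p]}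
    (hc : u.1.im = (p : ℤ_[p]) ^ j * c) : u ∉ orderUnits a b (j + 1) ↔ ¬ (p : ℤ_[p]) ∣ c := by
  rw [mem_orderUnits, hc, pow_succ, mul_dvd_mul_iff_left (pow_ne_zero _ PadicInt.prime_p.ne_zero)]

/-- At a tame level the residue of `im / (p ^ j re)` turns products into sums. It embeds `R j / R (j
+ 1)` in the additive group of `ZMod p`, where `k` solves a linear equation. -/
theorem Tame.exists_mul_pow_mem {j : ℕ} (h : Tame a b j) {x g : (QuadraticAlgebra ℤ_[p] a b)ˣ}
    (hx : x ∈ orderUnits a b j) (hg : g ∈ orderUnits a b j) (hg' : g ∉ orderUnits a b (j + 1)) :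
    ∃ k : ℕ, x * g ^ k ∈ orderUnits a b (j + 1) := by
  obtain ⟨β, hβ⟩ := hg
  obtain ⟨γ, hγ⟩ := hx
  let t : ℤ_[p] →+* ZMod p := PadicInt.toZMod
  have hgr : t g.1.re ≠ 0 := fun h0 => h.not_dvd_re ⟨β, hβ⟩ ((toZMod_eq_zero_iff_dvd _).1 h0)
  have hxr : t x.1.re ≠ 0 := fun h0 => h.not_dvd_re ⟨γ, hγ⟩ ((toZMod_eq_zero_iff_dvd _).1 h0)
  have hβ0 : t β ≠ 0 := fun h0 =>
    (not_mem_orderUnits_succ hβ).1 hg' ((toZMod_eq_zero_iff_dvd _).1 h0)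
  have key : ∀ k : ℕ, ∃ y : ℤ_[p], (x * g ^ k).1.im = (p : ℤ_[p]) ^ j * y ∧
      t y = t (x * g ^ k).1.re * (t γ / t x.1.re + k * (t β / t g.1.re)) := by
    intro k
    induction k with
    | zero => exact ⟨γ, by simpa using hγ, by simp; field_simp⟩
    | succ k ih =>
      obtain ⟨y, hy, hy'⟩ := ih
      set z := x * g ^ k with hz
      have hzg : x * g ^ (k + 1) = z * g := by rw [pow_succ, ← mul_assoc]
      have h1 : t (a * ((p : ℤ_[p]) ^ j * β)) = 0 :=
        (toZMod_eq_zero_iff_dvd _).2 (h.dvd (dvd_mul_right _ _)).1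
      have h2 : t (b * ((p : ℤ_[p]) ^ j * β)) = 0 :=
        (toZMod_eq_zero_iff_dvd _).2 (h.dvd (dvd_mul_right _ _)).2
      refine ⟨z.1.re * β + y * g.1.re + y * (b * ((p : ℤ_[p]) ^ j * β)), ?_, ?_⟩
      · rw [hzg, Units.val_mul, QuadraticAlgebra.im_mul, hy, hβ]; ring
      · have h3 : t (z * g).1.re = t z.1.re * t g.1.re := by
          rw [Units.val_mul, QuadraticAlgebra.re_mul, hβ, hy,
            show a * ((p : ℤ_[p]) ^ j * y) * ((p : ℤ_[p]) ^ j * β) =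
              (p : ℤ_[p]) ^ j * y * (a * ((p : ℤ_[p]) ^ j * β)) by ring]
          simp only [map_add, map_mul] at h1 ⊢
          rw [h1]; ring
        rw [hzg, h3, map_add, map_add, map_mul, map_mul, map_mul t y (b * _), h2, hy']
        push_cast
        field_simp
        ring
  obtain ⟨y, hy, hy'⟩ := key (-(t γ / t x.1.re) / (t β / t g.1.re)).val
  refine ⟨(-(t γ / t x.1.re) / (t β / t g.1.re)).val, ?_⟩
  rw [mem_orderUnits, hy, pow_succ]
  refine mul_dvd_mul_left _ ((toZMod_eq_zero_iff_dvd _).1 ?_)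
  change t y = 0
  rw [hy', ZMod.natCast_zmod_val, div_mul_cancel₀ _ (div_ne_zero hβ0 hgr), add_neg_cancel,
    mul_zero]

/-- The binomial expansion of a `p`-th power to first order. -/
theorem exists_add_pow_prime_expansion {R : Type*} [CommRing R] {q : ℕ} (hq : q.Prime) (x y : R) :
    ∃ z, (x + y) ^ q = x ^ q + q * x ^ (q - 1) * y + q * y ^ 2 * z + y ^ q := by
  obtain ⟨n, rfl⟩ : ∃ n, q = n + 2 := ⟨q - 2, by have := hq.two_le; omega⟩
  have hd : ∀ i ∈ Finset.range n, (((n + 2 : ℕ) : R) * y ^ 2) ∣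
      y ^ (i + 1 + 1) * x ^ (n + 2 - (i + 1 + 1)) * ((n + 2).choose (i + 1 + 1) : R) := by
    intro i hi
    have hi' := Finset.mem_range.1 hi
    obtain ⟨c, hc⟩ := hq.dvd_choose_self (k := i + 1 + 1) (by omega) (by omega)
    exact ⟨x ^ (n + 2 - (i + 1 + 1)) * y ^ i * c, by rw [hc]; push_cast; ring⟩
  obtain ⟨z, hz⟩ := Finset.dvd_sum hd
  refine ⟨z, ?_⟩
  rw [add_comm x y, add_pow, Finset.sum_range_succ, Finset.sum_range_succ',
    Finset.sum_range_succ', hz]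
  simp
  ring

theorem pow_mem_of_im_eq {j : ℕ} {x : (QuadraticAlgebra ℤ_[p] a b)ˣ} {c : ℤ_[p]}
    (h : (x ^ p).1.im = (p : ℤ_[p]) ^ (j + 1) * c) (hc : ¬ (p : ℤ_[p]) ∣ c) :
    x ^ p ∈ orderUnits a b (j + 1) ∧ x ^ p ∉ orderUnits a b (j + 2) :=
  ⟨⟨c, h⟩, (not_mem_orderUnits_succ h).2 hc⟩

/-- The `p`-th power map raises the level by exactly one, if the nonlinear terms of the binomial
expansion are negligible. -/
theorem Tame.pow_mem {j : ℕ} (h : Tame a b j)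
    (h2 : ∀ y : ℤ_[p], ∃ w : QuadraticAlgebra ℤ_[p] a b,
      (⟨0, (p : ℤ_[p]) ^ j * y⟩ : QuadraticAlgebra ℤ_[p] a b) ^ 2 = .C ((p : ℤ_[p]) ^ (j + 1)) * w)
    (hp : ∀ y : ℤ_[p], ∃ w : QuadraticAlgebra ℤ_[p] a b,
      (⟨0, (p : ℤ_[p]) ^ j * y⟩ : QuadraticAlgebra ℤ_[p] a b) ^ p = .C ((p : ℤ_[p]) ^ (j + 2)) * w)
    {x : (QuadraticAlgebra ℤ_[p] a b)ˣ} (hx : x ∈ orderUnits a b j)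
    (hx' : x ∉ orderUnits a b (j + 1)) :
    x ^ p ∈ orderUnits a b (j + 1) ∧ x ^ p ∉ orderUnits a b (j + 2) := by
  have hr := h.not_dvd_re hx
  obtain ⟨y, hy⟩ := hx
  have hy0 := (not_mem_orderUnits_succ hy).1 hx'
  obtain ⟨w, hw⟩ := h2 y
  obtain ⟨w', hw'⟩ := hp y
  obtain ⟨z, hz⟩ := exists_add_pow_prime_expansion (Fact.out : p.Prime)
    (QuadraticAlgebra.C x.1.re : QuadraticAlgebra ℤ_[p] a b) ⟨0, (p : ℤ_[p]) ^ j * y⟩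
  have hxe : x.1 = QuadraticAlgebra.C x.1.re + ⟨0, (p : ℤ_[p]) ^ j * y⟩ := by
    ext <;> simp [hy]
  -- The pure power of the real part has no imaginary part, and the linear term gives the leading
  -- coefficient. The terms containing the square carry another factor `p` from the binomial
  -- coefficients, which is why `h2` asks for one power of `p` less than `hp`.
  have him : (x ^ p).1.im = (p : ℤ_[p]) ^ (j + 1) *
      (x.1.re ^ (p - 1) * y + p * ((w * z).im + w'.im)) := by
    rw [Units.val_pow_eq_pow_val, hxe, hz, hw, hw', ← QuadraticAlgebra.C_natCast,
      ← QuadraticAlgebra.C_pow, ← QuadraticAlgebra.C_pow]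
    simp only [QuadraticAlgebra.im_add, QuadraticAlgebra.im_C, QuadraticAlgebra.im_mul,
      QuadraticAlgebra.re_mul, QuadraticAlgebra.re_C, QuadraticAlgebra.re_add]
    ring
  refine pow_mem_of_im_eq him fun hd => ?_
  rw [dvd_add_left (dvd_mul_right _ _)] at hd
  rcases PadicInt.prime_p.dvd_or_dvd hd with hd | hd
  · exact hr (PadicInt.prime_p.dvd_of_dvd_pow hd)
  · exact hy0 hd

theorem powFiltration_of_pow {j : ℕ} (h : Tame a b j)
    (hpow : ∀ i, j ≤ i → ∀ x ∈ orderUnits a b i, x ∉ orderUnits a b (i + 1) →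
      x ^ p ∈ orderUnits a b (i + 1) ∧ x ^ p ∉ orderUnits a b (i + 2)) :
    PowFiltration (orderUnits a b) p j where
  anti := orderUnits_antitone
  gen _ hi _ hx _ hg hg' := (h.mono hi).exists_mul_pow_mem hx hg hg'
  pow := hpow

theorem pow_mem_of_odd (hp2 : p ≠ 2) {i : ℕ} (hi : 1 ≤ i) {x : (QuadraticAlgebra ℤ_[p] a b)ˣ}
    (hx : x ∈ orderUnits a b i) (hx' : x ∉ orderUnits a b (i + 1)) :
    x ^ p ∈ orderUnits a b (i + 1) ∧ x ^ p ∉ orderUnits a b (i + 2) := by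
  have hp3 : 3 ≤ p := by
    have := (Fact.out : p.Prime).two_le
    omega
  have hsplit : ∀ (y : ℤ_[p]) (m n : ℕ), n ≤ i * m →
      ∃ w : QuadraticAlgebra ℤ_[p] a b,
      (⟨0, (p : ℤ_[p]) ^ i * y⟩ : QuadraticAlgebra ℤ_[p] a b) ^ m = .C ((p : ℤ_[p]) ^ n) * w := by
    intro y m n hn
    have he : (⟨0, (p : ℤ_[p]) ^ i * y⟩ : QuadraticAlgebra ℤ_[p] a b) =
        .C ((p : ℤ_[p]) ^ i) * ⟨0, y⟩ := by
      ext <;> simp only [QuadraticAlgebra.re_mul, QuadraticAlgebra.im_mul, QuadraticAlgebra.re_C,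
        QuadraticAlgebra.im_C] <;> ring
    refine ⟨.C ((p : ℤ_[p]) ^ (i * m - n)) * ⟨0, y⟩ ^ m, ?_⟩
    rw [he, mul_pow, ← QuadraticAlgebra.C_pow, ← pow_mul, ← mul_assoc, ← QuadraticAlgebra.C_mul,
      ← pow_add]
    congr 4
    omega
  -- The two bounds are `i + 1 ≤ 2 i`, from `i ≥ 1`, and `i + 2 ≤ p i`, from `p ≥ 3`.
  refine Tame.pow_mem (Or.inl hi) (fun y => hsplit y 2 (i + 1) (by omega))
    (fun y => hsplit y p (i + 2) (by nlinarith)) hx hx'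

theorem powFiltration_one_of_odd (hp2 : p ≠ 2) : PowFiltration (orderUnits a b) p 1 :=
  powFiltration_of_pow (Or.inl le_rfl) fun _ hi _ => pow_mem_of_odd hp2 hi

/-- At level `0` divisibility comes from `ω² = a`: the square of `y ω` is divisible by `p`, so its
fourth power, and hence its `p`-th power, is divisible by `p²`. This argument fails for `p = 3`. -/
theorem powFiltration_zero_of_five_le (hp5 : 5 ≤ p) (ha : (p : ℤ_[p]) ∣ a) :
    PowFiltration (orderUnits a 0) p 0 := by
  have ht : Tame a (0 : ℤ_[p]) 0 := Or.inr ⟨ha, dvd_zero _⟩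
  refine powFiltration_of_pow ht fun i _ x hx hx' => ?_
  rcases Nat.eq_zero_or_pos i with rfl | hi
  · obtain ⟨c, hc⟩ := ha
    have hsq : ∀ y : ℤ_[p], (⟨0, (p : ℤ_[p]) ^ 0 * y⟩ : QuadraticAlgebra ℤ_[p] a 0) ^ 2 =
        .C ((p : ℤ_[p]) ^ (0 + 1)) * .C (c * y ^ 2) := by
      intro y
      rw [pow_two, ← QuadraticAlgebra.C_mul, hc]
      ext <;> simp only [QuadraticAlgebra.re_mul, QuadraticAlgebra.im_mul, QuadraticAlgebra.re_C,
        QuadraticAlgebra.im_C] <;> ring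
    refine ht.pow_mem (fun y => ⟨_, hsq y⟩) (fun y => ?_) hx hx'
    refine ⟨.C (c * y ^ 2) ^ 2 * ⟨0, (p : ℤ_[p]) ^ 0 * y⟩ ^ (p - 4), ?_⟩
    have h4 : ∀ z : QuadraticAlgebra ℤ_[p] a 0, z ^ p = (z ^ 2) ^ 2 * z ^ (p - 4) := by
      intro z
      rw [← pow_mul, ← pow_add]
      congr 1
      omega
    rw [h4, hsq, mul_pow, ← QuadraticAlgebra.C_pow, mul_assoc, ← pow_mul]
  · exact pow_mem_of_odd (by omega) hi hx hx'

/-- For `p = 2`: the squaring map raises the level by one as soon as `b / 2` times the imaginary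
part is even. -/
theorem sq_mem_of_two {a b : ℤ_[2]} {i : ℕ} (h : Tame a b i) {c : ℤ_[2]}
    (hb : b * 2 ^ i = 2 * (2 * c)) {x : (QuadraticAlgebra ℤ_[2] a b)ˣ}
    (hx : x ∈ orderUnits a b i) (hx' : x ∉ orderUnits a b (i + 1)) :
    x ^ 2 ∈ orderUnits a b (i + 1) ∧ x ^ 2 ∉ orderUnits a b (i + 2) := by
  have hr := h.not_dvd_re hx
  obtain ⟨y, hy⟩ := hx
  have hy0 := (not_mem_orderUnits_succ hy).1 hx'
  refine pow_mem_of_im_eq (c := x.1.re * y + 2 * (c * y ^ 2)) ?_ fun hd => ?_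
  · rw [Units.val_pow_eq_pow_val, pow_two, QuadraticAlgebra.im_mul, hy]
    push_cast
    linear_combination 2 ^ i * y ^ 2 * hb
  · rw [dvd_add_left (by exact_mod_cast dvd_mul_right _ _)] at hd
    rcases PadicInt.prime_p.dvd_or_dvd hd with hd | hd
    · exact hr hd
    · exact hy0 hd

theorem powFiltration_two_ramified_zero {a : ℤ_[2]} (ha : (2 : ℤ_[2]) ∣ a) :
    PowFiltration (orderUnits a 0) 2 0 := by
  have ht : Tame a (0 : ℤ_[2]) 0 := Or.inr ⟨by exact_mod_cast ha, dvd_zero _⟩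
  exact powFiltration_of_pow ht fun i hi _ => sq_mem_of_two (ht.mono hi) (c := 0) (by simp)

theorem powFiltration_two_ramified_one {a : ℤ_[2]} :
    PowFiltration (orderUnits a 2) 2 1 := by
  refine powFiltration_of_pow (Or.inl le_rfl) fun i hi _ =>
    sq_mem_of_two (Or.inl hi) (c := 2 ^ (i - 1)) ?_
  obtain ⟨i, rfl⟩ := Nat.exists_eq_add_of_le' hi
  simp [pow_succ]; ring

theorem powFiltration_two_unramified {a b : ℤ_[2]} :
    PowFiltration (orderUnits a b) 2 2 := by
  refine powFiltration_of_pow (Or.inl one_le_two) fun i hi _ =>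
    sq_mem_of_two (Or.inl (by omega)) (c := b * 2 ^ (i - 2)) ?_
  obtain ⟨i, rfl⟩ := Nat.exists_eq_add_of_le' hi
  simp [pow_succ]; ring

/-- The imaginary part of the cube is `3 im (re² + c im²)`. For `re` and `im` prime to `3` the
bracket is `1 + c` modulo `3`, so the level rises by exactly one unless `c ≡ -1`, the case of `√-3`.
-/
theorem powFiltration_three_zero {a c : ℤ_[3]} (ha : a = 3 * c) (hc : ¬ (3 : ℤ_[3]) ∣ c + 1) :
    PowFiltration (orderUnits a 0) 3 0 := by
  have ht : Tame a (0 : ℤ_[3]) 0 := Or.inr ⟨⟨c, by exact_mod_cast ha⟩, dvd_zero _⟩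
  refine powFiltration_of_pow ht fun i _ x hx hx' => ?_
  rcases Nat.eq_zero_or_pos i with rfl | hi
  · have hr := ht.not_dvd_re hx
    have hy0 := (not_mem_orderUnits_succ (j := 0) (c := x.1.im) (by simp)).1 hx'
    refine pow_mem_of_im_eq (c := x.1.im * (x.1.re ^ 2 + c * x.1.im ^ 2)) ?_ fun hd => ?_
    · rw [Units.val_pow_eq_pow_val, pow_succ, pow_two, QuadraticAlgebra.im_mul,
        QuadraticAlgebra.im_mul, QuadraticAlgebra.re_mul]
      push_cast
      linear_combination x.1.im ^ 3 * ha
    · have hsq : ∀ z : ℤ_[3], ¬ ((3 : ℕ) : ℤ_[3]) ∣ z → PadicInt.toZMod z ^ 2 = 1 := by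
        intro z hz
        have : ∀ t : ZMod 3, t ≠ 0 → t ^ 2 = 1 := by decide
        exact this _ fun h0 => hz ((toZMod_eq_zero_iff_dvd _).1 h0)
      rcases PadicInt.prime_p.dvd_or_dvd hd with hd | hd
      · exact hy0 hd
      · rw [← toZMod_eq_zero_iff_dvd, map_add, map_mul, map_pow, map_pow, hsq _ hr, hsq _ hy0] at hd
        refine hc ?_
        have := (toZMod_eq_zero_iff_dvd (c + 1)).1 (by rw [map_add, map_one, ← hd]; ring)
        exact_mod_cast this
  · exact pow_mem_of_odd (by norm_num) hi hx hx'

end Quadratic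

/-! ### Squares in `ℤ_p` -/

section Squares

/-- Hensel's lemma for `X² - (1 + t)` at `1`, where the derivative is `2`. -/
theorem isSquare_one_add_of_norm_lt {p : ℕ} [Fact p.Prime] {t : ℤ_[p]} (ht : ‖t‖ < ‖(2 : ℤ_[p])‖ ^ 2) :
    IsSquare (1 + t) := by
  have h := hensels_lemma (p := p) (R := ℤ_[p])
    (F := (Polynomial.X ^ 2 - Polynomial.C (1 + t) : Polynomial ℤ_[p])) (a := 1) (by
      simpa [one_add_one_eq_two] using ht)
  obtain ⟨z, hz, -⟩ := h
  refine ⟨z, ?_⟩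
  simp only [map_sub, map_pow, Polynomial.aeval_X, Polynomial.aeval_C, Algebra.algebraMap_self,
    RingHom.id_apply] at hz
  linear_combination -hz

theorem isUnit_two_of_ne {p : ℕ} [Fact p.Prime] (hp : p ≠ 2) : IsUnit (2 : ℤ_[p]) := by
  rw [PadicInt.isUnit_iff]
  have := PadicInt.norm_natCast_eq_one_iff (p := p) (n := 2)
  push_cast at this
  rw [this, Nat.coprime_primes Fact.out Nat.prime_two]
  exact hp

theorem isSquare_one_add_of_dvd {p : ℕ} [Fact p.Prime] (hp : p ≠ 2) {t : ℤ_[p]}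
    (ht : (p : ℤ_[p]) ∣ t) : IsSquare (1 + t) := by
  apply isSquare_one_add_of_norm_lt
  rw [PadicInt.isUnit_iff.1 (isUnit_two_of_ne hp), one_pow]
  exact (PadicInt.norm_lt_one_iff_dvd t).2 ht

theorem isSquare_one_add_eight_mul (t : ℤ_[2]) : IsSquare (1 + 8 * t) := by
  apply isSquare_one_add_of_norm_lt
  have h2 : ‖(2 : ℤ_[2])‖ = 2⁻¹ := by simpa using PadicInt.norm_p (p := 2)
  rw [show (8 : ℤ_[2]) * t = 2 ^ 3 * t by norm_num, norm_mul, norm_pow, h2]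
  have := PadicInt.norm_le_one t
  nlinarith [norm_nonneg t]

/-- For odd `p`, a unit is a square as soon as it is congruent to a unit square. -/
theorem isSquare_of_sub_dvd {p : ℕ} [Fact p.Prime] (hp : p ≠ 2) (u v : ℤ_[p]ˣ)
    (h : (p : ℤ_[p]) ∣ u - v) (hv : IsSquare (v : ℤ_[p])) : IsSquare (u : ℤ_[p]) := by
  obtain ⟨z, hz⟩ := isSquare_one_add_of_dvd hp (dvd_mul_of_dvd_left h (v⁻¹ : ℤ_[p]ˣ))
  obtain ⟨y, hy⟩ := hv
  refine ⟨y * z, ?_⟩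
  have : (u : ℤ_[p]) = v * (1 + (u - v) * (v⁻¹ : ℤ_[p]ˣ)) := by
    have := v.mul_inv
    linear_combination (-(u : ℤ_[p]) + v) * this
  rw [this, hz, hy]
  ring

theorem isSquare_of_isSquare_toZMod {p : ℕ} [Fact p.Prime] (hp : p ≠ 2) (u : ℤ_[p]ˣ)
    (h : IsSquare (PadicInt.toZMod (u : ℤ_[p]))) : IsSquare (u : ℤ_[p]) := by
  obtain ⟨y, hy⟩ := h
  obtain ⟨c, rfl⟩ := ZMod.ringHom_surjective (PadicInt.toZMod (p := p)) y
  have hc : ¬ (p : ℤ_[p]) ∣ c := by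
    intro hc
    rw [(toZMod_eq_zero_iff_dvd c).2 hc, mul_zero, toZMod_eq_zero_iff_dvd] at hy
    exact not_dvd_units u hy
  have hcu := (not_dvd_iff_isUnit c).1 hc
  refine isSquare_of_sub_dvd hp u (hcu.unit * hcu.unit) ?_ ⟨c, by simp⟩
  rw [← toZMod_eq_zero_iff_dvd, map_sub, hy]
  simp

theorem even_or_odd_padicInt_two (x : ℤ_[2]) : ∃ y, x = 2 * y ∨ x = 1 + 2 * y := by
  have h : PadicInt.toZMod x = 0 ∨ PadicInt.toZMod x = 1 := by
    have : ∀ t : ZMod 2, t = 0 ∨ t = 1 := by decide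
    exact this _
  rcases h with h | h
  · obtain ⟨y, hy⟩ := (toZMod_eq_zero_iff_dvd x).1 h
    exact ⟨y, Or.inl (by exact_mod_cast hy)⟩
  · obtain ⟨y, hy⟩ := (toZMod_eq_zero_iff_dvd (x - 1)).1 (by rw [map_sub, h, map_one, sub_self])
    exact ⟨y, Or.inr (by push_cast at hy; linear_combination hy)⟩

theorem exists_eq_one_add_two_mul (u : ℤ_[2]ˣ) : ∃ y, (u : ℤ_[2]) = 1 + 2 * y := by
  obtain ⟨y, hy | hy⟩ := even_or_odd_padicInt_two (u : ℤ_[2])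
  · exact absurd ⟨y, by exact_mod_cast hy⟩ (not_dvd_units u)
  · exact ⟨y, hy⟩

end Squares

/-! ### Integral generators of quadratic extensions -/

section Model

variable {p : ℕ} [Fact p.Prime] {E : Type*} [Field E] [Algebra ℚ_[p] E] [Algebra ℤ_[p] E]
  [IsScalarTower ℤ_[p] ℚ_[p] E]

/-- `w` is a root of `X² - bX - a`, whose norm form `r² + brs - as²` is not divisible by `p²` at
primitive vectors. -/
structure IsIntegralGenerator (a b : ℤ_[p]) (w : E) : Prop where
  mul_self : w * w = algebraMap ℤ_[p] E a + algebraMap ℤ_[p] E b * w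
  primitive : ∀ r s : ℤ_[p], (p : ℤ_[p]) ^ 2 ∣ r * r + b * r * s - a * s * s →
    (p : ℤ_[p]) ∣ r ∧ (p : ℤ_[p]) ∣ s

/-- The polynomial `X² - bX - a` has no roots modulo `p`. -/
def UnramifiedForm (a b : ℤ_[p]) : Prop :=
  ∀ r s : ℤ_[p], (p : ℤ_[p]) ∣ r * r + b * r * s - a * s * s → (p : ℤ_[p]) ∣ r ∧ (p : ℤ_[p]) ∣ s

/-- The polynomial `X² - bX - a` is an Eisenstein polynomial. -/
def EisensteinForm (a b : ℤ_[p]) : Prop := (p : ℤ_[p]) ∣ b ∧ ∃ u : ℤ_[p]ˣ, a = p * u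

theorem UnramifiedForm.primitive {a b : ℤ_[p]} (h : UnramifiedForm a b) (r s : ℤ_[p])
    (hd : (p : ℤ_[p]) ^ 2 ∣ r * r + b * r * s - a * s * s) : (p : ℤ_[p]) ∣ r ∧ (p : ℤ_[p]) ∣ s :=
  h r s ((dvd_pow_self _ two_ne_zero).trans hd)

theorem EisensteinForm.primitive {a b : ℤ_[p]} (h : EisensteinForm a b) (r s : ℤ_[p])
    (hd : (p : ℤ_[p]) ^ 2 ∣ r * r + b * r * s - a * s * s) :
    (p : ℤ_[p]) ∣ r ∧ (p : ℤ_[p]) ∣ s := by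
  obtain ⟨⟨c, rfl⟩, u, rfl⟩ := h
  have hr : (p : ℤ_[p]) ∣ r := by
    have h1 : (p : ℤ_[p]) ∣ r * r := by
      obtain ⟨k, hk⟩ := hd
      exact ⟨p * k - c * r * s + u * s * s, by linear_combination hk⟩
    exact (PadicInt.prime_p.dvd_or_dvd h1).elim id id
  refine ⟨hr, ?_⟩
  obtain ⟨r', rfl⟩ := hr
  obtain ⟨k, hk⟩ := hd
  have hp0 : (p : ℤ_[p]) ≠ 0 := PadicInt.prime_p.ne_zero
  have h2 : (p : ℤ_[p]) ∣ u * (s * s) := by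
    refine ⟨r' * r' + c * r' * s - k, mul_left_cancel₀ hp0 ?_⟩
    linear_combination -hk
  rw [u.isUnit.dvd_mul_left] at h2
  exact (PadicInt.prime_p.dvd_or_dvd h2).elim id id

theorem algebraMap_padicInt_apply (r : ℤ_[p]) : algebraMap ℤ_[p] E r = algebraMap ℚ_[p] E r := by
  rw [IsScalarTower.algebraMap_apply ℤ_[p] ℚ_[p] E]; rfl

theorem exists_pow_mul_eq (x : ℚ_[p]) : ∃ (n : ℕ) (r : ℤ_[p]), (p : ℚ_[p]) ^ n * x = r := by
  have hp1 : (1 : ℝ) < p := by exact_mod_cast (Fact.out : p.Prime).one_lt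
  obtain ⟨n, hn⟩ := pow_unbounded_of_one_lt ‖x‖ hp1
  have h : ‖(p : ℚ_[p]) ^ n * x‖ ≤ 1 := by
    rw [norm_mul, norm_pow, Padic.norm_p, inv_pow, inv_mul_le_iff₀ (by positivity), mul_one]
    exact hn.le
  exact ⟨n, ⟨_, h⟩, rfl⟩

namespace IsIntegralGenerator

variable {a b : ℤ_[p]} {w : E} (hw : IsIntegralGenerator a b w)
include hw

theorem ne_algebraMap (c : ℚ_[p]) : w ≠ algebraMap ℚ_[p] E c := by
  rintro rfl
  have h := hw.mul_self
  rw [algebraMap_padicInt_apply, algebraMap_padicInt_apply, ← map_mul, ← map_mul, ← map_add] at h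
  have h := (algebraMap ℚ_[p] E).injective h
  have hc : IsIntegral ℤ_[p] c := by
    refine ⟨Polynomial.X ^ 2 - (Polynomial.C b * Polynomial.X + Polynomial.C a), ?_, ?_⟩
    · monicity!
    · simp [Polynomial.eval₂_sub]
      linear_combination h
  obtain ⟨c, rfl⟩ := IsIntegrallyClosed.isIntegral_iff.1 hc
  -- The primitive vector `(c, -1)` would have norm form zero.
  have h0 : c * c + b * c * (-1) - a * (-1) * (-1) = 0 := by
    have : c * c = a + b * c := by
      apply PadicInt.ext
      push_cast
      exact h
    linear_combination this
  have := (hw.primitive c (-1) (by rw [h0]; exact dvd_zero _)).2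
  rw [dvd_neg] at this
  exact PadicInt.prime_p.not_isUnit (isUnit_of_dvd_one this)

theorem eq_zero_of_add_eq_zero {r s : ℚ_[p]}
    (h : algebraMap ℚ_[p] E r + algebraMap ℚ_[p] E s * w = 0) : r = 0 ∧ s = 0 := by
  have hs : s = 0 := by
    by_contra hs
    refine hw.ne_algebraMap (-r / s) ?_
    have : algebraMap ℚ_[p] E s ≠ 0 := by simpa using hs
    rw [map_div₀, map_neg, eq_div_iff this]
    linear_combination h
  refine ⟨?_, hs⟩
  rw [hs, map_zero, zero_mul, add_zero] at h
  simpa using h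

/-- The extension field as a quadratic algebra over `ℚ_p`. -/
def fieldHom : QuadraticAlgebra ℚ_[p] (a : ℚ_[p]) b →ₐ[ℚ_[p]] E :=
  QuadraticAlgebra.lift ⟨w, by
    rw [hw.mul_self, Algebra.smul_def, Algebra.smul_def, mul_one, algebraMap_padicInt_apply,
      algebraMap_padicInt_apply]⟩

theorem fieldHom_apply (z : QuadraticAlgebra ℚ_[p] (a : ℚ_[p]) b) :
    hw.fieldHom z = algebraMap ℚ_[p] E z.re + algebraMap ℚ_[p] E z.im * w := by
  simp [fieldHom, QuadraticAlgebra.lift, Algebra.smul_def]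

theorem fieldHom_bijective [Algebra.IsQuadraticExtension ℚ_[p] E] :
    Function.Bijective hw.fieldHom := by
  have hinj : Function.Injective hw.fieldHom := by
    rw [injective_iff_map_eq_zero]
    intro z hz
    rw [fieldHom_apply] at hz
    have := hw.eq_zero_of_add_eq_zero hz
    ext
    · exact this.1
    · exact this.2
  refine ⟨hinj, ?_⟩
  have hfr : Module.finrank ℚ_[p] (QuadraticAlgebra ℚ_[p] (a : ℚ_[p]) b) =
      Module.finrank ℚ_[p] E := by
    rw [QuadraticAlgebra.finrank_eq_two, Algebra.IsQuadraticExtension.finrank_eq_two]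
  have : FiniteDimensional ℚ_[p] (QuadraticAlgebra ℚ_[p] (a : ℚ_[p]) b) := inferInstance
  exact (LinearMap.injective_iff_surjective_of_finrank_eq_finrank hfr
    (f := hw.fieldHom.toLinearMap)).1 hinj

theorem exists_eq_add [Algebra.IsQuadraticExtension ℚ_[p] E] (x : E) :
    ∃ r s : ℚ_[p], x = algebraMap ℚ_[p] E r + algebraMap ℚ_[p] E s * w := by
  obtain ⟨z, rfl⟩ := hw.fieldHom_bijective.2 x
  exact ⟨z.re, z.im, hw.fieldHom_apply z⟩

theorem norm_add [Algebra.IsQuadraticExtension ℚ_[p] E] (r s : ℚ_[p]) :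
    Algebra.norm ℚ_[p] (algebraMap ℚ_[p] E r + algebraMap ℚ_[p] E s * w) =
      r * r + b * r * s - a * s * s := by
  let e := AlgEquiv.ofBijective hw.fieldHom hw.fieldHom_bijective
  have h1 : algebraMap ℚ_[p] E r + algebraMap ℚ_[p] E s * w = e ⟨r, s⟩ :=
    (hw.fieldHom_apply ⟨r, s⟩).symm
  rw [h1, Algebra.norm_eq_of_algEquiv e, Algebra.norm_apply]
  exact (QuadraticAlgebra.det_toLinearMap_eq_norm _).trans (QuadraticAlgebra.norm_def _)

omit [Algebra ℚ_[p] E] [IsScalarTower ℤ_[p] ℚ_[p] E] in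
theorem isIntegral_self : IsIntegral ℤ_[p] w := by
  refine ⟨Polynomial.X ^ 2 - (Polynomial.C b * Polynomial.X + Polynomial.C a), ?_, ?_⟩
  · monicity!
  · simp [Polynomial.eval₂_sub]
    linear_combination hw.mul_self

omit [Algebra ℚ_[p] E] [IsScalarTower ℤ_[p] ℚ_[p] E] in
-- Descent on the denominator. If `p ^ (n + 1)` clears the denominators of `r` and `s` and their
-- norm form is integral, then the norm form of the cleared vector is divisible by `p²`, and
-- `primitive` cancels one factor `p` from both coordinates.
theorem exists_of_pow_mul (n : ℕ) : ∀ r s : ℚ_[p], (∃ r' : ℤ_[p], (p : ℚ_[p]) ^ n * r = r') →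
    (∃ s' : ℤ_[p], (p : ℚ_[p]) ^ n * s = s') → (∃ m : ℤ_[p], r * r + b * r * s - a * s * s = m) →
    (∃ r' : ℤ_[p], r = r') ∧ ∃ s' : ℤ_[p], s = s' := by
  induction n with
  | zero =>
    intro r s hr hs _
    simp only [pow_zero, one_mul] at hr hs
    exact ⟨hr, hs⟩
  | succ n ih =>
    rintro r s ⟨r', hr⟩ ⟨s', hs⟩ ⟨m, hm⟩
    have hd : (p : ℤ_[p]) ^ 2 ∣ r' * r' + b * r' * s' - a * s' * s' := by
      refine ⟨(p : ℤ_[p]) ^ (2 * n) * m, ?_⟩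
      apply PadicInt.ext
      push_cast
      rw [← hr, ← hs, ← hm]
      ring
    obtain ⟨⟨r₁, h1⟩, s₁, h2⟩ := hw.primitive r' s' hd
    have hp0 : (p : ℚ_[p]) ≠ 0 := by exact_mod_cast (Fact.out : p.Prime).ne_zero
    refine ih r s ⟨r₁, mul_left_cancel₀ hp0 ?_⟩ ⟨s₁, mul_left_cancel₀ hp0 ?_⟩ ⟨m, hm⟩
    · rw [← mul_assoc, ← pow_succ', hr, h1]; push_cast; rfl
    · rw [← mul_assoc, ← pow_succ', hs, h2]; push_cast; rfl

/-- An integral element has integral norm, and the descent on denominators then makes both its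
coordinates integral. This is why the ring of integers is `ℤ_p[w]`. -/
theorem exists_of_isIntegral [Algebra.IsQuadraticExtension ℚ_[p] E] {x : E}
    (hx : IsIntegral ℤ_[p] x) :
    ∃ r s : ℤ_[p], x = algebraMap ℤ_[p] E r + algebraMap ℤ_[p] E s * w := by
  obtain ⟨r, s, rfl⟩ := hw.exists_eq_add x
  have h1 := Algebra.isIntegral_norm ℚ_[p] hx
  rw [hw.norm_add] at h1
  obtain ⟨m, hm⟩ := IsIntegrallyClosed.isIntegral_iff.1 h1
  obtain ⟨n₁, r₁, hr₁⟩ := exists_pow_mul_eq r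
  obtain ⟨n₂, s₁, hs₁⟩ := exists_pow_mul_eq s
  obtain ⟨⟨r', rfl⟩, s', rfl⟩ := hw.exists_of_pow_mul (n₁ + n₂) r s
    ⟨p ^ n₂ * r₁, by push_cast; rw [← hr₁]; ring⟩ ⟨p ^ n₁ * s₁, by push_cast; rw [← hs₁]; ring⟩
    ⟨m, hm.symm⟩
  exact ⟨r', s', by rw [algebraMap_padicInt_apply, algebraMap_padicInt_apply]⟩

/-- The inclusion of the quadratic algebra `ℤ_p[w]` into the ring of integers. -/
def integersHom : QuadraticAlgebra ℤ_[p] a b →ₐ[ℤ_[p]] RingOfInt p E :=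
  QuadraticAlgebra.lift ⟨⟨w, hw.isIntegral_self⟩, by
    apply Subtype.ext
    simp [hw.mul_self, Algebra.smul_def]⟩

omit [Algebra ℚ_[p] E] [IsScalarTower ℤ_[p] ℚ_[p] E] in
theorem coe_integersHom (z : QuadraticAlgebra ℤ_[p] a b) :
    (hw.integersHom z : E) = algebraMap ℤ_[p] E z.re + algebraMap ℤ_[p] E z.im * w := by
  simp [integersHom, QuadraticAlgebra.lift, Algebra.smul_def]

theorem integersHom_bijective [Algebra.IsQuadraticExtension ℚ_[p] E] :
    Function.Bijective hw.integersHom := by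
  constructor
  · rw [injective_iff_map_eq_zero]
    intro z hz
    have h := hw.coe_integersHom z
    rw [hz, algebraMap_padicInt_apply, algebraMap_padicInt_apply] at h
    have := hw.eq_zero_of_add_eq_zero h.symm
    ext
    · simpa using this.1
    · simpa using this.2
  · rintro ⟨x, hx⟩
    obtain ⟨r, s, rfl⟩ := hw.exists_of_isIntegral hx
    exact ⟨⟨r, s⟩, Subtype.ext (hw.coe_integersHom _)⟩

/-- The ring of integers is `ℤ_p[w]`. -/
def integersEquiv [Algebra.IsQuadraticExtension ℚ_[p] E] :
    QuadraticAlgebra ℤ_[p] a b ≃ₐ[ℤ_[p]] RingOfInt p E :=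
  AlgEquiv.ofBijective hw.integersHom hw.integersHom_bijective

end IsIntegralGenerator

end Model

/-! ### The maximal ideal, the ramification index and the discriminant -/

section Ideal

variable {p : ℕ} [Fact p.Prime] {E : Type*} [Field E] [Algebra ℚ_[p] E] [Algebra ℤ_[p] E]
  [IsScalarTower ℤ_[p] ℚ_[p] E] [Algebra.IsQuadraticExtension ℚ_[p] E]

instance isDedekindDomain_ringOfInt : IsDedekindDomain (RingOfInt p E) :=
  integralClosure.isDedekindDomain ℤ_[p] ℚ_[p] E

theorem EisensteinForm.tame {a b : ℤ_[p]} (h : EisensteinForm a b) (j : ℕ) : Tame a b j := by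
  obtain ⟨hb, u, rfl⟩ := h
  exact Or.inr ⟨dvd_mul_right _ _, hb⟩

theorem EisensteinForm.isUnit_iff {a b : ℤ_[p]} (h : EisensteinForm a b)
    (x : QuadraticAlgebra ℤ_[p] a b) : IsUnit x ↔ ¬ (p : ℤ_[p]) ∣ x.re := by
  constructor
  · rintro ⟨u, rfl⟩
    exact (h.tame 0).not_dvd_re (mem_orderUnits_zero u)
  · intro hx
    rw [isUnit_quadratic_iff]
    intro hd
    obtain ⟨⟨c, rfl⟩, u, rfl⟩ := h
    obtain ⟨k, hk⟩ := hd
    have : (p : ℤ_[p]) ∣ x.re * x.re :=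
      ⟨k - c * x.re * x.im + u * x.im * x.im, by linear_combination hk⟩
    exact hx ((PadicInt.prime_p.dvd_or_dvd this).elim id id)

theorem UnramifiedForm.isUnit_iff {a b : ℤ_[p]} (h : UnramifiedForm a b)
    (x : QuadraticAlgebra ℤ_[p] a b) : IsUnit x ↔ ¬ QuadraticAlgebra.C (p : ℤ_[p]) ∣ x := by
  rw [QuadraticAlgebra.C_eq_algebraMap, QuadraticAlgebra.algebraMap_dvd_iff, isUnit_quadratic_iff,
    not_iff_not]
  refine ⟨h _ _, ?_⟩
  rintro ⟨h1, h2⟩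
  exact dvd_sub (dvd_add (dvd_mul_of_dvd_left h1 _) (dvd_mul_of_dvd_right h2 _))
    (dvd_mul_of_dvd_right h2 _)

theorem EisensteinForm.omega_dvd_iff {a b : ℤ_[p]} (h : EisensteinForm a b)
    (x : QuadraticAlgebra ℤ_[p] a b) : QuadraticAlgebra.omega ∣ x ↔ (p : ℤ_[p]) ∣ x.re := by
  obtain ⟨-, u, rfl⟩ := h
  constructor
  · rintro ⟨z, rfl⟩
    rw [QuadraticAlgebra.re_mul, QuadraticAlgebra.omega_re, QuadraticAlgebra.omega_im]
    exact ⟨u * z.im, by ring⟩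
  · rintro ⟨c, hc⟩
    refine ⟨⟨x.im - b * (c * (u⁻¹ : ℤ_[p]ˣ)), c * (u⁻¹ : ℤ_[p]ˣ)⟩, ?_⟩
    ext
    · rw [QuadraticAlgebra.re_mul, QuadraticAlgebra.omega_re, QuadraticAlgebra.omega_im, hc]
      have := u.mul_inv
      linear_combination -(p * c : ℤ_[p]) * this
    · rw [QuadraticAlgebra.im_mul, QuadraticAlgebra.omega_re, QuadraticAlgebra.omega_im]
      ring

/-- In the ramified case, the square of the uniformizer is associated to `p`. -/
theorem EisensteinForm.exists_omega_sq {a b : ℤ_[p]} (h : EisensteinForm a b) :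
    ∃ v : (QuadraticAlgebra ℤ_[p] a b)ˣ,
      (QuadraticAlgebra.omega : QuadraticAlgebra ℤ_[p] a b) ^ 2 = .C (p : ℤ_[p]) * v := by
  obtain ⟨⟨c, hc⟩, u, hu⟩ := id h
  have hv : IsUnit (⟨u, c⟩ : QuadraticAlgebra ℤ_[p] a b) := (h.isUnit_iff _).2 (not_dvd_units u)
  refine ⟨hv.unit, ?_⟩
  rw [pow_two, QuadraticAlgebra.omega_mul_omega_eq_mk]
  ext
  · simp only [IsUnit.unit_spec, QuadraticAlgebra.re_mul, QuadraticAlgebra.re_C,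
      QuadraticAlgebra.im_C, hu]
    ring
  · simp only [IsUnit.unit_spec, QuadraticAlgebra.im_mul, QuadraticAlgebra.re_C,
      QuadraticAlgebra.im_C, hc]
    ring

theorem C_dvd_iff {a b : ℤ_[p]} (c : ℤ_[p]) (x : QuadraticAlgebra ℤ_[p] a b) :
    QuadraticAlgebra.C c ∣ x ↔ c ∣ x.re ∧ c ∣ x.im := by
  rw [QuadraticAlgebra.C_eq_algebraMap, QuadraticAlgebra.algebraMap_dvd_iff]

/-- As `ω²` is `p` times a unit, even powers of `ω` act like powers of `p`. One further factor `ω`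
requires one more `p` in the real part only. -/
theorem EisensteinForm.omega_pow_dvd_iff {a b : ℤ_[p]} (h : EisensteinForm a b) (m : ℕ)
    (x : QuadraticAlgebra ℤ_[p] a b) :
    QuadraticAlgebra.omega ^ m ∣ x ↔
      (p : ℤ_[p]) ^ ((m + 1) / 2) ∣ x.re ∧ (p : ℤ_[p]) ^ (m / 2) ∣ x.im := by
  obtain ⟨v, hv⟩ := h.exists_omega_sq
  have heven : ∀ k : ℕ, (QuadraticAlgebra.omega : QuadraticAlgebra ℤ_[p] a b) ^ (2 * k) =
      .C ((p : ℤ_[p]) ^ k) * (v ^ k : (QuadraticAlgebra ℤ_[p] a b)ˣ) := by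
    intro k
    rw [pow_mul, hv, mul_pow, Units.val_pow_eq_pow_val, QuadraticAlgebra.C_pow]
  rcases Nat.even_or_odd' m with ⟨k, rfl | rfl⟩
  · rw [heven, Units.mul_right_dvd, C_dvd_iff]
    congr! 3 <;> omega
  · have hp : (p : ℤ_[p]) ^ k ≠ 0 := pow_ne_zero _ PadicInt.prime_p.ne_zero
    rw [pow_succ, heven, mul_right_comm, Units.mul_right_dvd, show (2 * k + 1 + 1) / 2 = k + 1 by omega,
      show (2 * k + 1) / 2 = k by omega]
    constructor
    · rintro ⟨z, rfl⟩
      rw [mul_assoc]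
      have h1 := (h.omega_dvd_iff (QuadraticAlgebra.omega * z)).1 (dvd_mul_right _ _)
      simp only [QuadraticAlgebra.C_mul_eq_smul, QuadraticAlgebra.re_smul,
        QuadraticAlgebra.im_smul, smul_eq_mul]
      exact ⟨by rw [pow_succ]; exact mul_dvd_mul_left _ h1, dvd_mul_right _ _⟩
    · rintro ⟨⟨r, hr⟩, ⟨s, hs⟩⟩
      have hx : x = .C ((p : ℤ_[p]) ^ k) * ⟨p * r, s⟩ := by
        rw [QuadraticAlgebra.C_mul_eq_smul]
        ext
        · simp [hr, pow_succ, mul_assoc]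
        · simp [hs]
      rw [hx]
      exact mul_dvd_mul_left _ ((h.omega_dvd_iff _).2 (dvd_mul_right _ _))

theorem ramIndex_eq_of_map_eq {n : ℕ} (hn : n ≠ 0) (h : (maximalIdeal ℤ_[p]).map (algebraMap ℤ_[p] (RingOfInt p E)) =
    maximalIdeal (RingOfInt p E) ^ n) : ramIndex p E = n := by
  have hlo : (maximalIdeal (RingOfInt p E)).LiesOver (maximalIdeal ℤ_[p]) := by
    refine ⟨?_⟩
    have : ((maximalIdeal (RingOfInt p E)).under ℤ_[p]).IsMaximal :=
      Ideal.isMaximal_comap_of_isIntegral_of_isMaximal _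
    exact (eq_maximalIdeal this).symm
  have hinj : Function.Injective (algebraMap ℤ_[p] (RingOfInt p E)) := by
    intro x y hxy
    have h1 : algebraMap ℤ_[p] E x = algebraMap ℤ_[p] E y := congrArg Subtype.val hxy
    rw [algebraMap_padicInt_apply, algebraMap_padicInt_apply] at h1
    exact PadicInt.ext ((algebraMap ℚ_[p] E).injective h1)
  have hne : (maximalIdeal ℤ_[p]).map (algebraMap ℤ_[p] (RingOfInt p E)) ≠ ⊥ := by
    rw [Ne, Ideal.map_eq_bot_iff_of_injective hinj]
    exact IsDiscreteValuationRing.not_a_field _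
  have hm : maximalIdeal (RingOfInt p E) ≠ ⊥ := by
    intro h0
    rw [h, h0, Ideal.bot_pow hn] at hne
    exact hne rfl
  rw [ramIndex, Ideal.IsDedekindDomain.ramificationIdx_eq_multiplicity (maximalIdeal ℤ_[p]) _ hne, h]
  refine multiplicity_pow_self hm ?_ n
  rw [Ideal.isUnit_iff]
  exact Ideal.IsPrime.ne_top'

namespace IsIntegralGenerator

variable {a b : ℤ_[p]} {w : E} (hw : IsIntegralGenerator a b w)
include hw

theorem mem_maximalIdeal_iff (x : QuadraticAlgebra ℤ_[p] a b) :
    hw.integersEquiv x ∈ maximalIdeal (RingOfInt p E) ↔ ¬ IsUnit x := by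
  rw [mem_maximalIdeal, mem_nonunits_iff, not_iff_not]
  exact MulEquiv.isUnit_map hw.integersEquiv

theorem maximalIdeal_eq_span {t : QuadraticAlgebra ℤ_[p] a b}
    (ht : ∀ x : QuadraticAlgebra ℤ_[p] a b, ¬ IsUnit x ↔ t ∣ x) :
    maximalIdeal (RingOfInt p E) = Ideal.span {hw.integersEquiv t} := by
  ext y
  obtain ⟨x, rfl⟩ := hw.integersEquiv.surjective y
  rw [hw.mem_maximalIdeal_iff, ht, Ideal.mem_span_singleton]
  exact (map_dvd_iff hw.integersEquiv).symm

theorem maximalIdeal_eq_span_of_unramified (h : UnramifiedForm a b) :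
    maximalIdeal (RingOfInt p E) = Ideal.span {hw.integersEquiv (.C (p : ℤ_[p]))} :=
  hw.maximalIdeal_eq_span fun x => by rw [h.isUnit_iff, not_not]

theorem maximalIdeal_eq_span_of_eisenstein (h : EisensteinForm a b) :
    maximalIdeal (RingOfInt p E) = Ideal.span {hw.integersEquiv QuadraticAlgebra.omega} :=
  hw.maximalIdeal_eq_span fun x => by rw [h.isUnit_iff, not_not, h.omega_dvd_iff]

/-- The identification of the unit groups. -/
def unitsEquiv : (QuadraticAlgebra ℤ_[p] a b)ˣ ≃* (RingOfInt p E)ˣ :=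
  Units.mapEquiv hw.integersEquiv.toMulEquiv

theorem coe_unitsEquiv (u : (QuadraticAlgebra ℤ_[p] a b)ˣ) :
    (hw.unitsEquiv u : RingOfInt p E) = hw.integersEquiv u := rfl

theorem unitsEquiv_mem_iff {t : QuadraticAlgebra ℤ_[p] a b}
    (ht : maximalIdeal (RingOfInt p E) = Ideal.span {hw.integersEquiv t}) (m : ℕ)
    (u : (QuadraticAlgebra ℤ_[p] a b)ˣ) :
    hw.unitsEquiv u ∈ unitFiltration p E m ↔ t ^ m ∣ (u : QuadraticAlgebra ℤ_[p] a b) - 1 := by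
  rw [unitFiltration, MonoidHom.mem_ker, Units.ext_iff, Units.coe_map, Units.val_one,
    coe_unitsEquiv, MonoidHom.coe_coe, ← map_one (Ideal.Quotient.mk _), Ideal.Quotient.mk_eq_mk_iff_sub_mem,
    ht, Ideal.span_singleton_pow, Ideal.mem_span_singleton, ← map_pow,
    ← map_one hw.integersEquiv, ← map_sub, map_dvd_iff hw.integersEquiv]

theorem unitsEquiv_mem_iff_of_unramified (h : UnramifiedForm a b) (m : ℕ)
    (u : (QuadraticAlgebra ℤ_[p] a b)ˣ) :
    hw.unitsEquiv u ∈ unitFiltration p E m ↔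
      (p : ℤ_[p]) ^ m ∣ u.1.re - 1 ∧ (p : ℤ_[p]) ^ m ∣ u.1.im := by
  rw [hw.unitsEquiv_mem_iff (hw.maximalIdeal_eq_span_of_unramified h), ← QuadraticAlgebra.C_pow,
    C_dvd_iff]
  simp [QuadraticAlgebra.re_one, QuadraticAlgebra.im_one]

theorem unitsEquiv_mem_iff_of_eisenstein (h : EisensteinForm a b) (m : ℕ)
    (u : (QuadraticAlgebra ℤ_[p] a b)ˣ) :
    hw.unitsEquiv u ∈ unitFiltration p E m ↔
      (p : ℤ_[p]) ^ ((m + 1) / 2) ∣ u.1.re - 1 ∧ (p : ℤ_[p]) ^ (m / 2) ∣ u.1.im := by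
  rw [hw.unitsEquiv_mem_iff (hw.maximalIdeal_eq_span_of_eisenstein h), h.omega_pow_dvd_iff]
  simp [QuadraticAlgebra.re_one, QuadraticAlgebra.im_one]

theorem integersEquiv_C (c : ℤ_[p]) :
    hw.integersEquiv (.C c) = algebraMap ℤ_[p] (RingOfInt p E) c := by
  rw [QuadraticAlgebra.C_eq_algebraMap, AlgEquiv.commutes]

theorem ramIndex_of_unramified (h : UnramifiedForm a b) : ramIndex p E = 1 := by
  refine ramIndex_eq_of_map_eq one_ne_zero ?_
  rw [PadicInt.maximalIdeal_eq_span_p, Ideal.map_span, Set.image_singleton,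
    hw.maximalIdeal_eq_span_of_unramified h, hw.integersEquiv_C, pow_one]

theorem ramIndex_of_eisenstein (h : EisensteinForm a b) : ramIndex p E = 2 := by
  refine ramIndex_eq_of_map_eq two_ne_zero ?_
  obtain ⟨v, hv⟩ := h.exists_omega_sq
  rw [PadicInt.maximalIdeal_eq_span_p, Ideal.map_span, Set.image_singleton,
    hw.maximalIdeal_eq_span_of_eisenstein h, Ideal.span_singleton_pow, ← map_pow, hv, map_mul,
    hw.integersEquiv_C]
  exact (Ideal.span_singleton_mul_right_unit (v.isUnit.map hw.integersEquiv) _).symm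

end IsIntegralGenerator

theorem basis_quadraticAlgebra_zero {a b : ℤ_[p]} : QuadraticAlgebra.basis a b 0 = 1 := by
  apply (QuadraticAlgebra.basis a b).repr.injective
  ext i; fin_cases i <;> simp [QuadraticAlgebra.re_one, QuadraticAlgebra.im_one]

theorem basis_quadraticAlgebra_one {a b : ℤ_[p]} : QuadraticAlgebra.basis a b 1 = ⟨0, 1⟩ := by
  apply (QuadraticAlgebra.basis a b).repr.injective
  ext i; fin_cases i <;> simp

theorem trace_quadraticAlgebra {a b : ℤ_[p]} (z : QuadraticAlgebra ℤ_[p] a b) :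
    Algebra.trace ℤ_[p] (QuadraticAlgebra ℤ_[p] a b) z = 2 * z.re + b * z.im := by
  rw [Algebra.trace_eq_matrix_trace (QuadraticAlgebra.basis a b), Matrix.trace, Fin.sum_univ_two,
    Matrix.diag, Matrix.diag, Algebra.leftMulMatrix_eq_repr_mul, Algebra.leftMulMatrix_eq_repr_mul]
  rw [basis_quadraticAlgebra_zero, basis_quadraticAlgebra_one]
  simp
  ring

theorem discr_quadraticAlgebra {a b : ℤ_[p]} :
    Algebra.discr ℤ_[p] (QuadraticAlgebra.basis a b) = b ^ 2 + 4 * a := by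
  rw [Algebra.discr_def, Matrix.det_fin_two]
  simp only [Algebra.traceMatrix_apply, Algebra.traceForm_apply, basis_quadraticAlgebra_zero,
    basis_quadraticAlgebra_one, trace_quadraticAlgebra, QuadraticAlgebra.re_mul,
    QuadraticAlgebra.im_mul, QuadraticAlgebra.re_one, QuadraticAlgebra.im_one]
  ring

/-- Discriminants of two bases differ by the square of a unit. -/
theorem exists_discr_eq_unit_sq_mul {A B ι : Type*} [CommRing A] [CommRing B] [Algebra A B]
    [Fintype ι] [DecidableEq ι] (b c : Module.Basis ι A B) :
    ∃ u : Aˣ, Algebra.discr A c = u ^ 2 * Algebra.discr A b := by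
  have hdet : IsUnit (b.toMatrix c).det := by
    have := Module.Basis.toMatrix_mul_toMatrix_flip b c
    exact (Matrix.isUnit_iff_isUnit_det _).1 (IsUnit.of_mul_eq_one _ this)
  refine ⟨hdet.unit, ?_⟩
  rw [IsUnit.unit_spec, ← Algebra.discr_of_matrix_vecMul]
  congr 1
  ext i
  rw [Matrix.vecMul, dotProduct]
  conv_lhs => rw [← b.sum_repr (c i)]
  refine Finset.sum_congr rfl fun j _ => ?_
  rw [Matrix.map_apply, Module.Basis.toMatrix_apply, Algebra.smul_def, mul_comm]

theorem IsIntegralGenerator.valuation_discr {a b : ℤ_[p]} {w : E} (hw : IsIntegralGenerator a b w)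
    {δ : ℕ} (h : HasDiscrValuation p E δ) : (b ^ 2 + 4 * a).valuation = δ := by
  obtain ⟨B, hB⟩ := h
  let f : Fin (Module.finrank ℚ_[p] E) ≃ Fin 2 :=
    finCongr (Algebra.IsQuadraticExtension.finrank_eq_two ℚ_[p] E)
  let B' := (QuadraticAlgebra.basis a b).map hw.integersEquiv.toLinearEquiv
  obtain ⟨u, hu⟩ := exists_discr_eq_unit_sq_mul B' (B.reindex f)
  have h1 : Algebra.discr ℤ_[p] B' = b ^ 2 + 4 * a := by
    rw [← discr_quadraticAlgebra,
      Algebra.discr_eq_discr_of_algEquiv (QuadraticAlgebra.basis a b) hw.integersEquiv]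
    rfl
  rw [← hB, ← Algebra.discr_reindex ℤ_[p] B f, ← Module.Basis.coe_reindex, hu, h1]
  by_cases h0 : b ^ 2 + 4 * a = 0
  · rw [h0, mul_zero]
  · have hv : (u : ℤ_[p]).valuation = 0 := by
      have h2 := PadicInt.valuation_mul u.ne_zero (u⁻¹).ne_zero
      rw [Units.mul_inv, PadicInt.valuation_one] at h2
      omega
    rw [PadicInt.valuation_mul (pow_ne_zero _ u.ne_zero) h0, PadicInt.valuation_pow, hv, mul_zero,
      zero_add]

end Ideal

/-! ### Classification of quadratic extensions by generators of the ring of integers -/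

section Classification

/-- The uniformizer `ν` is arbitrary because the ramified case uses `ν = -a`, which is a norm. -/
theorem exists_eq_zpow_mul_unit {p : ℕ} [Fact p.Prime] {ν : ℤ_[p]} {v : ℤ_[p]ˣ} (hν : ν = p * v)
    {x : ℚ_[p]} (hx : x ≠ 0) : ∃ (k : ℤ) (u : ℤ_[p]ˣ), x = (ν : ℚ_[p]) ^ k * (u : ℤ_[p]) := by
  have hp0 : (p : ℚ_[p]) ≠ 0 := by exact_mod_cast (Fact.out : p.Prime).ne_zero
  have hpr : (p : ℝ) ≠ 0 := by exact_mod_cast (Fact.out : p.Prime).ne_zero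
  have hn : ‖(ν : ℚ_[p])‖ = (p : ℝ)⁻¹ := by
    rw [PadicInt.padic_norm_e_of_padicInt, hν, norm_mul, PadicInt.norm_p, PadicInt.norm_units,
      mul_one]
  have hν0 : (ν : ℚ_[p]) ≠ 0 := by
    intro h0
    rw [h0, norm_zero] at hn
    exact inv_ne_zero hpr hn.symm
  have h1 : ‖(ν : ℚ_[p]) ^ (-x.valuation) * x‖ = 1 := by
    rw [norm_mul, norm_zpow, hn, Padic.norm_eq_zpow_neg_valuation hx, inv_zpow', neg_neg,
      ← zpow_add₀ hpr, add_neg_cancel, zpow_zero]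
  refine ⟨x.valuation, PadicInt.mkUnits h1, ?_⟩
  rw [PadicInt.mkUnits_eq, ← mul_assoc, ← zpow_add₀ hν0, add_neg_cancel, zpow_zero, one_mul]

variable {p : ℕ} [Fact p.Prime] {E : Type*} [Field E] [Algebra ℚ_[p] E] [Algebra ℤ_[p] E]
  [IsScalarTower ℤ_[p] ℚ_[p] E] [Algebra.IsQuadraticExtension ℚ_[p] E]

variable (p E) in
omit [Algebra ℤ_[p] E] [IsScalarTower ℤ_[p] ℚ_[p] E] in
-- Kummer theory: `E/ℚ_p` is cyclic of degree two and `ℚ_p` contains the primitive second root of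
-- unity `-1`.
theorem exists_sq_eq_algebraMap :
    ∃ (α : E) (d : ℚ_[p]), α ^ 2 = algebraMap ℚ_[p] E d ∧ ∀ c, α ≠ algebraMap ℚ_[p] E c := by
  have hfr : Module.finrank ℚ_[p] E = 2 := Algebra.IsQuadraticExtension.finrank_eq_two _ _
  have hprim : (primitiveRoots (Module.finrank ℚ_[p] E) ℚ_[p]).Nonempty := by
    rw [hfr]
    refine ⟨-1, (mem_primitiveRoots two_pos).2 ?_⟩
    exact IsPrimitiveRoot.neg_one 0 (by norm_num)
  obtain ⟨α, ⟨d, hd⟩, htop⟩ := exists_root_adjoin_eq_top_of_isCyclic ℚ_[p] E hprim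
  refine ⟨α, d, by rw [hd, hfr], ?_⟩
  rintro c rfl
  have h1 : IntermediateField.adjoin ℚ_[p] {algebraMap ℚ_[p] E c} = ⊥ :=
    IntermediateField.adjoin_simple_eq_bot_iff.2 (algebraMap_mem _ c)
  rw [h1] at htop
  have := IntermediateField.finrank_top' (F := ℚ_[p]) (E := E)
  rw [← htop, IntermediateField.finrank_bot, hfr] at this
  omega

variable (p E) in
theorem exists_sq_eq_pow_mul_unit :
    ∃ (α : E) (i : ℕ) (u : ℤ_[p]ˣ), i ≤ 1 ∧ α ^ 2 = algebraMap ℤ_[p] E (p ^ i * u) ∧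
      ∀ c, α ≠ algebraMap ℚ_[p] E c := by
  obtain ⟨α, d, hα, hc⟩ := exists_sq_eq_algebraMap p E
  have hd : d ≠ 0 := by
    rintro rfl
    rw [map_zero, pow_eq_zero_iff two_ne_zero] at hα
    exact hc 0 (by rw [hα, map_zero])
  have hp0 : (p : ℚ_[p]) ≠ 0 := by exact_mod_cast (Fact.out : p.Prime).ne_zero
  obtain ⟨k, u, rfl⟩ := exists_eq_zpow_mul_unit (ν := (p : ℤ_[p])) (v := 1) (by simp) hd
  rw [PadicInt.coe_natCast] at hα
  -- Dividing `α` by `p ^ (k / 2)` reduces the exponent `k` to its remainder modulo `2`.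
  refine ⟨α * algebraMap ℚ_[p] E (p ^ (-(k / 2))), (k % 2).toNat, u, by omega, ?_, ?_⟩
  · rw [mul_pow, hα, algebraMap_padicInt_apply, ← map_pow, ← map_mul]
    congr 1
    push_cast
    rw [← zpow_natCast (p : ℚ_[p]) (k % 2).toNat, Int.toNat_of_nonneg (by omega), mul_right_comm,
      ← zpow_natCast (_ ^ (-(k / 2))) 2, ← zpow_mul, ← zpow_add₀ hp0]
    congr 2
    have := Int.emod_add_mul_ediv k 2
    push_cast
    linarith
  · intro c h
    refine hc (c * p ^ (k / 2)) ?_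
    rw [map_mul, ← h, mul_assoc, ← map_mul, ← zpow_add₀ hp0]
    simp

theorem eisensteinForm_zero {a : ℤ_[p]} {u : ℤ_[p]ˣ} (h : a = p * u) : EisensteinForm a 0 :=
  ⟨dvd_zero _, u, h⟩

theorem unramifiedForm_of_not_isSquare {a : ℤ_[p]} (h : ¬ IsSquare (PadicInt.toZMod a)) :
    UnramifiedForm a 0 := by
  intro r s hd
  rw [← toZMod_eq_zero_iff_dvd, ← toZMod_eq_zero_iff_dvd]
  rw [← toZMod_eq_zero_iff_dvd] at hd
  simp only [map_sub, map_mul, zero_mul, add_zero] at hd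
  have hs : PadicInt.toZMod s = 0 := by
    by_contra hs
    refine h ⟨PadicInt.toZMod r / PadicInt.toZMod s, ?_⟩
    field_simp
    linear_combination -hd
  refine ⟨?_, hs⟩
  rw [hs, mul_zero, sub_zero] at hd
  exact mul_self_eq_zero.1 hd

theorem unramifiedForm_two : UnramifiedForm (-1 : ℤ_[2]) (-1) := by
  intro r s hd
  rw [← toZMod_eq_zero_iff_dvd, ← toZMod_eq_zero_iff_dvd]
  rw [← toZMod_eq_zero_iff_dvd] at hd
  simp only [map_sub, map_add, map_mul, map_neg, map_one] at hd
  have : ∀ x y : ZMod 2, x * x + -1 * x * y - -1 * y * y = 0 → x = 0 ∧ y = 0 := by decide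
  exact this _ _ hd

theorem isUnit_one_add_two_mul (c : ℤ_[2]) : IsUnit (1 + 2 * c) := by
  rw [← not_dvd_iff_isUnit]
  intro h
  rw [dvd_add_left (by exact_mod_cast dvd_mul_right _ _)] at h
  exact PadicInt.prime_p.not_isUnit (isUnit_of_dvd_one h)

theorem eisensteinForm_two (c : ℤ_[2]) : EisensteinForm (2 + 4 * c) 2 := by
  have hu := isUnit_one_add_two_mul c
  exact ⟨by simp, hu.unit, by rw [IsUnit.unit_spec]; push_cast; ring⟩

omit [Algebra.IsQuadraticExtension ℚ_[p] E] in
theorem false_of_isSquare {α : E} {d : ℤ_[p]} (hα : α ^ 2 = algebraMap ℤ_[p] E d)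
    (hc : ∀ c, α ≠ algebraMap ℚ_[p] E c) (hd : IsSquare d) : False := by
  obtain ⟨z, rfl⟩ := hd
  rw [map_mul, ← pow_two, sq_eq_sq_iff_eq_or_eq_neg] at hα
  rcases hα with h | h
  · exact hc z (by rw [h, algebraMap_padicInt_apply])
  · exact hc (-z) (by rw [h, algebraMap_padicInt_apply, map_neg])

variable (p E) in
/-- A quadratic extension of `ℚ_p` has an integral generator of one of five standard kinds. -/
theorem exists_isIntegralGenerator : ∃ (a b : ℤ_[p]) (w : E), IsIntegralGenerator a b w ∧
    ((p ≠ 2 ∧ b = 0 ∧ ¬ IsSquare (PadicInt.toZMod a)) ∨ (p = 2 ∧ a = -1 ∧ b = -1) ∨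
      (p ≠ 2 ∧ b = 0 ∧ ∃ u : ℤ_[p]ˣ, a = p * u) ∨ (p = 2 ∧ b = 0 ∧ ∃ u : ℤ_[p]ˣ, a = p * u) ∨
      (p = 2 ∧ b = 2 ∧ ∃ c, a = 2 + 4 * c)) := by
  obtain ⟨α, i, u, hi, hα, hc⟩ := exists_sq_eq_pow_mul_unit p E
  interval_cases i
  · rw [pow_zero, one_mul] at hα
    by_cases hp : p = 2
    · subst hp
      obtain ⟨e, he⟩ := exists_eq_one_add_two_mul u
      obtain ⟨f, rfl | rfl⟩ := even_or_odd_padicInt_two e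
      · obtain ⟨g, rfl | rfl⟩ := even_or_odd_padicInt_two f
        · refine (false_of_isSquare hα hc ?_).elim
          rw [he, show (1 : ℤ_[2]) + 2 * (2 * (2 * g)) = 1 + 8 * g by ring]
          exact isSquare_one_add_eight_mul g
        · -- the unramified extension
          have h3 : IsUnit (-3 : ℤ_[2]) := by
            rw [show (-3 : ℤ_[2]) = 1 + 2 * (-2) by norm_num]
            exact isUnit_one_add_two_mul _
          have hinv := h3.mul_val_inv
          set t : ℤ_[2] := ((h3.unit⁻¹ : ℤ_[2]ˣ) : ℤ_[2]) with ht
          -- Here `u = 5 + 8 g = -3 (1 + 8 (1 + g) t)` with `t` the inverse of `-3`. So `u` is `-3`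
          -- times a square, and `w` can be taken to be a primitive cube root of unity.
          obtain ⟨z, hz⟩ := isSquare_one_add_eight_mul ((1 + g) * t)
          have hz2 : (u : ℤ_[2]) = -3 * (z * z) := by
            rw [he, ← hz]
            linear_combination -8 * (1 + g) * hinv
          have hz0 : algebraMap ℤ_[2] E z ≠ 0 := by
            intro h0
            have : (algebraMap ℤ_[2] E) u = 0 := by rw [hz2, map_mul, map_mul, h0]; simp
            rw [this, pow_eq_zero_iff two_ne_zero] at hα
            exact hc 0 (by rw [hα, map_zero])
          have : CharZero E := charZero_of_injective_algebraMap (algebraMap ℚ_[2] E).injective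
          refine ⟨-1, -1, (-1 + α / algebraMap ℤ_[2] E z) / 2,
            ⟨?_, unramifiedForm_two.primitive⟩, Or.inr (Or.inl ⟨rfl, rfl, rfl⟩)⟩
          have hα' : (α / algebraMap ℤ_[2] E z) ^ 2 = -3 := by
            rw [div_pow, hα, hz2, div_eq_iff (pow_ne_zero _ hz0)]
            rw [map_mul, map_neg, map_ofNat, map_mul, pow_two]
          simp only [map_neg, map_one]
          field_simp
          field_simp at hα'
          linear_combination hα'
      -- Now `u = 3 + 4 f`, and the shift `w = 1 + α` has the Eisenstein polynomial `X² - 2 X - (2 +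
      -- 4 f)`.
      · refine ⟨2 + 4 * f, 2, 1 + α, ⟨?_, (eisensteinForm_two f).primitive⟩,
          Or.inr (Or.inr (Or.inr (Or.inr ⟨rfl, rfl, f, rfl⟩)))⟩
        rw [he] at hα
        simp only [map_add, map_mul, map_one, map_ofNat] at hα ⊢
        linear_combination hα
    · refine ⟨u, 0, α, ⟨?_, ?_⟩, Or.inl ⟨hp, rfl, ?_⟩⟩
      · rw [← pow_two, hα]; simp
      · apply UnramifiedForm.primitive
        apply unramifiedForm_of_not_isSquare
        exact fun h => false_of_isSquare hα hc (isSquare_of_isSquare_toZMod hp u h)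
      · exact fun h => false_of_isSquare hα hc (isSquare_of_isSquare_toZMod hp u h)
  · rw [pow_one] at hα
    refine ⟨p * u, 0, α, ⟨?_, (eisensteinForm_zero rfl).primitive⟩, ?_⟩
    · rw [← pow_two, hα]; simp
    · by_cases hp : p = 2
      · exact Or.inr (Or.inr (Or.inr (Or.inl ⟨hp, rfl, u, rfl⟩)))
      · exact Or.inr (Or.inr (Or.inl ⟨hp, rfl, u, rfl⟩))

end Classification

/-! ### The quadratic character -/

section QuadChar

variable {p : ℕ} [Fact p.Prime] {E : Type*} [Field E] [Algebra ℚ_[p] E] [Algebra ℤ_[p] E]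
  [IsScalarTower ℤ_[p] ℚ_[p] E] [Algebra.IsQuadraticExtension ℚ_[p] E]

variable (p E) in
/-- The subgroup of norms. -/
def normGroup : Subgroup ℚ_[p]ˣ where
  carrier := {a | ∃ y : E, Algebra.norm ℚ_[p] y = (a : ℚ_[p])}
  one_mem' := ⟨1, by simp⟩
  mul_mem' := by
    rintro a b ⟨x, hx⟩ ⟨y, hy⟩
    exact ⟨x * y, by rw [map_mul, hx, hy, Units.val_mul]⟩
  inv_mem' := by
    rintro a ⟨x, hx⟩
    exact ⟨x⁻¹, by rw [Algebra.norm_inv, hx, Units.val_inv_eq_inv_val]⟩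

omit [Algebra ℤ_[p] E] [IsScalarTower ℤ_[p] ℚ_[p] E] in
theorem quadChar_of_mem {a : ℚ_[p]ˣ} (h : a ∈ normGroup p E) : quadChar p E a = 1 := if_pos h

omit [Algebra ℤ_[p] E] [IsScalarTower ℤ_[p] ℚ_[p] E] in
theorem quadChar_of_not_mem {a : ℚ_[p]ˣ} (h : a ∉ normGroup p E) : quadChar p E a = -1 := if_neg h

omit [Algebra ℤ_[p] E] [IsScalarTower ℤ_[p] ℚ_[p] E] in
-- `quadChar` is multiplicative as soon as the norms have index at most two. This is the only part
-- of local class field theory that is needed, and it is checked case by case from norm forms.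
theorem exists_hom_eq_quadChar (h : ∀ a b, a ∉ normGroup p E → b ∉ normGroup p E →
    a * b ∈ normGroup p E) : ∃ χ : ℚ_[p]ˣ →* ℂˣ, ∀ a, χ a = quadChar p E a := by
  refine ⟨MonoidHom.mk' (quadChar p E) fun a b => ?_, fun a => rfl⟩
  by_cases ha : a ∈ normGroup p E <;> by_cases hb : b ∈ normGroup p E
  · rw [quadChar_of_mem ha, quadChar_of_mem hb, quadChar_of_mem (mul_mem ha hb), one_mul]
  · rw [quadChar_of_mem ha, quadChar_of_not_mem hb, quadChar_of_not_mem, one_mul]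
    exact fun hab => hb ((Subgroup.mul_mem_cancel_left _ ha).1 hab)
  · rw [quadChar_of_not_mem ha, quadChar_of_mem hb, quadChar_of_not_mem, mul_one]
    exact fun hab => ha ((Subgroup.mul_mem_cancel_right _ hb).1 hab)
  · rw [quadChar_of_not_mem ha, quadChar_of_not_mem hb, quadChar_of_mem (h a b ha hb)]
    simp

variable (p) in
/-- The inclusion `ℤ_p^× → ℚ_p^×`. -/
def padicUnits : ℤ_[p]ˣ →* ℚ_[p]ˣ :=
  Units.map ((PadicInt.Coe.ringHom : ℤ_[p] →+* ℚ_[p]) : ℤ_[p] →* ℚ_[p])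

theorem coe_padicUnits (u : ℤ_[p]ˣ) : (padicUnits p u : ℚ_[p]) = (u : ℤ_[p]) := rfl

omit [Algebra ℤ_[p] E] [IsScalarTower ℤ_[p] ℚ_[p] E] in
theorem sq_mem_normGroup (a : ℚ_[p]ˣ) : a ^ 2 ∈ normGroup p E :=
  ⟨algebraMap ℚ_[p] E a, by
    rw [Algebra.norm_algebraMap, Algebra.IsQuadraticExtension.finrank_eq_two]; simp⟩

omit [Algebra ℤ_[p] E] [IsScalarTower ℤ_[p] ℚ_[p] E] in
/-- A unit is a norm if its product with a unit norm is a square. -/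
theorem padicUnits_mem_of_isSquare {u v : ℤ_[p]ˣ} (hv : padicUnits p v ∈ normGroup p E)
    (h : IsSquare ((u * v : ℤ_[p]ˣ) : ℤ_[p])) : padicUnits p u ∈ normGroup p E := by
  obtain ⟨z, hz⟩ := h
  have hzu : IsUnit z := isUnit_of_mul_isUnit_left (hz ▸ (u * v).isUnit)
  have h1 : u * v = hzu.unit ^ 2 := by
    apply Units.ext
    rw [hz, Units.val_pow_eq_pow_val, IsUnit.unit_spec, pow_two]
  rw [← Subgroup.mul_mem_cancel_right _ hv, ← map_mul, h1, map_pow]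
  exact sq_mem_normGroup _

omit [Algebra ℤ_[p] E] [IsScalarTower ℤ_[p] ℚ_[p] E] in
-- When all units are norms, the classes modulo norms are represented by powers of `p`, and squares
-- are norms; so the index is at most two.
theorem exists_hom_of_unramified (h : ∀ u : ℤ_[p]ˣ, padicUnits p u ∈ normGroup p E) :
    ∃ χ : ℚ_[p]ˣ →* ℂˣ, (∀ x, χ x = quadChar p E x) ∧ ∀ u, χ (padicUnits p u) = 1 := by
  obtain ⟨χ, hχ⟩ := exists_hom_eq_quadChar (p := p) (E := E) (by
    have hp0 : (p : ℚ_[p]) ≠ 0 := by exact_mod_cast (Fact.out : p.Prime).ne_zero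
    have key : ∀ x : ℚ_[p]ˣ, x ∉ normGroup p E → Units.mk0 (p : ℚ_[p]) hp0 * x ∈ normGroup p E := by
      intro x hx
      obtain ⟨k, u, hk⟩ := exists_eq_zpow_mul_unit (ν := (p : ℤ_[p])) (v := 1) (by simp) x.ne_zero
      have hk' : x = Units.mk0 (p : ℚ_[p]) hp0 ^ k * padicUnits p u := by
        apply Units.ext
        rw [hk]
        simp [coe_padicUnits]
      rw [hk'] at hx ⊢
      rw [Subgroup.mul_mem_cancel_right _ (h u)] at hx
      rw [← mul_assoc, Subgroup.mul_mem_cancel_right _ (h u)]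
      rcases Int.even_or_odd' k with ⟨l, rfl | rfl⟩
      · refine absurd ?_ hx
        rw [mul_comm 2 l, zpow_mul]
        exact sq_mem_normGroup _
      · rw [← zpow_one_add, show (1 : ℤ) + (2 * l + 1) = (l + 1) * 2 by ring, zpow_mul]
        exact sq_mem_normGroup _
    intro x y hx hy
    have h1 := mul_mem (key x hx) (key y hy)
    rw [mul_mul_mul_comm, ← pow_two, Subgroup.mul_mem_cancel_left _ (sq_mem_normGroup _)] at h1
    exact h1)
  exact ⟨χ, hχ, fun u => by rw [hχ, quadChar_of_mem (h u)]⟩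

namespace IsIntegralGenerator

variable {a b : ℤ_[p]} {w : E} (hw : IsIntegralGenerator a b w)
include hw

theorem mem_normGroup_of_eq {x : ℚ_[p]ˣ} {r s : ℚ_[p]}
    (h : (x : ℚ_[p]) = r * r + b * r * s - a * s * s) : x ∈ normGroup p E :=
  ⟨_, (hw.norm_add r s).trans h.symm⟩

theorem padicUnits_mem_normGroup_iff (u : ℤ_[p]ˣ) : padicUnits p u ∈ normGroup p E ↔
    ∃ r s : ℤ_[p], (u : ℤ_[p]) = r * r + b * r * s - a * s * s := by
  constructor
  · rintro ⟨y, hy⟩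
    obtain ⟨r, s, rfl⟩ := hw.exists_eq_add y
    rw [hw.norm_add, coe_padicUnits] at hy
    obtain ⟨n₁, r₁, hr₁⟩ := exists_pow_mul_eq r
    obtain ⟨n₂, s₁, hs₁⟩ := exists_pow_mul_eq s
    obtain ⟨⟨r', rfl⟩, s', rfl⟩ := hw.exists_of_pow_mul (n₁ + n₂) r s
      ⟨p ^ n₂ * r₁, by push_cast; rw [← hr₁]; ring⟩
      ⟨p ^ n₁ * s₁, by push_cast; rw [← hs₁]; ring⟩ ⟨_, hy⟩
    refine ⟨r', s', PadicInt.ext ?_⟩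
    push_cast
    exact hy.symm
  · rintro ⟨r, s, h⟩
    refine hw.mem_normGroup_of_eq (r := r) (s := s) ?_
    rw [coe_padicUnits, h]
    push_cast
    rfl

/-- The uniformizer `-a` is the norm of `w`, so every class modulo norms is represented by a unit
and the index can be checked on units. -/
theorem exists_hom_of_eisenstein (hE : EisensteinForm a b)
    (h : ∀ u v : ℤ_[p]ˣ, padicUnits p u ∉ normGroup p E → padicUnits p v ∉ normGroup p E →
      padicUnits p (u * v) ∈ normGroup p E) :
    ∃ χ : ℚ_[p]ˣ →* ℂˣ, ∀ x, χ x = quadChar p E x := by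
  obtain ⟨-, u₀, ha⟩ := hE
  have ha' : -a = p * (-u₀ : ℤ_[p]ˣ) := by rw [ha]; push_cast; ring
  have ha0 : ((-a : ℤ_[p]) : ℚ_[p]) ≠ 0 := by
    rw [PadicInt.coe_ne_zero, ha']
    exact mul_ne_zero PadicInt.prime_p.ne_zero (-u₀).ne_zero
  have hν : Units.mk0 _ ha0 ∈ normGroup p E :=
    hw.mem_normGroup_of_eq (r := 0) (s := 1) (by simp)
  have key : ∀ x : ℚ_[p]ˣ, ∃ u : ℤ_[p]ˣ, ∃ y ∈ normGroup p E, x = y * padicUnits p u := by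
    intro x
    obtain ⟨k, u, hk⟩ := exists_eq_zpow_mul_unit ha' x.ne_zero
    refine ⟨u, _, zpow_mem hν k, Units.ext ?_⟩
    rw [hk]
    simp [coe_padicUnits]
  refine exists_hom_eq_quadChar fun x y hx hy => ?_
  obtain ⟨u, x', hx', rfl⟩ := key x
  obtain ⟨v, y', hy', rfl⟩ := key y
  rw [Subgroup.mul_mem_cancel_left _ hx'] at hx
  rw [Subgroup.mul_mem_cancel_left _ hy'] at hy
  rw [mul_mul_mul_comm, ← map_mul]
  exact mul_mem (mul_mem hx' hy') (h u v hx hy)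

end IsIntegralGenerator

end QuadChar

/-! ### The restriction of the quadratic character to the units -/

section UnitNorms

theorem toZModPow_eq_iff {p : ℕ} [Fact p.Prime] (k : ℕ) (x y : ℤ_[p]) :
    PadicInt.toZModPow k x = PadicInt.toZModPow k y ↔ (p : ℤ_[p]) ^ k ∣ x - y := by
  rw [← sub_eq_zero, ← map_sub, ← RingHom.mem_ker, PadicInt.ker_toZModPow,
    Ideal.mem_span_singleton]

theorem isSquare_of_toZModPow_three (v : ℤ_[2]ˣ) (h : PadicInt.toZModPow 3 (v : ℤ_[2]) = 1) :
    IsSquare (v : ℤ_[2]) := by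
  rw [← map_one (PadicInt.toZModPow 3), toZModPow_eq_iff] at h
  obtain ⟨t, ht⟩ := h
  have : (v : ℤ_[2]) = 1 + 8 * t := by
    push_cast at ht
    linear_combination ht
  rw [this]
  exact isSquare_one_add_eight_mul t

theorem exists_toZModPow_unit_two (k : ℕ) (u : ℤ_[2]ˣ) :
    ∃ y, PadicInt.toZModPow k (u : ℤ_[2]) = 1 + 2 * y := by
  obtain ⟨y, hy⟩ := exists_eq_one_add_two_mul u
  exact ⟨_, by rw [hy, map_add, map_one, map_mul, map_ofNat]⟩

variable {p : ℕ} [Fact p.Prime] {E : Type*} [Field E] [Algebra ℚ_[p] E] [Algebra ℤ_[p] E]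
  [IsScalarTower ℤ_[p] ℚ_[p] E] [Algebra.IsQuadraticExtension ℚ_[p] E]

/-- The form `r² - a s²` represents every residue modulo the odd prime `p`. A unit congruent to a
unit norm is a norm, because the product of the two is a square. -/
theorem IsIntegralGenerator.padicUnits_mem_of_not_isSquare {a : ℤ_[p]} {w : E}
    (hw : IsIntegralGenerator a 0 w) (hp : p ≠ 2) (ha : ¬ IsSquare (PadicInt.toZMod a))
    (u : ℤ_[p]ˣ) : padicUnits p u ∈ normGroup p E := by
  let t : ℤ_[p] →+* ZMod p := PadicInt.toZMod
  have hodd : Fintype.card (ZMod p) % 2 = 1 := by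
    rw [ZMod.card]
    exact Nat.odd_iff.1 ((Fact.out : p.Prime).odd_of_ne_two hp)
  have ha0 : t a ≠ 0 := fun h0 => ha (by change IsSquare (t a); rw [h0]; exact IsSquare.zero)
  obtain ⟨x, y, hxy⟩ := FiniteField.exists_root_sum_quadratic (R := ZMod p)
    (f := Polynomial.X ^ 2 - Polynomial.C (t u)) (g := - (Polynomial.C (t a) * Polynomial.X ^ 2))
    (by
      rw [Polynomial.degree_X_pow_sub_C two_pos]; rfl)
    (by
      rw [Polynomial.degree_neg, Polynomial.degree_C_mul_X_pow 2 ha0]; rfl) hodd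
  obtain ⟨r, rfl⟩ := ZMod.ringHom_surjective t x
  obtain ⟨s, rfl⟩ := ZMod.ringHom_surjective t y
  simp only [Polynomial.eval_sub, Polynomial.eval_pow, Polynomial.eval_X, Polynomial.eval_C,
    Polynomial.eval_neg, Polynomial.eval_mul] at hxy
  have hd : t (r * r + 0 * r * s - a * s * s) = t u := by
    simp only [map_sub, map_add, map_mul, map_zero]
    linear_combination hxy
  have hv : IsUnit (r * r + 0 * r * s - a * s * s) := by
    rw [← not_dvd_iff_isUnit, ← toZMod_eq_zero_iff_dvd]
    change ¬ t _ = 0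
    rw [hd]
    exact fun h0 => not_dvd_units u ((toZMod_eq_zero_iff_dvd _).1 h0)
  refine padicUnits_mem_of_isSquare (v := hv.unit) ((hw.padicUnits_mem_normGroup_iff _).2
    ⟨r, s, by rw [IsUnit.unit_spec]⟩) (isSquare_of_isSquare_toZMod hp _ ?_)
  change IsSquare (t _)
  rw [Units.val_mul, IsUnit.unit_spec, map_mul, hd]
  exact ⟨_, rfl⟩

/-- The norm form represents every odd class modulo `8`, odd squares are `1` modulo `8`, and units
congruent to `1` modulo `8` are squares. -/
theorem IsIntegralGenerator.padicUnits_mem_of_two {E : Type*} [Field E] [Algebra ℚ_[2] E]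
    [Algebra ℤ_[2] E] [IsScalarTower ℤ_[2] ℚ_[2] E] [Algebra.IsQuadraticExtension ℚ_[2] E] {w : E}
    (hw : IsIntegralGenerator (-1 : ℤ_[2]) (-1) w) (u : ℤ_[2]ˣ) :
    padicUnits 2 u ∈ normGroup 2 E := by
  let t : ℤ_[2] →+* ZMod (2 ^ 3) := PadicInt.toZModPow 3
  obtain ⟨c, hc⟩ := exists_toZModPow_unit_two 3 u
  obtain ⟨x, y, hxy⟩ : ∃ x y : ZMod (2 ^ 3), x * x - x * y + y * y = 1 + 2 * c := by
    have key : ∀ c : ZMod (2 ^ 3), ∃ x y : ZMod (2 ^ 3), x * x - x * y + y * y = 1 + 2 * c := by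
      decide
    exact key c
  obtain ⟨r, rfl⟩ := ZMod.ringHom_surjective t x
  obtain ⟨s, rfl⟩ := ZMod.ringHom_surjective t y
  have hd : t (r * r + -1 * r * s - -1 * s * s) = 1 + 2 * c := by
    simp only [map_sub, map_add, map_mul, map_neg, map_one]
    linear_combination hxy
  have hv : IsUnit (r * r + -1 * r * s - -1 * s * s) := by
    rw [← not_dvd_iff_isUnit]
    intro h
    have h2 := (toZModPow_eq_iff 3 (u : ℤ_[2]) (r * r + -1 * r * s - -1 * s * s)).1
      (hc.trans hd.symm)
    have h3 : ((2 : ℕ) : ℤ_[2]) ∣ u - (r * r + -1 * r * s - -1 * s * s) :=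
      (dvd_pow_self _ three_ne_zero).trans h2
    exact not_dvd_units u ((dvd_sub_left h).1 h3)
  refine padicUnits_mem_of_isSquare (v := hv.unit) ((hw.padicUnits_mem_normGroup_iff _).2
    ⟨r, s, by rw [IsUnit.unit_spec]⟩) (isSquare_of_toZModPow_three _ ?_)
  change t _ = 1
  rw [Units.val_mul, IsUnit.unit_spec, map_mul, hd]
  change PadicInt.toZModPow 3 (u : ℤ_[2]) * _ = 1
  rw [hc]
  have key : ∀ c : ZMod (2 ^ 3), (1 + 2 * c) * (1 + 2 * c) = 1 := by decide
  exact key c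

omit [Algebra ℤ_[p] E] [IsScalarTower ℤ_[p] ℚ_[p] E] in
theorem eq_one_iff_mem_normGroup {χ : ℚ_[p]ˣ →* ℂˣ} (hχ : ∀ x, χ x = quadChar p E x) (x : ℚ_[p]ˣ) :
    χ x = 1 ↔ x ∈ normGroup p E := by
  constructor
  · intro h
    by_contra hx
    rw [hχ, quadChar_of_not_mem hx] at h
    have := congrArg Units.val h
    norm_num at this
  · intro h
    rw [hχ, quadChar_of_mem h]

theorem isSquare_mul_of_not_isSquare {F : Type*} [Field F] [Fintype F] [DecidableEq F]
    {x y : F} (hx : ¬ IsSquare x) (hy : ¬ IsSquare y) : IsSquare (x * y) := by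
  have hx0 : x ≠ 0 := fun h => hx (h ▸ IsSquare.zero)
  have hy0 : y ≠ 0 := fun h => hy (h ▸ IsSquare.zero)
  rw [← quadraticChar_one_iff_isSquare (mul_ne_zero hx0 hy0), map_mul,
    (quadraticChar_neg_one_iff_not_isSquare).2 hx, (quadraticChar_neg_one_iff_not_isSquare).2 hy]
  norm_num

namespace IsIntegralGenerator

/-- Modulo `p` the norm form is `r²`, and a unit that is a square modulo `p` is a square. -/
theorem padicUnits_mem_iff_of_odd {a : ℤ_[p]} {w : E} (hw : IsIntegralGenerator a 0 w)
    (hp : p ≠ 2) (ha : EisensteinForm a 0) (u : ℤ_[p]ˣ) :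
    padicUnits p u ∈ normGroup p E ↔ IsSquare (PadicInt.toZMod (u : ℤ_[p])) := by
  constructor
  · intro h
    obtain ⟨r, s, hrs⟩ := (hw.padicUnits_mem_normGroup_iff u).1 h
    obtain ⟨-, v, rfl⟩ := ha
    refine ⟨PadicInt.toZMod r, ?_⟩
    rw [hrs]
    simp
  · intro h
    obtain ⟨z, hz⟩ := isSquare_of_isSquare_toZMod hp u h
    exact (hw.padicUnits_mem_normGroup_iff u).2 ⟨z, 0, by rw [hz]; ring⟩

theorem exists_hom_of_odd {a : ℤ_[p]} {w : E} (hw : IsIntegralGenerator a 0 w)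
    (hp : p ≠ 2) (ha : EisensteinForm a 0) :
    ∃ χ : ℚ_[p]ˣ →* ℂˣ, (∀ x, χ x = quadChar p E x) ∧
      (∀ u : ℤ_[p]ˣ, (p : ℤ_[p]) ∣ u - 1 → χ (padicUnits p u) = 1) ∧
      ∃ u : ℤ_[p]ˣ, χ (padicUnits p u) ≠ 1 := by
  have hF : ringChar (ZMod p) ≠ 2 := by rwa [ZMod.ringChar_zmod_n]
  obtain ⟨χ, hχ⟩ := hw.exists_hom_of_eisenstein ha (fun u v hu hv => by
    rw [hw.padicUnits_mem_iff_of_odd hp ha] at hu hv ⊢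
    rw [Units.val_mul, map_mul]
    exact isSquare_mul_of_not_isSquare hu hv)
  refine ⟨χ, hχ, fun u hu => ?_, ?_⟩
  · rw [eq_one_iff_mem_normGroup hχ, hw.padicUnits_mem_iff_of_odd hp ha]
    rw [← toZMod_eq_zero_iff_dvd, map_sub, map_one, sub_eq_zero] at hu
    rw [hu]
    exact IsSquare.one
  · obtain ⟨y, hy⟩ := FiniteField.exists_nonsquare hF
    obtain ⟨r, rfl⟩ := ZMod.ringHom_surjective (PadicInt.toZMod (p := p)) y
    have hr : IsUnit r := by
      rw [← not_dvd_iff_isUnit, ← toZMod_eq_zero_iff_dvd]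
      intro h0
      rw [h0] at hy
      exact hy IsSquare.zero
    refine ⟨hr.unit, ?_⟩
    rw [Ne, eq_one_iff_mem_normGroup hχ, hw.padicUnits_mem_iff_of_odd hp ha, IsUnit.unit_spec]
    exact hy

section Two

variable {E : Type*} [Field E] [Algebra ℚ_[2] E]
    [Algebra ℤ_[2] E] [IsScalarTower ℤ_[2] ℚ_[2] E] [Algebra.IsQuadraticExtension ℚ_[2] E] {w : E}

/-- A unit norm is `r² - 2 v s²` with `r` odd. Modulo `8` this is `1` for even `s` and `1 - 2 v` for
odd `s`. -/
theorem padicUnits_mem_iff_of_two_zero {a : ℤ_[2]} (hw : IsIntegralGenerator a 0 w) {v : ℤ_[2]ˣ}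
    (ha : a = (2 : ℕ) * v) (u : ℤ_[2]ˣ) :
    padicUnits 2 u ∈ normGroup 2 E ↔ PadicInt.toZModPow 3 (u : ℤ_[2]) = 1 ∨
      PadicInt.toZModPow 3 (u : ℤ_[2]) = 1 - 2 * PadicInt.toZModPow 3 (v : ℤ_[2]) := by
  obtain ⟨x, hx⟩ := exists_toZModPow_unit_two 3 u
  obtain ⟨c, hc⟩ := exists_toZModPow_unit_two 3 v
  constructor
  · intro h
    obtain ⟨r, s, hrs⟩ := (hw.padicUnits_mem_normGroup_iff u).1 h
    have h1 := congrArg (PadicInt.toZModPow 3) hrs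
    rw [ha] at h1
    simp only [map_sub, map_add, map_mul, map_zero, map_natCast] at h1
    have key : ∀ x c r s : ZMod (2 ^ 3),
        1 + 2 * x = r * r + 0 * r * s - ((2 : ℕ) : ZMod (2 ^ 3)) * (1 + 2 * c) * s * s →
        1 + 2 * x = 1 ∨ 1 + 2 * x = 1 - 2 * (1 + 2 * c) := by decide
    rw [hx, hc] at h1 ⊢
    exact key _ _ _ _ h1
  · rintro (h | h)
    · obtain ⟨z, hz⟩ := isSquare_of_toZModPow_three u h
      exact (hw.padicUnits_mem_normGroup_iff u).2 ⟨z, 0, by rw [hz]; ring⟩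
    · have h1 : IsUnit (1 - a) := by
        have := isUnit_one_add_two_mul (-v : ℤ_[2])
        rwa [show (1 : ℤ_[2]) - a = 1 + 2 * -v by rw [ha]; push_cast; ring]
      refine padicUnits_mem_of_isSquare (v := h1.unit) ((hw.padicUnits_mem_normGroup_iff _).2
        ⟨1, 1, by rw [IsUnit.unit_spec]; ring⟩) (isSquare_of_toZModPow_three _ ?_)
      rw [Units.val_mul, IsUnit.unit_spec, map_mul, h, ha]
      simp only [map_sub, map_mul, map_one, map_natCast, hc]
      clear hx h hc
      revert c; decide

theorem exists_hom_of_two_zero {a : ℤ_[2]} (hw : IsIntegralGenerator a 0 w) {v : ℤ_[2]ˣ}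
    (ha : a = (2 : ℕ) * v) :
    ∃ χ : ℚ_[2]ˣ →* ℂˣ, (∀ x, χ x = quadChar 2 E x) ∧
      (∀ u : ℤ_[2]ˣ, (2 : ℤ_[2]) ^ 3 ∣ u - 1 → χ (padicUnits 2 u) = 1) ∧
      ∃ u : ℤ_[2]ˣ, (2 : ℤ_[2]) ^ 2 ∣ u - 1 ∧ χ (padicUnits 2 u) ≠ 1 := by
  obtain ⟨c, hc⟩ := exists_toZModPow_unit_two 3 v
  obtain ⟨χ, hχ⟩ := hw.exists_hom_of_eisenstein (eisensteinForm_zero ha) (fun u u' hu hu' => by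
    rw [hw.padicUnits_mem_iff_of_two_zero ha] at hu hu' ⊢
    rw [Units.val_mul, map_mul]
    obtain ⟨x, hx⟩ := exists_toZModPow_unit_two 3 u
    obtain ⟨y, hy⟩ := exists_toZModPow_unit_two 3 u'
    rw [hx, hc] at hu
    rw [hy, hc] at hu'
    rw [hx, hy, hc]
    have key : ∀ x y c : ZMod (2 ^ 3), ¬ (1 + 2 * x = 1 ∨ 1 + 2 * x = 1 - 2 * (1 + 2 * c)) →
        ¬ (1 + 2 * y = 1 ∨ 1 + 2 * y = 1 - 2 * (1 + 2 * c)) →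
        ((1 + 2 * x) * (1 + 2 * y) = 1 ∨ (1 + 2 * x) * (1 + 2 * y) = 1 - 2 * (1 + 2 * c)) := by
      decide
    exact key _ _ _ hu hu')
  refine ⟨χ, hχ, fun u hu => ?_, ?_⟩
  · rw [eq_one_iff_mem_normGroup hχ, hw.padicUnits_mem_iff_of_two_zero ha]
    left
    rw [← map_one (PadicInt.toZModPow 3), toZModPow_eq_iff]
    exact_mod_cast hu
  -- The unit `5` is congruent to `1` modulo `4` but is not a norm: `5 ≢ 1` modulo `8`, and `1 - 2 v
  -- ≡ 3` modulo `4`. So the character has conductor exactly `3` on units.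
  · have h5 := isUnit_one_add_two_mul (2 : ℤ_[2])
    refine ⟨h5.unit, ⟨1, by rw [IsUnit.unit_spec]; norm_num⟩, ?_⟩
    rw [Ne, eq_one_iff_mem_normGroup hχ, hw.padicUnits_mem_iff_of_two_zero ha, IsUnit.unit_spec,
      hc]
    simp only [map_add, map_mul, map_one, map_ofNat]
    clear hc
    revert c; decide

/-- For odd `r` the norm form is `1 + 2 s (r - s)` modulo `4`, and `s (r - s)` is even. Conversely,
units `≡ 1` modulo `8` are squares, and units `≡ 5` become squares after multiplication by a norm
that is itself `≡ 5`. -/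
theorem padicUnits_mem_iff_of_two_two {c : ℤ_[2]} (hw : IsIntegralGenerator (2 + 4 * c) 2 w)
    (u : ℤ_[2]ˣ) :
    padicUnits 2 u ∈ normGroup 2 E ↔ PadicInt.toZModPow 2 (u : ℤ_[2]) = 1 := by
  constructor
  · intro h
    obtain ⟨r, s, hrs⟩ := (hw.padicUnits_mem_normGroup_iff u).1 h
    obtain ⟨x, hx⟩ := exists_toZModPow_unit_two 2 u
    have h1 := congrArg (PadicInt.toZModPow 2) hrs
    simp only [map_sub, map_add, map_mul, map_ofNat] at h1
    rw [hx] at h1 ⊢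
    have key : ∀ x c r s : ZMod (2 ^ 2),
        1 + 2 * x = r * r + 2 * r * s - (2 + 4 * c) * s * s → 1 + 2 * x = 1 := by decide
    exact key _ _ _ _ h1
  · intro h
    rw [← map_one (PadicInt.toZModPow 2), toZModPow_eq_iff] at h
    obtain ⟨y, hy⟩ := h
    push_cast at hy
    obtain ⟨z, rfl | rfl⟩ := even_or_odd_padicInt_two y
    · obtain ⟨t, ht⟩ := isSquare_one_add_eight_mul z
      exact (hw.padicUnits_mem_normGroup_iff u).2 ⟨t, 0, by linear_combination hy + ht⟩
    · -- the norm of `-1 + 2w`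
      have h1 := isUnit_one_add_two_mul (-6 - 8 * c)
      refine padicUnits_mem_of_isSquare (v := h1.unit) ((hw.padicUnits_mem_normGroup_iff _).2
        ⟨-1, 2, by rw [IsUnit.unit_spec]; ring⟩) ?_
      rw [Units.val_mul, IsUnit.unit_spec,
        show (u : ℤ_[2]) * (1 + 2 * (-6 - 8 * c)) = 1 + 8 * (-7 - 10 * c - 11 * z - 16 * c * z) by
          linear_combination (1 + 2 * (-6 - 8 * c)) * hy]
      exact isSquare_one_add_eight_mul _

theorem exists_hom_of_two_two {c : ℤ_[2]} (hw : IsIntegralGenerator (2 + 4 * c) 2 w) :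
    ∃ χ : ℚ_[2]ˣ →* ℂˣ, (∀ x, χ x = quadChar 2 E x) ∧
      ∀ u : ℤ_[2]ˣ, χ (padicUnits 2 u) = 1 ↔ (2 : ℤ_[2]) ^ 2 ∣ u - 1 := by
  obtain ⟨χ, hχ⟩ := hw.exists_hom_of_eisenstein (eisensteinForm_two c) (fun u u' hu hu' => by
    rw [hw.padicUnits_mem_iff_of_two_two] at hu hu' ⊢
    rw [Units.val_mul, map_mul]
    obtain ⟨x, hx⟩ := exists_toZModPow_unit_two 2 u
    obtain ⟨y, hy⟩ := exists_toZModPow_unit_two 2 u'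
    rw [hx] at hu
    rw [hy] at hu'
    rw [hx, hy]
    have key : ∀ x y : ZMod (2 ^ 2), ¬ (1 + 2 * x = 1) → ¬ (1 + 2 * y = 1) →
        (1 + 2 * x) * (1 + 2 * y) = 1 := by
      decide
    exact key _ _ hu hu')
  refine ⟨χ, hχ, fun u => ?_⟩
  rw [eq_one_iff_mem_normGroup hχ, hw.padicUnits_mem_iff_of_two_two,
    ← map_one (PadicInt.toZModPow 2), toZModPow_eq_iff]
  norm_cast

end Two

end IsIntegralGenerator

end UnitNorms

/-! ### Reduction to characters of the unit group of a quadratic algebra -/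

section Reduction

variable {p : ℕ} [Fact p.Prime]

/-- The inclusion of `ℤ_p^×` into the unit group of a quadratic algebra. -/
def scalarUnits (a b : ℤ_[p]) : ℤ_[p]ˣ →* (QuadraticAlgebra ℤ_[p] a b)ˣ :=
  Units.map (algebraMap ℤ_[p] (QuadraticAlgebra ℤ_[p] a b) :
    ℤ_[p] →* QuadraticAlgebra ℤ_[p] a b)

theorem coe_scalarUnits {a b : ℤ_[p]} (u : ℤ_[p]ˣ) :
    (scalarUnits a b u : QuadraticAlgebra ℤ_[p] a b) = .C (u : ℤ_[p]) := rfl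

/-- The characters of the unit group of a quadratic algebra with restriction `ε` to `ℤ_p^×`
and of conductor `n` with respect to a filtration. -/
def typeSet {a b : ℤ_[p]} (ε : ℤ_[p]ˣ →* ℂˣ) (F : ℕ → Set (QuadraticAlgebra ℤ_[p] a b)ˣ) (n : ℕ) :
    Set ((QuadraticAlgebra ℤ_[p] a b)ˣ →* ℂˣ) :=
  {ψ | (∀ u, ψ (scalarUnits a b u) = ε u) ∧ IsLeast {m | ∀ x ∈ F m, ψ x = 1} n}

variable {E : Type*} [Field E] [Algebra ℚ_[p] E] [Algebra ℤ_[p] E]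
  [IsScalarTower ℤ_[p] ℚ_[p] E] [Algebra.IsQuadraticExtension ℚ_[p] E]

instance isFractionRing_ringOfInt : IsFractionRing (RingOfInt p E) E :=
  integralClosure.isFractionRing_of_finite_extension ℚ_[p] E

/-- A nonzero element of `E` is a power of a uniformizer times a unit. -/
theorem exists_eq_zpow_mul {ϖ : RingOfInt p E} (h0 : ϖ ≠ 0)
    (hϖ : maximalIdeal (RingOfInt p E) = Ideal.span {ϖ}) {x : E} (hx : x ≠ 0) :
    ∃ (k : ℤ) (u : (RingOfInt p E)ˣ), x = (ϖ : E) ^ k * (u : RingOfInt p E) := by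
  have hnf : ¬ IsField (RingOfInt p E) := by
    rw [IsLocalRing.isField_iff_maximalIdeal_eq, hϖ, Ideal.span_singleton_eq_bot]
    exact h0
  have hdd : IsDedekindDomain (RingOfInt p E) := inferInstance
  have hdvr : IsDiscreteValuationRing (RingOfInt p E) :=
    ((IsDiscreteValuationRing.TFAE (RingOfInt p E) hnf).out 0 2).2 hdd
  have hirr : Irreducible ϖ := (IsDiscreteValuationRing.irreducible_iff_uniformizer ϖ).2 hϖ
  obtain ⟨y, z, hz, rfl⟩ := IsFractionRing.div_surjective (A := RingOfInt p E) x
  have hz0 : z ≠ 0 := nonZeroDivisors.ne_zero hz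
  have hy0 : y ≠ 0 := by
    rintro rfl
    simp at hx
  obtain ⟨n, u, rfl⟩ := IsDiscreteValuationRing.eq_unit_mul_pow_irreducible hy0 hirr
  obtain ⟨m, v, rfl⟩ := IsDiscreteValuationRing.eq_unit_mul_pow_irreducible hz0 hirr
  have hϖE : (ϖ : E) ≠ 0 := by simpa using h0
  refine ⟨n - m, u * v⁻¹, ?_⟩
  have hv : ((v : RingOfInt p E) : E) * ((v⁻¹ : (RingOfInt p E)ˣ) : RingOfInt p E) = 1 :=
    congrArg Subtype.val v.mul_inv
  have hv0 : ((v : RingOfInt p E) : E) ≠ 0 := left_ne_zero_of_mul_eq_one hv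
  change (((u : RingOfInt p E) : E) * ϖ ^ n) / (((v : RingOfInt p E) : E) * ϖ ^ m) =
    (ϖ : E) ^ ((n : ℤ) - m) * (((u : RingOfInt p E) : E) * ((v⁻¹ : (RingOfInt p E)ˣ) : RingOfInt p E))
  rw [zpow_sub₀ hϖE, zpow_natCast, zpow_natCast]
  field_simp
  linear_combination -hv

omit [Algebra ℚ_[p] E] [IsScalarTower ℤ_[p] ℚ_[p] E] [Algebra.IsQuadraticExtension ℚ_[p] E] in
theorem isUnit_of_coe_zpow_eq {ϖ : RingOfInt p E} {k : ℤ} (hk : k ≠ 0) {u : (RingOfInt p E)ˣ}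
    (h : (ϖ : E) ^ k = (u : RingOfInt p E)) : IsUnit ϖ := by
  have key : ∀ (n : ℕ) (v : (RingOfInt p E)ˣ), n ≠ 0 → (ϖ : E) ^ n = (v : RingOfInt p E) →
      IsUnit ϖ := by
    intro n v hn hv
    have : ϖ ^ n = v := Subtype.ext hv
    exact (isUnit_pow_iff hn).1 (this ▸ v.isUnit)
  rcases Int.eq_nat_or_neg k with ⟨n, rfl | rfl⟩
  · exact key n u (by simpa using hk) (by simpa using h)
  · refine key n u⁻¹ (by simpa using hk) ?_
    rw [zpow_neg, zpow_natCast] at h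
    have hu : ((u : RingOfInt p E) : E) * ((u⁻¹ : (RingOfInt p E)ˣ) : RingOfInt p E) = 1 :=
      congrArg Subtype.val u.mul_inv
    rw [← inv_inv ((ϖ : E) ^ n), h]
    exact inv_eq_of_mul_eq_one_right hu

omit [Algebra ℚ_[p] E] [IsScalarTower ℤ_[p] ℚ_[p] E] [Algebra.IsQuadraticExtension ℚ_[p] E] in
theorem unitsIncl_injective : Function.Injective (unitsIncl p E) := by
  intro u v h
  apply Units.ext
  apply Subtype.ext
  exact congrArg Units.val h

omit [Algebra ℚ_[p] E] [IsScalarTower ℤ_[p] ℚ_[p] E] [Algebra.IsQuadraticExtension ℚ_[p] E] in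
theorem coe_unitsIncl (u : (RingOfInt p E)ˣ) :
    (unitsIncl p E u : E) = ((u : RingOfInt p E) : E) := rfl

/-- A character of the unit group extends to a character of `E^×` with prescribed compatible
restriction to `ℚ_p^×`. -/
theorem exists_character_extension {ϖ : RingOfInt p E} (h0 : ϖ ≠ 0)
    (hϖ : maximalIdeal (RingOfInt p E) = Ideal.span {ϖ})
    (hp : (algebraMap ℤ_[p] (RingOfInt p E) p) ∈ maximalIdeal (RingOfInt p E))
    (χ : ℚ_[p]ˣ →* ℂˣ) (ψ : (RingOfInt p E)ˣ →* ℂˣ)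
    (hψ : ∀ u : ℤ_[p]ˣ, ψ (Units.map (algebraMap ℤ_[p] (RingOfInt p E) :
      ℤ_[p] →* RingOfInt p E) u) = χ (padicUnits p u)) :
    ∃ θ : Eˣ →* ℂˣ, (∀ u, θ (unitsIncl p E u) = ψ u) ∧ ∀ x, θ (baseIncl p E x) = χ x := by
  have hϖE : (ϖ : E) ≠ 0 := by simpa using h0
  have hϖu : ¬ IsUnit ϖ := by
    have : ϖ ∈ maximalIdeal (RingOfInt p E) := by rw [hϖ]; exact Ideal.mem_span_singleton_self _
    exact (mem_nonunits_iff).1 ((mem_maximalIdeal ϖ).1 this)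
  have hp0 : (p : ℚ_[p]) ≠ 0 := by exact_mod_cast (Fact.out : p.Prime).ne_zero
  let s : Eˣ := Units.mk0 (ϖ : E) hϖE
  let q : ℚ_[p]ˣ := Units.mk0 (p : ℚ_[p]) hp0
  let ι := MonoidHom.ofInjective (unitsIncl_injective (p := p) (E := E))
  -- the decomposition of `p`
  obtain ⟨e, v, hev⟩ := exists_eq_zpow_mul h0 hϖ (baseIncl p E q).ne_zero
  have hq : baseIncl p E q = s ^ e * unitsIncl p E v := by
    apply Units.ext
    rw [hev]
    simp [s, coe_unitsIncl]
  have he0 : e ≠ 0 := by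
    rintro rfl
    refine (mem_nonunits_iff).1 ((mem_maximalIdeal _).1 hp) ?_
    have : algebraMap ℤ_[p] (RingOfInt p E) p = v := by
      apply Subtype.ext
      rw [zpow_zero, one_mul] at hev
      rw [← hev]
      change algebraMap ℤ_[p] E p = algebraMap ℚ_[p] E p
      rw [map_natCast, map_natCast]
    exact this ▸ v.isUnit
  -- Since `p = ϖ ^ e v`, compatibility at `p` only prescribes the `e`-th power of the value `c` at
  -- `ϖ`, and `ℂ` contains the required roots.
  obtain ⟨c, hc⟩ : ∃ c : ℂˣ, c ^ e = χ q * (ψ v)⁻¹ := by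
    obtain ⟨z, hz⟩ := IsAlgClosed.exists_pow_nat_eq ((χ q * (ψ v)⁻¹ : ℂˣ) : ℂ)
      (Int.natAbs_pos.2 he0)
    have hz0 : z ≠ 0 := by
      rintro rfl
      rw [zero_pow (Int.natAbs_pos.2 he0).ne'] at hz
      exact Units.ne_zero _ hz.symm
    have h1 : Units.mk0 z hz0 ^ e.natAbs = χ q * (ψ v)⁻¹ := Units.ext (by simpa using hz)
    rcases Int.natAbs_eq e with h | h
    · exact ⟨Units.mk0 z hz0, by rw [h, zpow_natCast, h1]⟩
    · exact ⟨(Units.mk0 z hz0)⁻¹, by rw [h, zpow_neg, inv_zpow, inv_inv, zpow_natCast, h1]⟩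
  -- With `N = 0`, because `ϖ` has infinite order modulo the units: its value imposes no condition
  -- on `ψ`.
  obtain ⟨θ, hθ, hθs⟩ := exists_extension_one (unitsIncl p E).range
    (ψ.comp ι.symm.toMonoidHom) s 0 (by
      intro k
      rw [Nat.cast_zero, zero_dvd_iff]
      constructor
      · rintro ⟨u, hu⟩
        by_contra hk
        refine hϖu (isUnit_of_coe_zpow_eq (u := u) hk ?_)
        have := congrArg Units.val hu
        rw [coe_unitsIncl] at this
        rw [this]
        simp [s]
      · rintro rfl
        rw [zpow_zero]
        exact Subgroup.one_mem _) (by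
      intro x
      obtain ⟨k, u, hk⟩ := exists_eq_zpow_mul h0 hϖ x.ne_zero
      refine ⟨k, _, ⟨u, rfl⟩, Units.ext ?_⟩
      rw [hk, Units.val_mul, coe_unitsIncl, mul_comm]
      simp [s]) c (by
      intro h hh
      have : h = 1 := Subtype.ext (by simpa using hh)
      rw [this, map_one, pow_zero])
  have hθu : ∀ u, θ (unitsIncl p E u) = ψ u := by
    intro u
    have h1 := hθ (ι u)
    have h2 : ((ι u : (unitsIncl p E).range) : Eˣ) = unitsIncl p E u := rfl
    rw [h2] at h1
    rw [h1]
    simp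
  have hθp : θ (baseIncl p E q) = χ q := by
    rw [hq, map_mul, map_zpow, hθs, hc, hθu]
    simp
  refine ⟨θ, hθu, fun x => ?_⟩
  obtain ⟨k, u, hk⟩ := exists_eq_zpow_mul_unit (ν := (p : ℤ_[p])) (v := 1) (by simp) x.ne_zero
  have hx : x = q ^ k * padicUnits p u := by
    apply Units.ext
    rw [hk]
    simp [q, coe_padicUnits]
  have hb : baseIncl p E (padicUnits p u) = unitsIncl p E (Units.map (algebraMap ℤ_[p]
      (RingOfInt p E) : ℤ_[p] →* RingOfInt p E) u) := by
    apply Units.ext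
    exact (algebraMap_padicInt_apply (E := E) (u : ℤ_[p])).symm
  rw [hx, map_mul, map_mul, map_zpow, map_zpow, hθp, hb, hθu, hψ, map_mul, map_zpow]

namespace IsIntegralGenerator

variable {a b : ℤ_[p]} {w : E} (hw : IsIntegralGenerator a b w)
include hw

/-- Orbits of inertial types are counted by the characters of the unit group of `ℤ_p[w]`. -/
theorem orbitCount_eq_of_hasOrbitCount {t : QuadraticAlgebra ℤ_[p] a b} (ht0 : t ≠ 0)
    (ht : maximalIdeal (RingOfInt p E) = Ideal.span {hw.integersEquiv t})
    {χ : ℚ_[p]ˣ →* ℂˣ} (hχ : ∀ x, χ x = quadChar p E x)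
    {F : ℕ → Set (QuadraticAlgebra ℤ_[p] a b)ˣ}
    (hF : ∀ m u, u ∈ F m ↔ hw.unitsEquiv u ∈ unitFiltration p E m) (n : ℕ) {N : ℕ∞}
    (h : HasOrbitCount (typeSet (χ.comp (padicUnits p)) F n) N) : orbitCount p E n = N := by
  obtain ⟨f, hf, hN⟩ := h
  let r : (Eˣ →* ℂˣ) → ((QuadraticAlgebra ℤ_[p] a b)ˣ →* ℂˣ) := fun θ =>
    (θ.comp (unitsIncl p E)).comp hw.unitsEquiv.toMonoidHom
  have hr : ∀ θ u, r θ u = θ (unitsIncl p E (hw.unitsEquiv u)) := fun _ _ => rfl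
  have hscalar : ∀ u : ℤ_[p]ˣ, unitsIncl p E (hw.unitsEquiv (scalarUnits a b u)) =
      baseIncl p E (padicUnits p u) := by
    intro u
    apply Units.ext
    change ((hw.integersEquiv (.C (u : ℤ_[p])) : RingOfInt p E) : E) = algebraMap ℚ_[p] E _
    rw [hw.integersEquiv_C]
    exact algebraMap_padicInt_apply (E := E) (u : ℤ_[p])
  have hcond : ∀ θ : Eˣ →* ℂˣ, HasConductor p E θ n ↔ IsLeast {m | ∀ x ∈ F m, r θ x = 1} n := by
    intro θ
    have : {m : ℕ | ∀ u ∈ unitFiltration p E m, θ (unitsIncl p E u) = 1} =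
        {m | ∀ x ∈ F m, r θ x = 1} := by
      ext m
      constructor
      · intro h x hx
        exact h _ ((hF m x).1 hx)
      · intro h u hu
        obtain ⟨x, rfl⟩ := hw.unitsEquiv.surjective u
        exact h x ((hF m x).2 hu)
    rw [HasConductor, this]
  have hmem : ∀ θ : PrimChar p E n, r θ.1 ∈ typeSet (χ.comp (padicUnits p)) F n := by
    intro θ
    refine ⟨fun u => ?_, (hcond _).1 θ.2.2⟩
    rw [hr, hscalar, θ.2.1, MonoidHom.comp_apply, hχ]
  have hp : algebraMap ℤ_[p] (RingOfInt p E) p ∈ maximalIdeal (RingOfInt p E) := by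
    rw [← hw.integersEquiv_C, hw.mem_maximalIdeal_iff, isUnit_quadratic_iff, not_not]
    simp
  have hconj : ∀ θ₁ θ₂ : PrimChar p E n, (orbitSetoid p E n).r θ₁ θ₂ ↔ f (r θ₁.1) = f (r θ₂.1) := by
    intro θ₁ θ₂
    rw [hf _ (hmem θ₁) _ (hmem θ₂)]
    constructor
    · rintro ⟨σ, h⟩
      exact ⟨σ, fun u => h _⟩
    · rintro ⟨σ, h⟩
      refine ⟨σ, fun u => ?_⟩
      obtain ⟨x, rfl⟩ := hw.unitsEquiv.surjective u
      exact h x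
  rw [← hN, Set.encard]
  -- The invariant `f` of the restriction separates orbits by `hconj`; every value is attained
  -- because each character of the unit group in `typeSet` extends to `E^×`.
  refine ENat.card_congr (Equiv.ofBijective
    (Quotient.lift (fun θ : PrimChar p E n =>
      (⟨f (r θ.1), _, hmem θ, rfl⟩ : f '' typeSet (χ.comp (padicUnits p)) F n))
      fun θ₁ θ₂ h => Subtype.ext ((hconj θ₁ θ₂).1 h)) ⟨?_, ?_⟩)
  · rintro ⟨θ₁⟩ ⟨θ₂⟩ h
    exact Quotient.sound ((hconj θ₁ θ₂).2 (congrArg Subtype.val h))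
  · rintro ⟨_, ψ, hψ, rfl⟩
    obtain ⟨θ, h1, h2⟩ := exists_character_extension (ϖ := hw.integersEquiv t)
      (by simpa using ht0) ht hp χ (ψ.comp hw.unitsEquiv.symm.toMonoidHom) (by
        intro u
        have : hw.unitsEquiv.symm (Units.map (algebraMap ℤ_[p] (RingOfInt p E) :
            ℤ_[p] →* RingOfInt p E) u) = scalarUnits a b u := by
          rw [MulEquiv.symm_apply_eq]
          apply Units.ext
          exact (hw.integersEquiv_C (u : ℤ_[p])).symm
        rw [MonoidHom.comp_apply]
        change ψ (hw.unitsEquiv.symm _) = _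
        rw [this, hψ.1]
        rfl)
    have hrθ : r θ = ψ := by
      ext u
      rw [hr, h1]
      simp
    exact ⟨Quotient.mk _ ⟨θ, fun x => by rw [h2, hχ], (hcond θ).2 (hrθ ▸ hψ.2)⟩,
      Subtype.ext (congrArg f hrθ)⟩

end IsIntegralGenerator

end Reduction

/-! ### Conductors and the filtration by orders -/

section Conductor

variable {p : ℕ} [Fact p.Prime] {a b : ℤ_[p]}

/-- Dividing by the real part normalises a unit to `1 + s ω` modulo `ℤ_p^×`. This converts
conditions on `U^m` into conditions on orders. -/
theorem exists_eq_scalarUnits_mul {x : (QuadraticAlgebra ℤ_[p] a b)ˣ} (hx : IsUnit x.1.re) :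
    ∃ y : (QuadraticAlgebra ℤ_[p] a b)ˣ, x = scalarUnits a b hx.unit * y ∧ y.1.re = 1 ∧
      ∀ z, z ∣ x.1.im → z ∣ y.1.im := by
  have hv : ((scalarUnits a b hx.unit)⁻¹).1 = .C ((hx.unit⁻¹ : ℤ_[p]ˣ) : ℤ_[p]) := by
    rw [← map_inv, coe_scalarUnits]
  refine ⟨(scalarUnits a b hx.unit)⁻¹ * x, by simp, ?_, fun z hz => ?_⟩
  · rw [Units.val_mul, hv, QuadraticAlgebra.re_mul]
    simp
  · rw [Units.val_mul, hv, QuadraticAlgebra.im_mul]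
    simpa using hz

theorem mem_typeSet_iff {ε : ℤ_[p]ˣ →* ℂˣ} {F : ℕ → Set (QuadraticAlgebra ℤ_[p] a b)ˣ} {n : ℕ}
    {T : (m : ℕ) → Set ((QuadraticAlgebra ℤ_[p] a b)ˣ →* ℂˣ)}
    (hT : ∀ ψ : (QuadraticAlgebra ℤ_[p] a b)ˣ →* ℂˣ, (∀ u, ψ (scalarUnits a b u) = ε u) →
      ∀ m, (∀ x ∈ F m, ψ x = 1) ↔ ψ ∈ T m)
    (hT' : ∀ m, ∀ ψ ∈ T m, ∀ u, ψ (scalarUnits a b u) = ε u)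
    (ψ : (QuadraticAlgebra ℤ_[p] a b)ˣ →* ℂˣ) :
    ψ ∈ typeSet ε F n ↔ ψ ∈ T n ∧ ∀ m < n, ψ ∉ T m := by
  constructor
  · rintro ⟨h1, h2, h3⟩
    refine ⟨(hT ψ h1 n).1 h2, fun m hm h4 => ?_⟩
    have := h3 ((hT ψ h1 m).2 h4)
    omega
  · rintro ⟨h1, h2⟩
    have hs := hT' n ψ h1
    refine ⟨hs, (hT ψ hs n).2 h1, fun m hm => ?_⟩
    by_contra hlt
    exact h2 m (by omega) ((hT ψ hs m).1 hm)

theorem scalarUnits_mem_orderUnits {k : ℕ} {u : ℤ_[p]ˣ} :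
    scalarUnits a b u ∈ orderUnits a b k := by
  rw [mem_orderUnits, coe_scalarUnits]
  simp

/-! #### The unramified case -/

theorem signFiltration_one :
    SignFiltration (orderUnits a b) (fun _ => 1) 0 where
  anti := orderUnits_antitone
  mul _ _ _ _ := (one_mul _).symm
  sign _ := Or.inl rfl

/-- `ψ` is trivial on `ℤ_p^×`, and the product of `ℤ_p^×` and `U^m` is the unit group of `ℤ_p + p^m
O` for `m ≥ 1`. At `m = 0` the real part need not be a unit, but both groups are everything. -/
theorem trivial_iff_mem_agreeing_of_unramified {F : ℕ → Set (QuadraticAlgebra ℤ_[p] a b)ˣ}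
    (hF : ∀ m u, u ∈ F m ↔ (p : ℤ_[p]) ^ m ∣ u.1.re - 1 ∧ (p : ℤ_[p]) ^ m ∣ u.1.im)
    {ψ : (QuadraticAlgebra ℤ_[p] a b)ˣ →* ℂˣ} (hψ : ∀ u, ψ (scalarUnits a b u) = 1) (m : ℕ) :
    (∀ x ∈ F m, ψ x = 1) ↔ ψ ∈ agreeing (orderUnits a b) (fun _ => 1) m := by
  refine ⟨fun h x hx => ?_, fun h x hx => h x ((hF m x).1 hx).2⟩
  rcases Nat.eq_zero_or_pos m with rfl | hm
  · exact h x ((hF 0 x).2 (by simp))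
  · have hu : IsUnit x.1.re := (not_dvd_iff_isUnit _).1
      (Tame.not_dvd_re (j := m) (Or.inl hm) hx)
    obtain ⟨y, hy, h1, h2⟩ := exists_eq_scalarUnits_mul hu
    rw [hy, map_mul, hψ, one_mul]
    exact h y ((hF m y).2 ⟨by simp [h1], h2 _ hx⟩)

section Unramified

variable {F : ℕ → Set (QuadraticAlgebra ℤ_[p] a b)ˣ}
  (hF : ∀ m u, u ∈ F m ↔ (p : ℤ_[p]) ^ m ∣ u.1.re - 1 ∧ (p : ℤ_[p]) ^ m ∣ u.1.im)
  {ε : ℤ_[p]ˣ →* ℂˣ} (hε : ∀ u, ε u = 1)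
include hF hε

theorem mem_typeSet_of_unramified (n : ℕ) (ψ : (QuadraticAlgebra ℤ_[p] a b)ˣ →* ℂˣ) :
    ψ ∈ typeSet ε F n ↔ ψ ∈ agreeing (orderUnits a b) (fun _ => 1) n ∧
      ∀ m < n, ψ ∉ agreeing (orderUnits a b) (fun _ => 1) m := by
  refine mem_typeSet_iff (fun ψ hψ m => trivial_iff_mem_agreeing_of_unramified hF
    (fun u => (hψ u).trans (hε u)) m) (fun m ψ hψ u => ?_) ψ
  rw [hε, hψ _ scalarUnits_mem_orderUnits]

theorem typeSet_zero_of_unramified :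
    typeSet ε F 0 = agreeing (orderUnits a b) (fun _ => 1) 0 := by
  ext ψ
  simp [mem_typeSet_of_unramified hF hε]

theorem typeSet_succ_of_unramified (n : ℕ) :
    typeSet ε F (n + 1) = agreeing (orderUnits a b) (fun _ => 1) (n + 1) \
      agreeing (orderUnits a b) (fun _ => 1) n := by
  ext ψ
  rw [mem_typeSet_of_unramified hF hε]
  exact and_congr_right fun _ => ⟨fun h => h n (by omega), fun h m hm hψ =>
    h (signFiltration_one.agreeing_anti (by omega) hψ)⟩

end Unramified

/-! #### The ramified case -/

open Classical in
/-- The value of a character of `ℤ_p^×` at the first coordinate. -/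
def reChar (ε : ℤ_[p]ˣ →* ℂˣ) (x : (QuadraticAlgebra ℤ_[p] a b)ˣ) : ℂˣ :=
  -- The default value `1` plays no role in the ramified case, where the real part of a unit is a
  -- unit (`isUnit_re`).
  if h : IsUnit x.1.re then ε h.unit else 1

theorem reChar_eq {ε : ℤ_[p]ˣ →* ℂˣ} {x : (QuadraticAlgebra ℤ_[p] a b)ˣ} {u : ℤ_[p]ˣ}
    (h : x.1.re = u) : reChar ε x = ε u := by
  have hu : IsUnit x.1.re := h ▸ u.isUnit
  rw [reChar, dif_pos hu]
  congr 1
  exact Units.ext h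

/-- A quadratic character of `ℤ_p^×` of conductor `c + 1`. -/
structure IsQuadraticOfConductor (ε : ℤ_[p]ˣ →* ℂˣ) (c : ℕ) : Prop where
  sign : ∀ u, ε u = 1 ∨ ε u = -1
  trivial : ∀ u : ℤ_[p]ˣ, (p : ℤ_[p]) ^ (c + 1) ∣ (u : ℤ_[p]) - 1 → ε u = 1
  nontrivial : ∃ u : ℤ_[p]ˣ, (p : ℤ_[p]) ^ c ∣ (u : ℤ_[p]) - 1 ∧ ε u ≠ 1

theorem isUnit_re (ha : (p : ℤ_[p]) ∣ a) (hb : (p : ℤ_[p]) ∣ b)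
    (x : (QuadraticAlgebra ℤ_[p] a b)ˣ) : IsUnit x.1.re :=
  (not_dvd_iff_isUnit _).1 (Tame.not_dvd_re (j := 0) (Or.inr ⟨ha, hb⟩) (mem_orderUnits_zero x))

section Ramified

variable {ε : ℤ_[p]ˣ →* ℂˣ} {c : ℕ} (hε : IsQuadraticOfConductor ε c)
include hε

theorem IsQuadraticOfConductor.eq_of_dvd_sub {u v : ℤ_[p]ˣ}
    (h : (p : ℤ_[p]) ^ (c + 1) ∣ (u : ℤ_[p]) - v) : ε u = ε v := by
  have : ε (u * v⁻¹) = 1 := by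
    refine hε.trivial _ ?_
    have e : ((u * v⁻¹ : ℤ_[p]ˣ) : ℤ_[p]) - 1 = (u - v) * (v⁻¹ : ℤ_[p]ˣ) := by
      rw [sub_mul, Units.mul_inv, Units.val_mul]
    rw [e]
    exact dvd_mul_of_dvd_left h _
  rwa [map_mul, map_inv, mul_inv_eq_one] at this

variable (ha : (p : ℤ_[p]) ∣ a) (hb : (p : ℤ_[p]) ∣ b)

include ha hb in
-- The real part of `x y` differs from the product of the real parts by `a im x im y`. At level `c`
-- this is divisible by `p ^ (c + 1)`, because `p ∣ a`.
theorem signFiltration_reChar : SignFiltration (orderUnits a b) (reChar ε) c where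
  anti := orderUnits_antitone
  sign x := by
    rw [reChar_eq (u := (isUnit_re ha hb x).unit) rfl]
    exact hε.sign _
  mul x hx y hy := by
    rw [reChar_eq (u := (isUnit_re ha hb x).unit) rfl, reChar_eq (u := (isUnit_re ha hb y).unit) rfl,
      reChar_eq (u := (isUnit_re ha hb (x * y)).unit) rfl, ← map_mul]
    refine hε.eq_of_dvd_sub ?_
    change _ ∣ x.1.re * y.1.re + a * x.1.im * y.1.im - x.1.re * y.1.re
    rw [add_sub_cancel_left, pow_succ', mul_assoc]
    exact mul_dvd_mul ha (dvd_mul_of_dvd_left hx _)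

variable {F : ℕ → Set (QuadraticAlgebra ℤ_[p] a b)ˣ}
  (hF : ∀ m u, u ∈ F m ↔
    (p : ℤ_[p]) ^ ((m + 1) / 2) ∣ u.1.re - 1 ∧ (p : ℤ_[p]) ^ (m / 2) ∣ u.1.im)

include ha hb hF in
-- `U^m` meets `ℤ_p^×` in the units congruent to `1` modulo `p ^ ⌈m/2⌉`, and `ε` is trivial there
-- iff `⌈m/2⌉ ≥ c + 1`, that is `m ≥ 2c + 1`. Granting this, splitting off the real part reduces
-- triviality on `U^m` to agreement with `ε ∘ re` at level `⌊m/2⌋`.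
theorem trivial_iff_mem_agreeing_of_ramified {ψ : (QuadraticAlgebra ℤ_[p] a b)ˣ →* ℂˣ}
    (hψ : ∀ u, ψ (scalarUnits a b u) = ε u) (m : ℕ) :
    (∀ x ∈ F m, ψ x = 1) ↔
      ψ ∈ {ψ | 2 * c + 1 ≤ m ∧ ψ ∈ agreeing (orderUnits a b) (reChar ε) (m / 2)} := by
  constructor
  · intro h
    refine ⟨?_, fun x hx => ?_⟩
    · obtain ⟨u, hu, hu1⟩ := hε.nontrivial
      by_contra hlt
      refine hu1 ((hψ u).symm.trans (h _ ((hF _ _).2 ⟨?_, scalarUnits_mem_orderUnits⟩)))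
      rw [coe_scalarUnits]
      exact (pow_dvd_pow _ (by omega)).trans hu
    · obtain ⟨y, hy, h1, h2⟩ := exists_eq_scalarUnits_mul (isUnit_re ha hb x)
      rw [reChar_eq (u := (isUnit_re ha hb x).unit) rfl]
      conv_lhs => rw [hy]
      rw [map_mul, hψ, h y ((hF m y).2 ⟨by simp [h1], h2 _ hx⟩), mul_one]
  · rintro ⟨hm, h⟩ x hx
    obtain ⟨h1, h2⟩ := (hF m x).1 hx
    rw [h x h2, reChar_eq (u := (isUnit_re ha hb x).unit) rfl]
    exact hε.trivial _ ((pow_dvd_pow _ (by omega)).trans h1)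

include ha hb hF in
theorem mem_typeSet_of_ramified (n : ℕ) (ψ : (QuadraticAlgebra ℤ_[p] a b)ˣ →* ℂˣ) :
    ψ ∈ typeSet ε F n ↔
      (2 * c + 1 ≤ n ∧ ψ ∈ agreeing (orderUnits a b) (reChar ε) (n / 2)) ∧
      ∀ m < n, ¬ (2 * c + 1 ≤ m ∧ ψ ∈ agreeing (orderUnits a b) (reChar ε) (m / 2)) := by
  refine mem_typeSet_iff (fun ψ hψ m => trivial_iff_mem_agreeing_of_ramified hε ha hb hF hψ m)
    (fun m ψ hψ u => ?_) ψ
  rw [hψ.2 _ scalarUnits_mem_orderUnits]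
  exact reChar_eq rfl

include ha hb hF in
-- `2 * c + 1` is the least possible conductor, so there is no lower level to exclude.
theorem typeSet_two_mul_add_one_eq_agreeing :
    typeSet ε F (2 * c + 1) = agreeing (orderUnits a b) (reChar ε) c := by
  ext ψ
  rw [mem_typeSet_of_ramified hε ha hb hF, show (2 * c + 1) / 2 = c by omega]
  exact ⟨fun h => h.1.2, fun h => ⟨⟨le_rfl, h⟩, fun m hm h' => by omega⟩⟩

include ha hb hF in
theorem typeSet_even_eq_agreeing_diff {k : ℕ} (hk : c ≤ k) :
    typeSet ε F (2 * (k + 1)) = agreeing (orderUnits a b) (reChar ε) (k + 1) \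
      agreeing (orderUnits a b) (reChar ε) k := by
  ext ψ
  rw [mem_typeSet_of_ramified hε ha hb hF, show 2 * (k + 1) / 2 = k + 1 by omega]
  constructor
  · rintro ⟨⟨-, h1⟩, h2⟩
    refine ⟨h1, fun h3 => h2 (2 * k + 1) (by omega) ⟨by omega, ?_⟩⟩
    rwa [show (2 * k + 1) / 2 = k by omega]
  · rintro ⟨h1, h2⟩
    exact ⟨⟨by omega, h1⟩, fun m hm h3 => h2
      ((signFiltration_reChar hε ha hb).agreeing_anti (by omega) h3.2)⟩

include ha hb hF in
-- The conditions at `2 k` and `2 k + 1` are the same, since both halve to level `k` and both exceed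
-- `2 c`.
theorem typeSet_odd_eq_empty {k : ℕ} (hk : c < k) : typeSet ε F (2 * k + 1) = ∅ := by
  refine Set.eq_empty_of_forall_notMem fun ψ h => ?_
  rw [mem_typeSet_of_ramified hε ha hb hF, show (2 * k + 1) / 2 = k by omega] at h
  refine h.2 (2 * k) (by omega) ⟨by omega, ?_⟩
  rw [show 2 * k / 2 = k by omega]
  exact h.1.2

end Ramified

end Conductor

/-! ### Generators -/

section Generators

variable {G : Type*} [CommGroup G] {R : ℕ → Subgroup G} {p j m M : ℕ} {g s : G}

namespace PowFiltration

variable (h : PowFiltration R p j)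
  (hgs : ∀ i l : ℤ, g ^ i * s ^ l ∈ R j ↔ (m : ℤ) ∣ i ∧ (M : ℤ) ∣ l) (hg : g ^ m ∉ R (j + 1))
include h hgs hg

/-- Below level `j` the elements `g` and `s` have independent orders `m` and `M`. Then `g ^ m`
generates a cyclic group of order `p ^ n` modulo `R (j + n)`, where `s ^ M` is already trivial. -/
theorem zpow_mul_zpow_mem_iff (hp : p.Prime) (n : ℕ) (hs : s ^ M ∈ R (j + n)) (i l : ℤ) :
    g ^ i * s ^ l ∈ R (j + n) ↔ ((m * p ^ n : ℕ) : ℤ) ∣ i ∧ (M : ℤ) ∣ l := by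
  have hgm : g ^ m ∈ R j := by simpa using (hgs m 0).2 ⟨dvd_rfl, dvd_zero _⟩
  have key : (m : ℤ) ∣ i → (M : ℤ) ∣ l →
      (g ^ i * s ^ l ∈ R (j + n) ↔ ((m * p ^ n : ℕ) : ℤ) ∣ i) := by
    rintro ⟨i, rfl⟩ ⟨l, rfl⟩
    rw [zpow_mul s, zpow_natCast, (R (j + n)).mul_mem_cancel_right (zpow_mem hs _), zpow_mul,
      zpow_natCast, h.zpow_mem_iff hp hgm hg, Nat.cast_mul]
    rcases Nat.eq_zero_or_pos m with rfl | hm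
    · exact absurd (by simp) hg
    · rw [mul_dvd_mul_iff_left (by exact_mod_cast hm.ne')]
  constructor
  · intro hm
    obtain ⟨h1, h2⟩ := (hgs i l).1 (h.anti (by omega) hm)
    exact ⟨(key h1 h2).1 hm, h2⟩
  · rintro ⟨h1, h2⟩
    exact (key ((Int.natCast_dvd_natCast.2 (dvd_mul_right m _)).trans h1) h2).2 h1

theorem exists_eq_mul_zpow_mul_zpow (hx : ∀ x : G, ∃ i l : ℤ, x * (g ^ i * s ^ l) ∈ R j) (n : ℕ)
    (x : G) : ∃ i l : ℤ, ∃ y ∈ R (j + n), x = y * (g ^ i * s ^ l) := by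
  have hgm : g ^ m ∈ R j := by simpa using (hgs m 0).2 ⟨dvd_rfl, dvd_zero _⟩
  obtain ⟨i, l, hl⟩ := hx x
  obtain ⟨k, y, hy, hk⟩ := h.exists_eq_mul_zpow hgm hg n hl
  refine ⟨m * k - i, -l, y, hy, ?_⟩
  rw [← eq_mul_inv_iff_mul_eq] at hk
  rw [hk, mul_assoc, zpow_sub, zpow_mul, zpow_natCast, zpow_neg, mul_inv]
  simp only [mul_assoc]

end PowFiltration

theorem zpow_mem_iff_of_prime {H : Subgroup G} {x : G} {q : ℕ} (hq : q.Prime)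
    (h : x ^ q ∈ H) (h' : x ∉ H) (i : ℤ) : x ^ i ∈ H ↔ (q : ℤ) ∣ i := by
  have := Fact.mk hq
  have key : orderOf (x : G ⧸ H) = q := by
    refine orderOf_eq_prime ?_ ?_
    · rwa [← QuotientGroup.mk_pow, QuotientGroup.eq_one_iff]
    · rwa [Ne, QuotientGroup.eq_one_iff]
  rw [← key, orderOf_dvd_iff_zpow_eq_one, ← QuotientGroup.mk_zpow, QuotientGroup.eq_one_iff]

/-- By multiplicativity the two divisor counts are those of `m` times `n + 2` and times `n + 1`. -/
theorem card_divisors_sdiff {m p : ℕ} (hp : p.Prime) (hm : m.Coprime p) (n : ℕ) :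
    ((m * p ^ (n + 1)).divisors \ (m * p ^ n).divisors).card = m.divisors.card := by
  rcases Nat.eq_zero_or_pos m with rfl | hm0
  · simp
  rw [Finset.card_sdiff_of_subset (Nat.divisors_subset_of_dvd
      (mul_ne_zero hm0.ne' (pow_ne_zero _ hp.ne_zero)) (mul_dvd_mul_left m (pow_dvd_pow p (by omega)))),
    Nat.Coprime.card_divisors_mul (hm.pow_right _), Nat.Coprime.card_divisors_mul (hm.pow_right _),
    Nat.divisors_prime_pow hp, Nat.divisors_prime_pow hp, Finset.card_map, Finset.card_map,
    Finset.card_range, Finset.card_range, ← Nat.mul_sub]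
  simp

end Generators

/-! ### Unramified extensions -/

section UnramifiedGenerators

variable {p : ℕ} [Fact p.Prime] {a b : ℤ_[p]}

/-- Reduction modulo `p`. -/
def reduction (a b : ℤ_[p]) : QuadraticAlgebra ℤ_[p] a b →+*
    QuadraticAlgebra (ZMod p) (PadicInt.toZMod a) (PadicInt.toZMod b) where
  toFun z := ⟨PadicInt.toZMod z.re, PadicInt.toZMod z.im⟩
  map_one' := by ext <;> simp [QuadraticAlgebra.re_one, QuadraticAlgebra.im_one]
  map_zero' := by ext <;> simp
  map_mul' x y := by ext <;> simp
  map_add' x y := by ext <;> simp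

/-- This is the form in which the quadratic algebra over `ZMod p` is recognised as a field. -/
theorem fact_of_unramifiedForm (h : UnramifiedForm a b) :
    Fact (∀ r : ZMod p, r ^ 2 ≠ PadicInt.toZMod a + PadicInt.toZMod b * r) := by
  refine ⟨fun r hr => ?_⟩
  obtain ⟨r, rfl⟩ := ZMod.ringHom_surjective (PadicInt.toZMod (p := p)) r
  refine not_dvd_units (1 : ℤ_[p]ˣ) (h (-r) 1 ?_).2
  rw [← toZMod_eq_zero_iff_dvd]
  simp only [map_sub, map_add, map_mul, map_neg, map_one]
  linear_combination hr

theorem UnramifiedForm.exists_unit_reduction (h : UnramifiedForm a b)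
    (k : (QuadraticAlgebra (ZMod p) (PadicInt.toZMod a) (PadicInt.toZMod b))ˣ) :
    ∃ u, Units.map (reduction a b).toMonoidHom u = k := by
  obtain ⟨r, hr⟩ := ZMod.ringHom_surjective (PadicInt.toZMod (p := p)) k.1.re
  obtain ⟨s, hs⟩ := ZMod.ringHom_surjective (PadicInt.toZMod (p := p)) k.1.im
  have hu : IsUnit (⟨r, s⟩ : QuadraticAlgebra ℤ_[p] a b) := by
    rw [isUnit_quadratic_iff]
    intro hd
    obtain ⟨h1, h2⟩ := h _ _ hd
    rw [← toZMod_eq_zero_iff_dvd] at h1 h2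
    have : k.1 = 0 := by
      ext
      · rw [← hr, h1]; rfl
      · rw [← hs, h2]; rfl
    have : Fact (1 < p) := ⟨(Fact.out : p.Prime).one_lt⟩
    exact k.ne_zero ‹_›
  refine ⟨hu.unit, Units.ext ?_⟩
  ext
  · exact hr
  · exact hs

theorem reduction_mem_range_iff (u : (QuadraticAlgebra ℤ_[p] a b)ˣ) :
    Units.map (reduction a b).toMonoidHom u ∈ (Units.map (algebraMap (ZMod p) (QuadraticAlgebra (ZMod p)
      (PadicInt.toZMod a) (PadicInt.toZMod b))).toMonoidHom).range ↔
      u ∈ orderUnits a b 1 := by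
  rw [mem_orderUnits, pow_one, ← toZMod_eq_zero_iff_dvd]
  constructor
  · rintro ⟨v, hv⟩
    exact (congrArg (fun z => z.1.im) hv).symm
  · intro h0
    have hu : IsUnit u.1.re := by
      rw [← not_dvd_iff_isUnit]
      intro hd
      rw [toZMod_eq_zero_iff_dvd] at h0
      exact not_dvd_norm_units u (dvd_sub (dvd_add (dvd_mul_of_dvd_left hd _)
        (dvd_mul_of_dvd_right h0 _)) (dvd_mul_of_dvd_right h0 _))
    refine ⟨Units.map (PadicInt.toZMod (p := p)).toMonoidHom hu.unit, Units.ext ?_⟩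
    ext
    · rfl
    · exact h0.symm

theorem exists_mem_orderUnits_one :
    ∃ r : (QuadraticAlgebra ℤ_[p] a b)ˣ, r ∈ orderUnits a b 1 ∧ r ∉ orderUnits a b 2 := by
  have hu : IsUnit (⟨1, p⟩ : QuadraticAlgebra ℤ_[p] a b) := by
    rw [isUnit_quadratic_iff]
    intro hd
    refine not_dvd_units (1 : ℤ_[p]ˣ) ((dvd_add_left (c := b * p - a * p * p) ?_).1 ?_)
    · exact dvd_sub (dvd_mul_left _ _) (dvd_mul_left _ _)
    · convert hd using 1
      simp; ring
  refine ⟨hu.unit, ?_, ?_⟩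
  · simp [mem_orderUnits]
  · exact (not_mem_orderUnits_succ (j := 1) (c := 1) (by simp)).2 (not_dvd_units 1)

/-- `O^× / R 1` is the quotient of the unit group of the residue field by that of `ZMod p`, cyclic
of order `p + 1`. A lift of a generator still has to be chosen so that its `(p + 1)`-th power has
exact level `1`. -/
theorem UnramifiedForm.exists_generator (h : UnramifiedForm a b) (hp : p ≠ 2) :
    ∃ g : (QuadraticAlgebra ℤ_[p] a b)ˣ,
      (∀ i : ℤ, g ^ i ∈ orderUnits a b 1 ↔ ((p + 1 : ℕ) : ℤ) ∣ i) ∧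
      (∀ x, ∃ i : ℤ, x * g ^ i ∈ orderUnits a b 1) ∧ g ^ (p + 1) ∉ orderUnits a b 2 := by
  have := fact_of_unramifiedForm h
  let K := QuadraticAlgebra (ZMod p) (PadicInt.toZMod a) (PadicInt.toZMod b)
  have hp1 := (Fact.out : p.Prime).one_lt
  have : Finite K := Finite.of_equiv _ (QuadraticAlgebra.equivProd _ _).symm
  let S : Subgroup Kˣ := (Units.map (algebraMap (ZMod p) K).toMonoidHom).range
  let π : (QuadraticAlgebra ℤ_[p] a b)ˣ →* Kˣ := Units.map (reduction a b).toMonoidHom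
  have hcard : Nat.card (Kˣ ⧸ S) = p + 1 := by
    have h1 := Subgroup.card_eq_card_quotient_mul_card_subgroup S
    have h2 : Nat.card S = p - 1 := by
      have hinj : Function.Injective (Units.map (algebraMap (ZMod p) K).toMonoidHom) :=
        Units.map_injective (algebraMap (ZMod p) K).injective
      rw [← Nat.card_congr (MonoidHom.ofInjective hinj).toEquiv, Nat.card_units, Nat.card_zmod]
    rw [Nat.card_units, h2, Nat.card_congr (QuadraticAlgebra.equivProd _ _), Nat.card_prod,
      Nat.card_zmod] at h1
    obtain ⟨q, rfl⟩ : ∃ q, p = q + 2 := ⟨p - 2, by omega⟩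
    have h3 : (q + 2) * (q + 2) - 1 = (q + 2 + 1) * (q + 2 - 1) := by
      rw [show q + 2 - 1 = q + 1 by omega, Nat.sub_eq_iff_eq_add (by nlinarith)]; ring
    rw [h3] at h1
    exact (Nat.eq_of_mul_eq_mul_right (by omega) h1).symm
  obtain ⟨γ, hγ⟩ := IsCyclic.exists_generator (α := Kˣ ⧸ S)
  have hord : orderOf γ = p + 1 := by rw [orderOf_eq_card_of_forall_mem_zpowers hγ, hcard]
  obtain ⟨k, rfl⟩ := QuotientGroup.mk_surjective γ
  obtain ⟨g₀, rfl⟩ := h.exists_unit_reduction k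
  have hmk : ∀ u, ((π u : Kˣ) : Kˣ ⧸ S) = 1 ↔ u ∈ orderUnits a b 1 := fun u => by
    rw [QuotientGroup.eq_one_iff]
    exact reduction_mem_range_iff u
  have h1 : ∀ g, ((π g : Kˣ) : Kˣ ⧸ S) = π g₀ →
      (∀ i : ℤ, g ^ i ∈ orderUnits a b 1 ↔ ((p + 1 : ℕ) : ℤ) ∣ i) ∧
      (∀ x, ∃ i : ℤ, x * g ^ i ∈ orderUnits a b 1) := by
    intro g hg
    refine ⟨fun i => ?_, fun x => ?_⟩
    · rw [← hmk, map_zpow, QuotientGroup.mk_zpow, hg, ← orderOf_dvd_iff_zpow_eq_one]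
      rw [show orderOf ((π g₀ : Kˣ) : Kˣ ⧸ S) = p + 1 from hord]
    · obtain ⟨i, hi⟩ := Subgroup.mem_zpowers_iff.1 (hγ (π x : Kˣ))
      refine ⟨-i, (hmk _).1 ?_⟩
      rw [map_mul, map_zpow, QuotientGroup.mk_mul, QuotientGroup.mk_zpow, hg, ← hi, zpow_neg]
      exact mul_inv_cancel _
  -- If the power is too deep, `g₀` is multiplied by some `r` of exact level `1`. As `r ^ p` has
  -- level `2`, the new power is `r` modulo `R 2`.
  by_cases hg : g₀ ^ (p + 1) ∈ orderUnits a b 2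
  · obtain ⟨r, hr, hr'⟩ := exists_mem_orderUnits_one (a := a) (b := b)
    obtain ⟨h2, h3⟩ := h1 (g₀ * r) (by rw [map_mul, QuotientGroup.mk_mul, (hmk r).2 hr, mul_one])
    refine ⟨g₀ * r, h2, h3, fun hm => hr' ?_⟩
    have hrp := ((powFiltration_one_of_odd (a := a) (b := b) hp).pow 1 le_rfl r hr hr').1
    rw [mul_pow, (orderUnits a b 2).mul_mem_cancel_left hg, pow_succ,
      (orderUnits a b 2).mul_mem_cancel_left hrp] at hm
    exact hm
  · exact ⟨g₀, (h1 g₀ rfl).1, (h1 g₀ rfl).2, hg⟩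

/-- `O^× / R 2` is the product of a group of order `3`, generated by the cube root of unity `ζ = ω`,
and one of order `2`, generated by `s = 1 + 2 ω`, whose square `-3` is a scalar and so lies in every
level. The factor `1 + 4 ω` in `g` generates the levels from `2` on. -/
theorem powFiltration_two_unramified_generators :
    ∃ g s : (QuadraticAlgebra ℤ_[2] (-1) (-1))ˣ,
      (∀ i l : ℤ, g ^ i * s ^ l ∈ orderUnits (-1 : ℤ_[2]) (-1) 2 ↔
        ((3 : ℕ) : ℤ) ∣ i ∧ ((2 : ℕ) : ℤ) ∣ l) ∧
      (∀ x, ∃ i l : ℤ, x * (g ^ i * s ^ l) ∈ orderUnits (-1 : ℤ_[2]) (-1) 2) ∧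
      g ^ 3 ∉ orderUnits (-1 : ℤ_[2]) (-1) 3 ∧ ∀ n, s ^ 2 ∈ orderUnits (-1 : ℤ_[2]) (-1) n := by
  have h2 : ∀ x : ℤ_[2], (2 : ℤ_[2]) * x ≠ 1 := fun x h =>
    not_dvd_units (p := 2) 1 ⟨x, by simpa using h.symm⟩
  let ζ : (QuadraticAlgebra ℤ_[2] (-1) (-1))ˣ :=
    ⟨⟨0, 1⟩, ⟨-1, -1⟩, by ext <;> simp [QuadraticAlgebra.re_one, QuadraticAlgebra.im_one],
      by ext <;> simp [QuadraticAlgebra.re_one, QuadraticAlgebra.im_one]⟩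
  have hζ : ζ ^ 3 = 1 := by
    apply Units.ext
    ext <;> simp [ζ, pow_succ, QuadraticAlgebra.re_one, QuadraticAlgebra.im_one]
  have hu : ∀ c : ℤ_[2], IsUnit (⟨1, 2 * c⟩ : QuadraticAlgebra ℤ_[2] (-1) (-1)) := by
    intro c
    rw [isUnit_quadratic_iff]
    rintro ⟨d, hd⟩
    refine h2 (d + c - 2 * c * c) ?_
    push_cast at hd
    linear_combination -hd
  let s := (hu 1).unit
  let g₀ := (hu 2).unit
  have hs1 : s.1 = ⟨1, 2 * 1⟩ := rfl
  have hg1 : g₀.1 = ⟨1, 2 * 2⟩ := rfl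
  have hmem : ∀ {k : ℕ} {u : (QuadraticAlgebra ℤ_[2] (-1) (-1))ˣ},
      u ∈ orderUnits (-1 : ℤ_[2]) (-1) k ↔ (2 : ℤ_[2]) ^ k ∣ u.1.im := by
    intro k u
    rw [mem_orderUnits]
    simp
  have hg : g₀ ∈ orderUnits (-1 : ℤ_[2]) (-1) 2 := hmem.2 ⟨1, by rw [hg1]; ring⟩
  have hg' : g₀ ∉ orderUnits (-1 : ℤ_[2]) (-1) (2 + 1) := by
    rw [not_mem_orderUnits_succ (c := 1) (by rw [hg1]; push_cast; ring)]
    exact not_dvd_units 1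
  have hs2 : ∀ n, s ^ 2 ∈ orderUnits (-1 : ℤ_[2]) (-1) n := by
    intro n
    rw [hmem, Units.val_pow_eq_pow_val, pow_two, QuadraticAlgebra.im_mul, hs1]
    norm_num
  have hsR : s ∈ orderUnits (-1 : ℤ_[2]) (-1) 1 := hmem.2 ⟨1, by rw [hs1]; ring⟩
  have hs' : s ∉ orderUnits (-1 : ℤ_[2]) (-1) 2 := by
    rw [not_mem_orderUnits_succ (j := 1) (c := 1) (by rw [hs1]; push_cast; ring)]
    exact not_dvd_units 1
  have hmono : orderUnits (-1 : ℤ_[2]) (-1) 2 ≤ orderUnits (-1 : ℤ_[2]) (-1) 1 :=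
    orderUnits_antitone (by norm_num)
  have hζ1 : ∀ i : ℤ, ζ ^ i ∈ orderUnits (-1 : ℤ_[2]) (-1) 1 ↔ ((3 : ℕ) : ℤ) ∣ i := by
    refine zpow_mem_iff_of_prime Nat.prime_three (by rw [hζ]; exact one_mem _) ?_
    rw [hmem]
    rintro ⟨c, hc⟩
    exact h2 c (by simpa [ζ] using hc.symm)
  have hs0 : ∀ l : ℤ, s ^ l ∈ orderUnits (-1 : ℤ_[2]) (-1) 2 ↔ ((2 : ℕ) : ℤ) ∣ l :=
    zpow_mem_iff_of_prime Nat.prime_two (hs2 2) hs'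
  have hζs : ∀ i l : ℤ, ζ ^ i * s ^ l ∈ orderUnits (-1 : ℤ_[2]) (-1) 2 ↔
      ((3 : ℕ) : ℤ) ∣ i ∧ ((2 : ℕ) : ℤ) ∣ l := by
    intro i l
    have hone : ((3 : ℕ) : ℤ) ∣ i → ζ ^ i = 1 := by
      rintro ⟨i, rfl⟩
      rw [zpow_mul, zpow_natCast, hζ, one_zpow]
    constructor
    · intro hm
      have h3 := (hζ1 i).1 ((Subgroup.mul_mem_cancel_right _ (zpow_mem hsR l)).1 (hmono hm))
      rw [hone h3, one_mul] at hm
      exact ⟨h3, (hs0 l).1 hm⟩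
    · rintro ⟨h3, hl⟩
      rw [hone h3, one_mul]
      exact (hs0 l).2 hl
  refine ⟨ζ * g₀, s, fun i l => ?_, fun x => ?_, ?_, hs2⟩
  · rw [← hζs, mul_zpow, mul_right_comm, Subgroup.mul_mem_cancel_right _ (zpow_mem hg i)]
  · obtain ⟨i, hi⟩ : ∃ i : ℤ, x * ζ ^ i ∈ orderUnits (-1 : ℤ_[2]) (-1) 1 := by
      -- The parities of the coordinates decide which of `1`, `ζ`, `ζ²` makes the imaginary part
      -- even; both even is impossible for a unit.
      obtain ⟨r, hr | hr⟩ := even_or_odd_padicInt_two x.1.re <;>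
      obtain ⟨t, ht | ht⟩ := even_or_odd_padicInt_two x.1.im
      · refine (not_dvd_norm_units x ?_).elim
        rw [hr, ht]
        exact ⟨r * (2 * r) - r * (2 * t) + t * (2 * t), by push_cast; ring⟩
      · refine ⟨(2 : ℕ), hmem.2 ⟨-r, ?_⟩⟩
        rw [zpow_natCast, Units.val_mul, Units.val_pow_eq_pow_val, pow_two]
        simp [ζ, hr]
      · exact ⟨0, hmem.2 ⟨t, by simp [ht]⟩⟩
      · refine ⟨(1 : ℕ), hmem.2 ⟨r - t, ?_⟩⟩
        rw [zpow_natCast, Units.val_mul, Units.val_pow_eq_pow_val, pow_one]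
        simp [ζ, hr, ht]
        ring
    obtain ⟨l, hl⟩ : ∃ l : ℤ, x * ζ ^ i * s ^ l ∈ orderUnits (-1 : ℤ_[2]) (-1) 2 := by
      generalize x * ζ ^ i = y at hi
      obtain ⟨t, ht⟩ := hmem.1 hi
      obtain ⟨t, rfl | rfl⟩ := even_or_odd_padicInt_two t
      · exact ⟨0, hmem.2 ⟨t, by rw [zpow_zero, mul_one, ht]; ring⟩⟩
      · obtain ⟨r, hr | hr⟩ := even_or_odd_padicInt_two y.1.re
        · refine (not_dvd_norm_units y ?_).elim
          rw [hr, ht]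
          exact ⟨r * (2 * r) - r * (2 ^ 1 * (1 + 2 * t)) + (1 + 2 * t) * (2 * (1 + 2 * t)), by
            push_cast; ring⟩
        · refine ⟨1, hmem.2 ⟨r - t, ?_⟩⟩
          rw [zpow_one, Units.val_mul, QuadraticAlgebra.im_mul, hs1, ht, hr]
          ring
    refine ⟨i, l, ?_⟩
    rw [mul_zpow, mul_right_comm, ← mul_assoc, ← mul_assoc,
      Subgroup.mul_mem_cancel_right _ (zpow_mem hg i)]
    exact hl
  · rw [mul_pow, hζ, one_mul, pow_succ]
    have := powFiltration_two_unramified.pow 2 le_rfl g₀ hg hg'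
    rwa [Subgroup.mul_mem_cancel_left _ this.1]

end UnramifiedGenerators

/-! ### Orbit counts for unramified extensions -/

section UnramifiedCounts

variable {p : ℕ} [Fact p.Prime] {a b : ℤ_[p]} {E : Type*} [Field E] [Algebra ℚ_[p] E]
  [Algebra ℤ_[p] E] [IsScalarTower ℤ_[p] ℚ_[p] E] [Algebra.IsQuadraticExtension ℚ_[p] E] {w : E}

namespace IsIntegralGenerator

variable (hw : IsIntegralGenerator a b w)
include hw

theorem orbitCount_of_unramified (h : UnramifiedForm a b)
    (hn : ∀ u : ℤ_[p]ˣ, padicUnits p u ∈ normGroup p E) :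
    (∀ N, HasOrbitCount (agreeing (orderUnits a b) (fun _ => 1) 0) N → orbitCount p E 0 = N) ∧
    ∀ k k' N, k = k' + 1 → HasOrbitCount (agreeing (orderUnits a b) (fun _ => 1) k \
      agreeing (orderUnits a b) (fun _ => 1) k') N → orbitCount p E k = N := by
  obtain ⟨χ, hχ, hχ'⟩ := exists_hom_of_unramified hn
  have hp0 : (p : ℤ_[p]) ≠ 0 := PadicInt.prime_p.ne_zero
  let F : ℕ → Set (QuadraticAlgebra ℤ_[p] a b)ˣ := fun m =>
    {u | (p : ℤ_[p]) ^ m ∣ u.1.re - 1 ∧ (p : ℤ_[p]) ^ m ∣ u.1.im}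
  have hF : ∀ m u, u ∈ F m ↔ (p : ℤ_[p]) ^ m ∣ u.1.re - 1 ∧ (p : ℤ_[p]) ^ m ∣ u.1.im :=
    fun _ _ => Iff.rfl
  have hε : ∀ u, (χ.comp (padicUnits p)) u = 1 := hχ'
  have key := hw.orbitCount_eq_of_hasOrbitCount (t := .C (p : ℤ_[p]))
    (fun h0 => hp0 (congrArg QuadraticAlgebra.re h0)) (hw.maximalIdeal_eq_span_of_unramified h) hχ
    (F := F) fun m u => (hw.unitsEquiv_mem_iff_of_unramified h m u).symm
  refine ⟨fun N hN => key 0 ?_, ?_⟩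
  · rwa [typeSet_zero_of_unramified hF hε]
  · rintro _ n N rfl hN
    refine key (n + 1) ?_
    rwa [typeSet_succ_of_unramified hF hε]

theorem orbitCount_of_unramified_of_odd (h : UnramifiedForm a b) (hp : p ≠ 2)
    (hn : ∀ u : ℤ_[p]ˣ, padicUnits p u ∈ normGroup p E) :
    orbitCount p E 0 = 1 ∧
    orbitCount p E 1 = (((p + 1).divisors \ Nat.divisors 1).card : ℕ) ∧
    ∀ n, orbitCount p E (n + 2) = ((p + 1).divisors.card : ℕ) := by
  obtain ⟨h0, h1⟩ := hw.orbitCount_of_unramified h hn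
  obtain ⟨g, hg, hx, hg'⟩ := h.exists_generator hp
  have hpr : p.Prime := Fact.out
  have hone : ∀ i : ℤ, (1 : (QuadraticAlgebra ℤ_[p] a b)ˣ) ^ i ∈ orderUnits a b 0 ↔
      ((1 : ℕ) : ℤ) ∣ i := by simp
  have hone' : ∀ i : ℤ, g ^ i ∈ orderUnits a b 0 ↔ ((1 : ℕ) : ℤ) ∣ i := fun i => by
    simp [mem_orderUnits_zero]
  have hgs : ∀ i l : ℤ, g ^ i * 1 ^ l ∈ orderUnits a b 1 ↔
      ((p + 1 : ℕ) : ℤ) ∣ i ∧ ((1 : ℕ) : ℤ) ∣ l := fun i l => by simpa using hg i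
  have hpf := powFiltration_one_of_odd (a := a) (b := b) hp
  have hmem : ∀ n : ℕ, ∀ i : ℤ, g ^ i ∈ orderUnits a b (1 + n) ↔
      (((p + 1) * p ^ n : ℕ) : ℤ) ∣ i := fun n i => by
    simpa using hpf.zpow_mul_zpow_mem_iff hgs hg' hpr n (by simp) i 0
  have hgen : ∀ n : ℕ, ∀ x, ∃ i : ℤ, ∃ y ∈ orderUnits a b (1 + n), x = y * g ^ i := fun n x => by
    obtain ⟨i, l, y, hy, hxy⟩ := hpf.exists_eq_mul_zpow_mul_zpow hgs hg' (fun x => by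
      obtain ⟨i, hi⟩ := hx x
      exact ⟨i, 0, by simpa using hi⟩) n x
    exact ⟨i, y, hy, by simpa using hxy⟩
  refine ⟨?_, ?_, fun n => ?_⟩
  · have := h0 _ (signFiltration_one.hasOrbitCount_agreeing le_rfl one_ne_zero hone
      (fun x => ⟨0, x, mem_orderUnits_zero x, by simp⟩) rfl)
    simpa using this
  · exact h1 1 0 _ rfl (signFiltration_one.hasOrbitCount_agreeing_diff (g := g) le_rfl zero_le_one
      (Nat.succ_ne_zero p) hg hone' (hgen 0) rfl)
  · have := h1 _ _ _ (by omega) (signFiltration_one.hasOrbitCount_agreeing_diff (g := g)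
      (k := 1 + (n + 1)) (k' := 1 + n) (Nat.zero_le _) (by omega)
      (mul_ne_zero (Nat.succ_ne_zero p) (pow_ne_zero _ hpr.ne_zero)) (hmem (n + 1)) (hmem n)
      (hgen (n + 1)) rfl)
    rw [show 1 + (n + 1) = n + 2 by omega] at this
    rw [this]
    exact congrArg _ (card_divisors_sdiff hpr (by simp) n)

end IsIntegralGenerator

/-- Modulo level `2 + n` the unit group is a product of cyclic groups of orders `3 * 2 ^ n` and `2`.
The two divisors of `3` and the two signs of `ψ s` give four orbits. -/
theorem IsIntegralGenerator.orbitCount_of_unramified_of_two {E : Type*} [Field E]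
    [Algebra ℚ_[2] E] [Algebra ℤ_[2] E] [IsScalarTower ℤ_[2] ℚ_[2] E]
    [Algebra.IsQuadraticExtension ℚ_[2] E] {w : E}
    (hw : IsIntegralGenerator (-1 : ℤ_[2]) (-1) w) (n : ℕ) : orbitCount 2 E (n + 3) = 4 := by
  obtain ⟨-, h1⟩ := hw.orbitCount_of_unramified unramifiedForm_two hw.padicUnits_mem_of_two
  obtain ⟨g, s, hgs, hx, hg, hs⟩ := powFiltration_two_unramified_generators
  have hpf := powFiltration_two_unramified (a := -1) (b := -1)
  have := h1 _ _ _ (by omega) (signFiltration_one.hasOrbitCount_agreeing_diff_two_mul (g := g) (s := s)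
    (k := 2 + (n + 1)) (k' := 2 + n) (Nat.zero_le _) (by omega)
    (mul_ne_zero three_ne_zero (pow_ne_zero _ two_ne_zero))
    (hpf.zpow_mul_zpow_mem_iff hgs hg Nat.prime_two (n + 1) (hs _))
    (hpf.zpow_mul_zpow_mem_iff hgs hg Nat.prime_two n (hs _))
    (hpf.exists_eq_mul_zpow_mul_zpow hgs hg hx (n + 1)) rfl rfl rfl)
  rw [card_divisors_sdiff Nat.prime_two (by norm_num), Nat.prime_three.divisors,
    show 2 + (n + 1) = n + 3 by omega] at this
  exact this

end UnramifiedCounts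

/-! ### Ramified extensions -/

section RamifiedCounts

variable {p : ℕ} [Fact p.Prime] {a b : ℤ_[p]} {E : Type*} [Field E] [Algebra ℚ_[p] E]
  [Algebra ℤ_[p] E] [IsScalarTower ℤ_[p] ℚ_[p] E] [Algebra.IsQuadraticExtension ℚ_[p] E] {w : E}

omit [Algebra ℤ_[p] E] [IsScalarTower ℤ_[p] ℚ_[p] E] [Algebra.IsQuadraticExtension ℚ_[p] E] in
theorem quadChar_eq_or (x : ℚ_[p]ˣ) : quadChar p E x = 1 ∨ quadChar p E x = -1 := by
  unfold quadChar
  split_ifs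
  · exact Or.inl rfl
  · exact Or.inr rfl

theorem EisensteinForm.dvd (h : EisensteinForm a b) : (p : ℤ_[p]) ∣ a :=
  h.2.elim fun _ hu => hu ▸ dvd_mul_right _ _

theorem EisensteinForm.exists_unit (h : EisensteinForm a b) {r : ℤ_[p]} (hr : ¬ (p : ℤ_[p]) ∣ r)
    (s : ℤ_[p]) : ∃ u : (QuadraticAlgebra ℤ_[p] a b)ˣ, u.1 = ⟨r, s⟩ :=
  ⟨((h.isUnit_iff ⟨r, s⟩).2 hr).unit, rfl⟩

theorem not_dvd_one : ¬ (p : ℤ_[p]) ∣ 1 := not_dvd_units 1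

theorem reChar_eq_one {ε : ℤ_[p]ˣ →* ℂˣ} {x : (QuadraticAlgebra ℤ_[p] a b)ˣ} (h : x.1.re = 1) :
    reChar ε x = 1 := by
  rw [reChar_eq (u := 1) (by simpa using h), map_one]

theorem IsIntegralGenerator.orbitCount_of_eisenstein (hw : IsIntegralGenerator a b w)
    (h : EisensteinForm a b) {χ : ℚ_[p]ˣ →* ℂˣ} (hχ : ∀ x, χ x = quadChar p E x) {c : ℕ}
    (hε : IsQuadraticOfConductor (χ.comp (padicUnits p)) c) :
    (∀ N, HasOrbitCount (agreeing (orderUnits a b) (reChar (χ.comp (padicUnits p))) c) N →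
      orbitCount p E (2 * c + 1) = N) ∧
    (∀ k k' N, k = k' + 1 → c ≤ k' →
      HasOrbitCount (agreeing (orderUnits a b) (reChar (χ.comp (padicUnits p))) k \
        agreeing (orderUnits a b) (reChar (χ.comp (padicUnits p))) k') N →
      orbitCount p E (2 * k) = N) ∧
    ∀ k, c < k → orbitCount p E (2 * k + 1) = 0 := by
  let F : ℕ → Set (QuadraticAlgebra ℤ_[p] a b)ˣ := fun m =>
    {u | (p : ℤ_[p]) ^ ((m + 1) / 2) ∣ u.1.re - 1 ∧ (p : ℤ_[p]) ^ (m / 2) ∣ u.1.im}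
  have hF : ∀ m u, u ∈ F m ↔
      (p : ℤ_[p]) ^ ((m + 1) / 2) ∣ u.1.re - 1 ∧ (p : ℤ_[p]) ^ (m / 2) ∣ u.1.im :=
    fun _ _ => Iff.rfl
  have key := hw.orbitCount_eq_of_hasOrbitCount (t := QuadraticAlgebra.omega)
    (fun h0 => one_ne_zero (congrArg QuadraticAlgebra.im h0))
    (hw.maximalIdeal_eq_span_of_eisenstein h) hχ
    (F := F) fun m u => (hw.unitsEquiv_mem_iff_of_eisenstein h m u).symm
  refine ⟨fun N hN => key _ ?_, ?_, fun k hk => key _ ?_⟩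
  · rwa [typeSet_two_mul_add_one_eq_agreeing hε h.dvd h.1 hF]
  · rintro _ k N rfl hk hN
    refine key _ ?_
    rwa [typeSet_even_eq_agreeing_diff hε h.dvd h.1 hF hk]
  · rw [typeSet_odd_eq_empty hε h.dvd h.1 hF hk]
    exact hasOrbitCount_empty

/-- The element `1 + p^j ω` generates the filtration from level `j` on. -/
theorem EisensteinForm.exists_generator (h : EisensteinForm a b) (j : ℕ) :
    ∃ g : (QuadraticAlgebra ℤ_[p] a b)ˣ, g.1 = ⟨1, (p : ℤ_[p]) ^ j⟩ ∧ g ∈ orderUnits a b j ∧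
      g ∉ orderUnits a b (j + 1) := by
  obtain ⟨g, hg⟩ := h.exists_unit not_dvd_one ((p : ℤ_[p]) ^ j)
  refine ⟨g, hg, ?_, ?_⟩
  · rw [mem_orderUnits, hg]
  · rw [not_mem_orderUnits_succ (c := 1) (by rw [hg, mul_one])]
    exact not_dvd_one

/-! ### Ramified extensions whose unit quotients are cyclic of `p`-power order -/

section Cyclic

variable {g : (QuadraticAlgebra ℤ_[p] a b)ˣ} (h : PowFiltration (orderUnits a b) p 0)
  (hg : g ∉ orderUnits a b 1)
include h hg

theorem zpow_mem_orderUnits_iff (n : ℕ) (i : ℤ) :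
    g ^ i ∈ orderUnits a b n ↔ ((p ^ n : ℕ) : ℤ) ∣ i := by
  simpa using h.zpow_mem_iff Fact.out (mem_orderUnits_zero g) hg n i

theorem exists_eq_mul_zpow_orderUnits (n : ℕ) (x : (QuadraticAlgebra ℤ_[p] a b)ˣ) :
    ∃ i : ℤ, ∃ y ∈ orderUnits a b n, x = y * g ^ i := by
  simpa using h.exists_eq_mul_zpow (mem_orderUnits_zero g) hg n (mem_orderUnits_zero x)

/-- The only divisor of `p ^ (k + 1)` that does not divide `p ^ k` is `p ^ (k + 1)` itself. -/
theorem hasOrbitCount_agreeing_diff_of_cyclic {ρ : (QuadraticAlgebra ℤ_[p] a b)ˣ → ℂˣ} {c k : ℕ}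
    (hρ : SignFiltration (orderUnits a b) ρ c) (hk : c ≤ k) (hgk : ρ (g ^ p ^ k) = 1) :
    HasOrbitCount (agreeing (orderUnits a b) ρ (k + 1) \ agreeing (orderUnits a b) ρ k) 1 := by
  have hp : p.Prime := Fact.out
  have := hρ.hasOrbitCount_agreeing_diff hk (Nat.le_succ k) (pow_ne_zero _ hp.ne_zero)
    (zpow_mem_orderUnits_iff h hg (k + 1)) (zpow_mem_orderUnits_iff h hg k)
    (exists_eq_mul_zpow_orderUnits h hg (k + 1)) hgk
  have e := card_divisors_sdiff hp (Nat.coprime_one_left p) k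
  rw [one_mul, one_mul, Nat.divisors_one, Finset.card_singleton] at e
  rwa [e] at this

end Cyclic

omit [Algebra ℤ_[p] E] [IsScalarTower ℤ_[p] ℚ_[p] E] [Algebra.IsQuadraticExtension ℚ_[p] E] in
theorem isQuadraticOfConductor_zero {χ : ℚ_[p]ˣ →* ℂˣ} (hχ : ∀ x, χ x = quadChar p E x)
    (h1 : ∀ u : ℤ_[p]ˣ, (p : ℤ_[p]) ∣ u - 1 → χ (padicUnits p u) = 1)
    (h2 : ∃ u : ℤ_[p]ˣ, χ (padicUnits p u) ≠ 1) :
    IsQuadraticOfConductor (χ.comp (padicUnits p)) 0 where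
  sign u := by
    rw [MonoidHom.comp_apply, hχ]
    exact quadChar_eq_or _
  trivial u hu := h1 u (by simpa using hu)
  nontrivial := h2.imp fun u hu => ⟨by simp, hu⟩

/-- Here `c = 0`, and agreement at level `0` determines `ψ` on the whole unit group. -/
theorem IsIntegralGenerator.orbitCount_one_of_odd {a : ℤ_[p]} (hw : IsIntegralGenerator a 0 w)
    (hp : p ≠ 2) (h : EisensteinForm a 0) : orbitCount p E 1 = 1 := by
  obtain ⟨χ, hχ, h1, h2⟩ := hw.exists_hom_of_odd hp h
  have hε := isQuadraticOfConductor_zero hχ h1 h2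
  have := (hw.orbitCount_of_eisenstein h hχ hε).1 _
    ((signFiltration_reChar hε h.dvd h.1).hasOrbitCount_agreeing (g := 1) (N := 1) le_rfl
      one_ne_zero (by simp) (fun x => ⟨0, x, mem_orderUnits_zero x, by simp⟩)
      (reChar_eq_one (by simp [QuadraticAlgebra.re_one])))
  simpa using this

theorem IsIntegralGenerator.orbitCount_odd_of_odd {a : ℤ_[p]} (hw : IsIntegralGenerator a 0 w)
    (hp : p ≠ 2) (h : EisensteinForm a 0) {k : ℕ} (hk : 0 < k) : orbitCount p E (2 * k + 1) = 0 := by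
  obtain ⟨χ, hχ, h1, h2⟩ := hw.exists_hom_of_odd hp h
  exact (hw.orbitCount_of_eisenstein h hχ (isQuadraticOfConductor_zero hχ h1 h2)).2.2 k hk

theorem IsIntegralGenerator.orbitCount_even_of_odd {a : ℤ_[p]} (hw : IsIntegralGenerator a 0 w)
    (hp : p ≠ 2) (h : EisensteinForm a 0) (hpf : PowFiltration (orderUnits a 0) p 0) (k : ℕ) :
    orbitCount p E (2 * (k + 1)) = 1 := by
  obtain ⟨χ, hχ, h1, h2⟩ := hw.exists_hom_of_odd hp h
  have hε := isQuadraticOfConductor_zero hχ h1 h2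
  have hρ := signFiltration_reChar hε h.dvd h.1
  obtain ⟨g, hg1, hg, hg'⟩ := h.exists_generator 0
  refine (hw.orbitCount_of_eisenstein h hχ hε).2.1 _ _ _ rfl (Nat.zero_le k)
    (hasOrbitCount_agreeing_diff_of_cyclic hpf hg' hρ (Nat.zero_le k) ?_)
  rw [hρ.map_pow_of_mem hg, reChar_eq_one (by rw [hg1]), one_pow]

end RamifiedCounts

/-! ### Ramified extensions of `ℚ_2` -/

section RamifiedTwo

variable {E : Type*} [Field E] [Algebra ℚ_[2] E] [Algebra ℤ_[2] E] [IsScalarTower ℤ_[2] ℚ_[2] E]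
  [Algebra.IsQuadraticExtension ℚ_[2] E] {w : E}

/-- Here `c = 2`, so the least conductor is `5`. The quotient `O^× / R 2` is cyclic of order `4`,
generated by `1 + ω`, and the three divisors of `4` are the possible orders. -/
theorem IsIntegralGenerator.orbitCount_of_two_zero {a : ℤ_[2]} (hw : IsIntegralGenerator a 0 w)
    {v : ℤ_[2]ˣ} (ha : a = (2 : ℕ) * v) :
    orbitCount 2 E 5 = 3 ∧ (∀ k, 3 ≤ k → orbitCount 2 E (2 * k) = 1) ∧
      ∀ k, 3 ≤ k → orbitCount 2 E (2 * k + 1) = 0 := by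
  have h := eisensteinForm_zero ha
  obtain ⟨χ, hχ, h1, h2⟩ := hw.exists_hom_of_two_zero ha
  have hε : IsQuadraticOfConductor (χ.comp (padicUnits 2)) 2 :=
    { sign := fun u => by
        rw [MonoidHom.comp_apply, hχ]
        exact quadChar_eq_or _
      trivial := h1
      nontrivial := h2 }
  have hρ := signFiltration_reChar hε h.dvd h.1
  obtain ⟨g, hg1, -, hg'⟩ := h.exists_generator 0
  have hpf : PowFiltration (orderUnits a 0) 2 0 :=
    powFiltration_two_ramified_zero (by exact_mod_cast h.dvd)
  have hg4 : g ^ 4 ∈ orderUnits a 0 2 := by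
    have := (zpow_mem_orderUnits_iff hpf hg' 2 4).2 (by norm_num)
    exact_mod_cast this
  have hρ4 : reChar (χ.comp (padicUnits 2)) (g ^ 4) = 1 := by
    obtain ⟨e, he⟩ := exists_eq_one_add_two_mul v
    -- The real part of `(1 + ω)^4` is `1 + 6 a + a² = 1 + 4 v (3 + v)`, which is `1` modulo `8`
    -- because `v` is odd.
    have hre : (g ^ 4).1.re = 1 + 2 ^ 3 * (2 + 5 * e + 2 * e ^ 2) := by
      rw [Units.val_pow_eq_pow_val, hg1]
      simp only [pow_succ, pow_zero, one_mul, QuadraticAlgebra.re_mul, QuadraticAlgebra.im_mul, ha,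
        he]
      push_cast
      ring
    rw [reChar_eq (u := (isUnit_re h.dvd h.1 (g ^ 4)).unit) rfl]
    refine h1 _ ?_
    rw [IsUnit.unit_spec, hre]
    exact ⟨_, add_sub_cancel_left _ _⟩
  obtain ⟨c1, c2, c3⟩ := hw.orbitCount_of_eisenstein h hχ hε
  refine ⟨?_, fun k hk => ?_, fun k hk => c3 k (by omega)⟩
  · have := c1 _ (hρ.hasOrbitCount_agreeing (g := g) (N := 2 ^ 2) le_rfl (by norm_num)
      (zpow_mem_orderUnits_iff hpf hg' 2) (exists_eq_mul_zpow_orderUnits hpf hg' 2) hρ4)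
    rw [Nat.divisors_prime_pow Nat.prime_two] at this
    simpa using this
  · obtain ⟨k, rfl⟩ := Nat.exists_eq_add_of_le hk
    refine c2 _ (2 + k) _ (by omega) (by omega) ?_
    rw [show 3 + k = 2 + k + 1 by omega]
    refine hasOrbitCount_agreeing_diff_of_cyclic hpf hg' hρ (by omega) ?_
    rw [pow_add, pow_mul, show 2 ^ 2 = 4 from rfl, hρ.map_pow_of_mem hg4, hρ4, one_pow]

/-- Here `c = 1`. The element `s = w - 1` has square `3 + 4 c`, a unit that is not a norm, so `ψ s`
is always `±i`. The count depends on whether these two values can be exchanged while fixing `ψ g`.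
-/
theorem IsIntegralGenerator.orbitCount_of_two_two {c : ℤ_[2]}
    (hw : IsIntegralGenerator (2 + 4 * c) 2 w) :
    orbitCount 2 E 3 = 1 ∧ orbitCount 2 E 4 = 1 ∧ (∀ k, 3 ≤ k → orbitCount 2 E (2 * k) = 2) ∧
      ∀ k, 2 ≤ k → orbitCount 2 E (2 * k + 1) = 0 := by
  have h := eisensteinForm_two c
  obtain ⟨χ, hχ, h1⟩ := hw.exists_hom_of_two_two
  have hsign : ∀ u, χ (padicUnits 2 u) = 1 ∨ χ (padicUnits 2 u) = -1 := fun u => by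
    rw [hχ]
    exact quadChar_eq_or _
  have h2 : ∀ x : ℤ_[2], (2 : ℤ_[2]) * x ≠ 1 := fun x h =>
    not_dvd_one (p := 2) ⟨x, by simpa using h.symm⟩
  have hu := isUnit_one_add_two_mul (1 + 2 * c)
  have hε3 : χ (padicUnits 2 hu.unit) = -1 := by
    refine (hsign _).resolve_left fun h3 => ?_
    obtain ⟨d, hd⟩ := (h1 _).1 h3
    rw [IsUnit.unit_spec] at hd
    have : (2 : ℤ_[2]) * (1 - 2 * (d - c)) = 2 * 0 := by linear_combination hd
    have := mul_left_cancel₀ two_ne_zero this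
    exact h2 (d - c) (by linear_combination -this)
  have hε : IsQuadraticOfConductor (χ.comp (padicUnits 2)) 1 :=
    { sign := hsign
      trivial := fun u hu => (h1 u).2 hu
      nontrivial := ⟨hu.unit, ⟨1 + 2 * c, by rw [IsUnit.unit_spec]; push_cast; ring⟩, by
        rw [MonoidHom.comp_apply, hε3]
        exact neg_one_ne_one_units⟩ }
  have hρ := signFiltration_reChar hε h.dvd h.1
  obtain ⟨g, hg1, hg, hg'⟩ := h.exists_generator 1
  have hρg : reChar (χ.comp (padicUnits 2)) g = 1 := reChar_eq_one (by rw [hg1])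
  obtain ⟨s, hs1⟩ := h.exists_unit (r := -1) (by rw [dvd_neg]; exact not_dvd_one) 1
  have hss : (s ^ 2).1 = ⟨3 + 4 * c, 0⟩ := by
    rw [Units.val_pow_eq_pow_val, hs1]
    ext
    · simp [pow_two]; ring
    · simp [pow_two]; ring
  have hs2 : ∀ n, s ^ 2 ∈ orderUnits (2 + 4 * c) 2 n := fun n => by
    rw [mem_orderUnits, hss]
    exact dvd_zero _
  have hs' : s ∉ orderUnits (2 + 4 * c) 2 (0 + 1) :=
    (not_mem_orderUnits_succ (c := 1) (by rw [hs1]; simp)).2 not_dvd_one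
  have hρs : reChar (χ.comp (padicUnits 2)) (s ^ 2) = -1 := by
    rw [reChar_eq (u := hu.unit) (by rw [hss, IsUnit.unit_spec]; ring)]
    exact hε3
  have hsR := zpow_mem_iff_of_prime Nat.prime_two (hs2 1) hs'
  have hx : ∀ x, ∃ l : ℤ, x * s ^ l ∈ orderUnits (2 + 4 * c) 2 1 := fun x => by
    obtain ⟨l, hl⟩ := Tame.exists_mul_pow_mem (Or.inr ⟨h.dvd, h.1⟩) (mem_orderUnits_zero x)
      (mem_orderUnits_zero s) hs'
    exact ⟨l, by simpa using hl⟩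
  have hpf := powFiltration_two_ramified_one (a := 2 + 4 * c)
  have hgs : ∀ i l : ℤ, g ^ i * s ^ l ∈ orderUnits (2 + 4 * c) 2 1 ↔
      ((1 : ℕ) : ℤ) ∣ i ∧ ((2 : ℕ) : ℤ) ∣ l := fun i l => by
    rw [Subgroup.mul_mem_cancel_left _ (zpow_mem hg i), hsR]
    simp
  have hg1' : g ^ 1 ∉ orderUnits (2 + 4 * c) 2 (1 + 1) := by rwa [pow_one]
  have hmem : ∀ n, ∀ i l : ℤ, g ^ i * s ^ l ∈ orderUnits (2 + 4 * c) 2 (1 + n) ↔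
      ((2 ^ n : ℕ) : ℤ) ∣ i ∧ ((2 : ℕ) : ℤ) ∣ l := fun n => by
    simpa using hpf.zpow_mul_zpow_mem_iff hgs hg1' Nat.prime_two n (hs2 _)
  have hgen := hpf.exists_eq_mul_zpow_mul_zpow hgs hg1' fun x => by
    obtain ⟨l, hl⟩ := hx x
    exact ⟨0, l, by simpa using hl⟩
  obtain ⟨c1, c2, c3⟩ := hw.orbitCount_of_eisenstein h hχ hε
  refine ⟨?_, ?_, fun k hk => ?_, fun k hk => c3 k (by omega)⟩
  -- At conductor `3` the quotient is generated by `s` alone, and order `4` is the only possible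
  -- order of `ψ s`.
  · refine c1 _ (hρ.hasOrbitCount_of_orderOf (g := s) (N := 2) (k := 1) le_rfl hsR (fun x => ?_) {4}
      (by simp) (fun ψ => ?_) fun x hx => ?_)
    · obtain ⟨l, hl⟩ := hx x
      exact ⟨-l, _, hl, by simp⟩
    · rw [Finset.mem_singleton, ← sq_eq_neg_one_iff]
      refine ⟨fun hψ => ⟨hψ, ?_⟩, fun h => h.1⟩
      rw [← map_pow, hψ _ (hs2 1), hρs]
    · rw [hρs, sq_eq_neg_one_iff]
      simpa using hx
  · exact c2 2 1 _ rfl le_rfl (hρ.hasOrbitCount_agreeing_diff_two_two le_rfl one_le_two (hmem 1)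
      (hmem 0) (hgen 1) hρg hρs)
  · obtain ⟨i, rfl⟩ := Nat.exists_eq_add_of_le hk
    refine c2 _ (1 + (i + 1)) _ (by omega) (by omega) ?_
    rw [show 3 + i = 1 + (i + 1 + 1) by omega]
    -- From conductor `6` on, the powers of `ψ g` contain a root of unity of order `4`, and `ψ s` is
    -- its first or third power, as its square must be `-1`.
    refine hρ.hasOrbitCount_agreeing_diff_of_prime_pow (L := 4) Nat.prime_two (by omega) (by omega)
      (hmem (i + 1 + 1)) (hmem (i + 1)) (hgen _) ?_ ⟨2 ^ i, by ring⟩ (fun y hy => ?_) {1, 3}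
      (by simp) fun x hx j hj => ?_
    · rw [hρ.map_pow_of_mem hg, hρg, one_pow]
    · rw [show 4 = 2 * 2 from rfl, pow_mul, hy, hρs]
      simp
    · have hx2 := sq_eq_neg_one_iff.2 hx
      rw [hρs, ← pow_mul, mul_comm, pow_mul, hx2]
      interval_cases j <;> simp [neg_one_ne_one_units.symm, pow_succ]

end RamifiedTwo

/-- The cube root of unity `s = (-1 + √-3) / 2` has exact level `0` and trivial cube, so the power
filtration starts at level `1` and `s` is a second generator of order `3`. At conductor `2` only `s`
matters; from conductor `4` on, `ψ s` can be any of the three powers of the cube root of unity given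
by `ψ g`. -/
theorem IsIntegralGenerator.orbitCount_of_neg_three {E : Type*} [Field E] [Algebra ℚ_[3] E]
    [Algebra ℤ_[3] E] [IsScalarTower ℤ_[3] ℚ_[3] E] [Algebra.IsQuadraticExtension ℚ_[3] E] {w : E}
    (hw : IsIntegralGenerator (-3 : ℤ_[3]) 0 w) :
    orbitCount 3 E 2 = 1 ∧ ∀ k, 2 ≤ k → orbitCount 3 E (2 * k) = 3 := by
  have h : EisensteinForm (-3 : ℤ_[3]) 0 := eisensteinForm_zero (u := -1) (by simp)
  obtain ⟨χ, hχ, h1, h2⟩ := hw.exists_hom_of_odd (by norm_num) h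
  have hε := isQuadraticOfConductor_zero hχ h1 h2
  have hρ := signFiltration_reChar hε h.dvd h.1
  obtain ⟨g, hg1, hg, hg'⟩ := h.exists_generator 1
  have hρg : reChar (χ.comp (padicUnits 3)) g = 1 := reChar_eq_one (by rw [hg1])
  obtain ⟨t, ht⟩ := (isUnit_two_of_ne (p := 3) (by norm_num)).exists_right_inv
  have htu : ¬ ((3 : ℕ) : ℤ_[3]) ∣ t := fun hd =>
    not_dvd_one (p := 3) (ht ▸ dvd_mul_of_dvd_right hd 2)
  obtain ⟨s, hs1⟩ := h.exists_unit (r := -t) (by rwa [dvd_neg]) t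
  have hs3 : s ^ 3 = 1 := by
    apply Units.ext
    rw [Units.val_pow_eq_pow_val, hs1]
    ext
    · simp [pow_succ, QuadraticAlgebra.re_one]
      linear_combination (4 * t ^ 2 + 2 * t + 1) * ht
    · simp [pow_succ, QuadraticAlgebra.im_one]
      ring
  have hs' : s ∉ orderUnits (-3 : ℤ_[3]) 0 (0 + 1) :=
    (not_mem_orderUnits_succ (c := t) (by rw [hs1]; simp)).2 htu
  have hsR := zpow_mem_iff_of_prime (H := orderUnits (-3 : ℤ_[3]) 0 1) Nat.prime_three
    (by rw [hs3]; exact one_mem _) hs'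
  have hx : ∀ x, ∃ l : ℤ, x * s ^ l ∈ orderUnits (-3 : ℤ_[3]) 0 1 := fun x => by
    obtain ⟨l, hl⟩ := Tame.exists_mul_pow_mem (Or.inr ⟨h.dvd, h.1⟩) (mem_orderUnits_zero x)
      (mem_orderUnits_zero s) hs'
    exact ⟨l, by simpa using hl⟩
  have hρs : reChar (χ.comp (padicUnits 3)) s = 1 := by
    rw [reChar_eq (u := (isUnit_re h.dvd h.1 s).unit) rfl]
    refine h1 _ ⟨-t, ?_⟩
    rw [IsUnit.unit_spec, hs1]
    push_cast
    linear_combination ht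
  have hρ3 : reChar (χ.comp (padicUnits 3)) (s ^ 3) = 1 := by
    rw [hs3, reChar_eq_one (by simp [QuadraticAlgebra.re_one])]
  have hpf := powFiltration_one_of_odd (p := 3) (a := -3) (b := 0) (by norm_num)
  have hgs : ∀ i l : ℤ, g ^ i * s ^ l ∈ orderUnits (-3 : ℤ_[3]) 0 1 ↔
      ((1 : ℕ) : ℤ) ∣ i ∧ ((3 : ℕ) : ℤ) ∣ l := fun i l => by
    rw [Subgroup.mul_mem_cancel_left _ (zpow_mem hg i), hsR]
    simp
  have hg1' : g ^ 1 ∉ orderUnits (-3 : ℤ_[3]) 0 (1 + 1) := by rwa [pow_one]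
  have hmem : ∀ n, ∀ i l : ℤ, g ^ i * s ^ l ∈ orderUnits (-3 : ℤ_[3]) 0 (1 + n) ↔
      ((3 ^ n : ℕ) : ℤ) ∣ i ∧ ((3 : ℕ) : ℤ) ∣ l := fun n => by
    simpa using hpf.zpow_mul_zpow_mem_iff hgs hg1' Nat.prime_three n
      (by rw [hs3]; exact one_mem _)
  have hgen := hpf.exists_eq_mul_zpow_mul_zpow hgs hg1' fun x => by
    obtain ⟨l, hl⟩ := hx x
    exact ⟨0, l, by simpa using hl⟩
  obtain ⟨-, c2, -⟩ := hw.orbitCount_of_eisenstein h hχ hε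
  refine ⟨?_, fun k hk => ?_⟩
  · have := c2 1 0 _ rfl le_rfl (hρ.hasOrbitCount_agreeing_diff (g := s) (N := 3) (N' := 1) le_rfl
      zero_le_one three_ne_zero hsR (fun i => by simp [mem_orderUnits_zero]) (fun x => ?_)
      (by rwa [pow_one]))
    · rw [Nat.prime_three.divisors] at this
      exact this
    · obtain ⟨l, hl⟩ := hx x
      exact ⟨-l, _, hl, by simp⟩
  · obtain ⟨i, rfl⟩ := Nat.exists_eq_add_of_le hk
    refine c2 _ (1 + i) _ (by omega) (by omega) ?_
    rw [show 2 + i = 1 + (i + 1) by omega]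
    refine hρ.hasOrbitCount_agreeing_diff_of_prime_pow (L := 3) Nat.prime_three (by omega) (by omega)
      (hmem (i + 1)) (hmem i) (hgen _) ?_ ⟨3 ^ i, by ring⟩ (fun y hy => by rw [hy, hρ3])
      (Finset.range 3) (by simp) fun x hx j hj => ?_
    · rw [hρ.map_pow_of_mem (hρ.anti (Nat.zero_le 1) hg), hρg, one_pow]
    · rw [hρ3, ← pow_mul, mul_comm, pow_mul, show x ^ 3 = 1 by rw [← hx, pow_orderOf_eq_one]]
      simpa using hj

/-! ### Assembly -/

section Assembly

theorem powFiltration_zero_of_odd {p : ℕ} [Fact p.Prime] {E : Type*} [Field E] [Algebra ℚ_[p] E]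
    [Algebra ℤ_[p] E] [IsScalarTower ℤ_[p] ℚ_[p] E] [Algebra.IsQuadraticExtension ℚ_[p] E] {w : E}
    {a : ℤ_[p]} (hw : IsIntegralGenerator a 0 w) (hp : p ≠ 2) {u : ℤ_[p]ˣ} (ha : a = p * u)
    (h3 : ¬ (p = 3 ∧ ∃ x : E, x ^ 2 = -3)) : PowFiltration (orderUnits a 0) p 0 := by
  have hpr : p.Prime := Fact.out
  by_cases hp3 : p = 3
  · subst hp3
    refine powFiltration_three_zero (c := u) (by simpa using ha) fun hd => h3 ⟨rfl, ?_⟩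
    -- If `3 ∣ u + 1`, then `-u` is congruent to `1` modulo `3`, hence a square `z²`. From `w² = 3 u
    -- = -3 z²` it follows that `w / z` is a square root of `-3`, which `h3` excludes.
    obtain ⟨z, hz⟩ : IsSquare (-(u : ℤ_[3])) := by
      have := isSquare_one_add_of_dvd (p := 3) (by norm_num) (t := -((u : ℤ_[3]) + 1))
        (by rw [dvd_neg]; exact_mod_cast hd)
      rwa [show 1 + -((u : ℤ_[3]) + 1) = -u by ring] at this
    have hz0 : algebraMap ℤ_[3] E z ≠ 0 := by
      intro h0
      rw [← map_zero (algebraMap ℤ_[3] E)] at h0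
      have hinj : Function.Injective (algebraMap ℤ_[3] E) := by
        rw [IsScalarTower.algebraMap_eq ℤ_[3] ℚ_[3] E]
        exact (algebraMap ℚ_[3] E).injective.comp (IsFractionRing.injective ℤ_[3] ℚ_[3])
      rw [hinj h0, mul_zero, neg_eq_zero] at hz
      exact u.ne_zero hz
    refine ⟨w / algebraMap ℤ_[3] E z, ?_⟩
    have hww := hw.mul_self
    have hz2 : algebraMap ℤ_[3] E u = -(algebraMap ℤ_[3] E z * algebraMap ℤ_[3] E z) := by
      rw [← map_mul, ← hz, map_neg, neg_neg]
    rw [div_pow, div_eq_iff (pow_ne_zero _ hz0), pow_two, hww, ha]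
    simp only [map_mul, map_zero, zero_mul, add_zero, hz2]
    rw [map_natCast]
    push_cast
    ring
  · refine powFiltration_zero_of_five_le ?_ (ha ▸ dvd_mul_right _ _)
    have := hpr.two_le
    rcases hpr.eq_two_or_odd with h | h
    · exact absurd h hp
    · omega

theorem valuation_eq_zero_of_isUnit {p : ℕ} [Fact p.Prime] {x : ℤ_[p]} (hx : IsUnit x) :
    x.valuation = 0 := by
  obtain ⟨y, hy⟩ := hx.exists_right_inv
  have h := PadicInt.valuation_mul hx.ne_zero (right_ne_zero_of_mul_eq_one hy)
  rw [hy, PadicInt.valuation_one] at h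
  omega

theorem isIntegralGenerator_neg_three {E : Type*} [Field E] [Algebra ℚ_[3] E] [Algebra ℤ_[3] E]
    [IsScalarTower ℤ_[3] ℚ_[3] E] {x : E} (hx : x ^ 2 = -3) :
    IsIntegralGenerator (-3 : ℤ_[3]) 0 x :=
  ⟨by rw [← pow_two, hx, map_neg, map_ofNat, map_zero, zero_mul, add_zero], (eisensteinForm_zero (u := -1) (by simp)).primitive⟩

variable {E : Type*} [Field E] [Algebra ℚ_[2] E] [Algebra ℤ_[2] E] [IsScalarTower ℤ_[2] ℚ_[2] E]
  [Algebra.IsQuadraticExtension ℚ_[2] E] {w : E}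

theorem hasDiscrValuation_two_zero {a : ℤ_[2]} (hw : IsIntegralGenerator a 0 w) {u : ℤ_[2]ˣ}
    (ha : a = (2 : ℕ) * u) {δ : ℕ} (h : HasDiscrValuation 2 E δ) : δ = 3 := by
  rw [← hw.valuation_discr h, ha,
    show (0 : ℤ_[2]) ^ 2 + 4 * ((2 : ℕ) * (u : ℤ_[2])) = ((2 : ℕ) : ℤ_[2]) ^ 3 * u by
      push_cast; ring, PadicInt.valuation_p_pow_mul _ _ u.ne_zero, valuation_eq_zero_of_isUnit u.isUnit]

theorem hasDiscrValuation_two_two {c : ℤ_[2]} (hw : IsIntegralGenerator (2 + 4 * c) 2 w) {δ : ℕ}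
    (h : HasDiscrValuation 2 E δ) : δ = 2 := by
  have hu := isUnit_one_add_two_mul (1 + 2 * c)
  rw [← hw.valuation_discr h,
    show (2 : ℤ_[2]) ^ 2 + 4 * (2 + 4 * c) = ((2 : ℕ) : ℤ_[2]) ^ 2 * (1 + 2 * (1 + 2 * c)) by
      push_cast; ring, PadicInt.valuation_p_pow_mul _ _ hu.ne_zero, valuation_eq_zero_of_isUnit hu]

end Assembly

end LocalChar

end

theorem mainTheorem9 (p : ℕ) [Fact p.Prime] (E : Type*) [Field E] [Algebra ℚ_[p] E]
    [Algebra ℤ_[p] E] [IsScalarTower ℤ_[p] ℚ_[p] E] [Algebra.IsQuadraticExtension ℚ_[p] E] :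
    -- `E` unramified, `p` odd
    (LocalChar.ramIndex p E = 1 → p ≠ 2 →
      LocalChar.orbitCount p E 0 = 1 ∧
      LocalChar.orbitCount p E 1 + 1 = (ArithmeticFunction.sigma 0 (p + 1) : ℕ) ∧
      ∀ n : ℕ, 2 ≤ n →
        LocalChar.orbitCount p E n = (ArithmeticFunction.sigma 0 (p + 1) : ℕ)) ∧
    -- `E` unramified, `p = 2`
    (LocalChar.ramIndex p E = 1 → p = 2 → ∀ n : ℕ, 3 ≤ n → LocalChar.orbitCount p E n = 4) ∧
    -- `E` ramified, `p` odd, conductor `1`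
    (LocalChar.ramIndex p E = 2 → p ≠ 2 → LocalChar.orbitCount p E 1 = 1) ∧
    -- `E` ramified, `p` odd, `E` not isomorphic to `ℚ_3(√-3)`
    (LocalChar.ramIndex p E = 2 → p ≠ 2 → ¬ (p = 3 ∧ ∃ x : E, x ^ 2 = -3) → ∀ n : ℕ, 2 ≤ n →
      (Odd n → LocalChar.orbitCount p E n = 0) ∧ (Even n → LocalChar.orbitCount p E n = 1)) ∧
    -- `E` ramified, `p = 2`, discriminant of valuation `3`
    (LocalChar.ramIndex p E = 2 → p = 2 → LocalChar.HasDiscrValuation p E 3 →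
      LocalChar.orbitCount p E 5 = 3 ∧
      ∀ n : ℕ, 6 ≤ n →
        (Odd n → LocalChar.orbitCount p E n = 0) ∧ (Even n → LocalChar.orbitCount p E n = 1)) ∧
    -- `E = ℚ_3(√-3)`
    (p = 3 → (∃ x : E, x ^ 2 = -3) →
      LocalChar.orbitCount p E 2 = 1 ∧
      ∀ n : ℕ, 3 ≤ n →
        (Odd n → LocalChar.orbitCount p E n = 0) ∧ (Even n → LocalChar.orbitCount p E n = 3)) ∧
    -- `E` ramified, `p = 2`, discriminant of valuation `2`
    (LocalChar.ramIndex p E = 2 → p = 2 → LocalChar.HasDiscrValuation p E 2 →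
      LocalChar.orbitCount p E 3 = 1 ∧ LocalChar.orbitCount p E 4 = 1 ∧
      ∀ n : ℕ, 6 ≤ n →
        (Odd n → LocalChar.orbitCount p E n = 0) ∧ (Even n → LocalChar.orbitCount p E n = 2)) := by
  open LocalChar in
  obtain ⟨a, b, w, hw, h⟩ := exists_isIntegralGenerator p E
  have heven : ∀ {n m : ℕ}, 2 * m ≤ n → Even n → ∃ k, m ≤ k ∧ n = 2 * k := by
    rintro n m hn ⟨k, hk⟩
    exact ⟨k, by omega, by omega⟩
  have hodd : ∀ {n m : ℕ}, 2 * m ≤ n → Odd n → ∃ k, m ≤ k ∧ n = 2 * k + 1 := by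
    rintro n m hn ⟨k, hk⟩
    exact ⟨k, by omega, by omega⟩
  -- This case uses `√-3` as integral generator in place of `w`, so it holds whichever normal form
  -- `w` has.
  have h6 : p = 3 → (∃ x : E, x ^ 2 = -3) → orbitCount p E 2 = 1 ∧ ∀ n : ℕ, 3 ≤ n →
      (Odd n → orbitCount p E n = 0) ∧ (Even n → orbitCount p E n = 3) := by
    rintro rfl ⟨x, hx⟩
    have hg := isIntegralGenerator_neg_three hx
    obtain ⟨h1, h2⟩ := hg.orbitCount_of_neg_three
    refine ⟨h1, fun n hn => ⟨fun ho => ?_, fun he => ?_⟩⟩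
    · obtain ⟨k, hk, rfl⟩ := hodd (m := 1) (by omega) ho
      exact hg.orbitCount_odd_of_odd (by norm_num) (eisensteinForm_zero (u := -1) (by simp)) hk
    · obtain ⟨k, hk, rfl⟩ := heven (m := 1) (by omega) he
      exact h2 k (by omega)
  -- Each normal form determines the ramification index and, in the ramified cases over `ℚ_2`, the
  -- valuation of the discriminant. The conjuncts that belong to other forms are then vacuous.
  rcases h with ⟨hp, rfl, ha⟩ | ⟨rfl, rfl, rfl⟩ | ⟨hp, rfl, u, ha⟩ | ⟨rfl, rfl, u, ha⟩ |
    ⟨rfl, rfl, c, rfl⟩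
  · have hu := unramifiedForm_of_not_isSquare ha
    have he := hw.ramIndex_of_unramified hu
    refine ⟨fun _ _ => ?_, fun _ h => absurd h hp, fun h => by omega, fun h => by omega,
      fun h => by omega, h6, fun h => by omega⟩
    obtain ⟨h0, h1, h2⟩ := hw.orbitCount_of_unramified_of_odd hu hp
      (hw.padicUnits_mem_of_not_isSquare hp ha)
    rw [ArithmeticFunction.sigma_zero_apply]
    refine ⟨h0, ?_, fun n hn => ?_⟩
    · rw [h1, Nat.divisors_one, ← Finset.erase_eq]
      exact_mod_cast Finset.card_erase_add_one (Nat.one_mem_divisors.2 (Nat.succ_ne_zero p))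
    · obtain ⟨n, rfl⟩ := Nat.exists_eq_add_of_le' hn
      exact h2 n
  · have he := hw.ramIndex_of_unramified unramifiedForm_two
    refine ⟨fun _ h => absurd rfl h, fun _ _ n hn => ?_, fun h => by omega, fun h => by omega,
      fun h => by omega, h6, fun h => by omega⟩
    obtain ⟨n, rfl⟩ := Nat.exists_eq_add_of_le' hn
    exact hw.orbitCount_of_unramified_of_two n
  · have hE := eisensteinForm_zero ha
    have he := hw.ramIndex_of_eisenstein hE
    refine ⟨fun h => by omega, fun h => by omega, fun _ _ => hw.orbitCount_one_of_odd hp hE,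
      fun _ _ h3 n hn => ⟨fun ho => ?_, fun he => ?_⟩, fun _ h => absurd h hp, h6,
      fun _ h => absurd h hp⟩
    · obtain ⟨k, hk, rfl⟩ := hodd (m := 1) (by omega) ho
      exact hw.orbitCount_odd_of_odd hp hE hk
    · obtain ⟨k, hk, rfl⟩ := heven (m := 1) (by omega) he
      obtain ⟨k, rfl⟩ := Nat.exists_eq_add_of_le' hk
      exact hw.orbitCount_even_of_odd hp hE (powFiltration_zero_of_odd hw hp ha h3) k
  · have he := hw.ramIndex_of_eisenstein (eisensteinForm_zero ha)
    obtain ⟨h1, h2, h3⟩ := hw.orbitCount_of_two_zero ha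
    refine ⟨fun h => by omega, fun h => by omega, fun _ h => absurd rfl h, fun _ h => absurd rfl h,
      fun _ _ _ => ⟨h1, fun n hn => ⟨fun ho => ?_, fun he => ?_⟩⟩, h6,
      fun _ _ hd => absurd (hasDiscrValuation_two_zero hw ha hd) (by norm_num)⟩
    · obtain ⟨k, hk, rfl⟩ := hodd (m := 3) (by omega) ho
      exact h3 k hk
    · obtain ⟨k, hk, rfl⟩ := heven (m := 3) (by omega) he
      exact h2 k hk
  · have he := hw.ramIndex_of_eisenstein (eisensteinForm_two c)
    obtain ⟨h1, h2, h3, h4⟩ := hw.orbitCount_of_two_two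
    refine ⟨fun h => by omega, fun h => by omega, fun _ h => absurd rfl h, fun _ h => absurd rfl h,
      fun _ _ hd => absurd (hasDiscrValuation_two_two hw hd) (by norm_num), h6,
      fun _ _ _ => ⟨h1, h2, fun n hn => ⟨fun ho => ?_, fun he => ?_⟩⟩⟩
    · obtain ⟨k, hk, rfl⟩ := hodd (m := 3) (by omega) ho
      exact h4 k (by omega)
    · obtain ⟨k, hk, rfl⟩ := heven (m := 3) (by omega) he
      exact h3 k hk
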